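/- Let $G$ be a Kleinian group, i.e. a discrete group of orientation-preserving isometries of hyperbolic space $\mathbb H^3$, and let $P$ be an ideal polyhedron (the convex hull of finitely many points of the sphere at infinity, with nonempty interior, taken together with its ideal vertices) that is a fundamental polyhedron of $G$: the translates $gP$, $g\in G$, cover $\mathbb H^3$, the translates of the interior of $P$ by non-identity elements of $G$ are disjoint from it, and for each face $\sigma$ of $P$ there is a face pairing $g\in G$, meaning that $g(\sigma)=\sigma'$ is again a face of $P$ and $g(P)\cap P=\sigma'$. Call two edges (respectively two vertices) of $P$ equivalent if they are related by the equivalence relation generated by: $a\sim g(a)$ whenever $g$ is the face pairing of a face $\sigma$ and $a$ lies in $\sigma$. The equivalence classes are the edge classes (respectively vertex classes). Assume that * no face pairing is elliptic (an isometry is elliptic if it is not the identity and fixes a point of $\mathbb H^3$); * for each edge class, the interior dihedral angles of $P$ at the edges of that class sum to $2\pi$. Let $\overline E$ and $\overline V$ be the numbers of edges and (ideal) vertices of $P$, and let $E$ and $V$ be the numbers of edge classes and vertex classes. Then $$E=\frac{\overline E-\overline V}{2}.$$ Moreover, let $q=\sum_{k=0}^{3}(-1)^k c_k$ be the Euler characteristic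 of the quotient space obtained from $P$ (with its ideal vertices) by gluing its faces along the face pairings, where $c_k$ is the number of its $k$-cells, the images of the relative interiors of the $k$-dimensional faces of $P$ ($P$ itself being its 3-dimensional face). Then $V=q$. -/

import Mathlib

/-!
Hyperbolic 3-space in the Klein (projective) model: the open unit ball of Euclidean 3-space, with
ideal boundary the unit sphere.  A point `x` is the line through `(1, x)` in Minkowski space
`ℝ^{1,3}` (coordinate `0` is time); geodesic lines, planes and hyperbolically convex sets are
the Euclidean ones, and the orientation-preserving isometries are the elements of `SO⁺(1,3)`,
acting projectively.
-/

noncomputable section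

namespace KleinianPolyhedron

/-- The ambient space of the Klein model. -/
abbrev E3 : Type := EuclideanSpace ℝ (Fin 3)

/-- Hyperbolic 3-space: the open unit ball. -/
def hyperbolicSpace : Set E3 := Metric.ball 0 1

/-- The sphere at infinity: the unit sphere. -/
def idealBoundary : Set E3 := Metric.sphere 0 1

/-- The Minkowski form `-X₀Y₀ + X₁Y₁ + X₂Y₂ + X₃Y₃`. -/
def mink (X Y : Fin 4 → ℝ) : ℝ := -(X 0 * Y 0) + ∑ i : Fin 3, X i.succ * Y i.succ

/-- The homogeneous coordinates `(1, x)` of a point `x`. -/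
def homog (x : E3) : Fin 4 → ℝ := Fin.cons 1 (fun i : Fin 3 => x i)

/-- The point of the Klein model with homogeneous coordinates `X`. -/
def dehomog (X : Fin 4 → ℝ) : E3 := WithLp.toLp 2 (fun i : Fin 3 => X i.succ / X 0)

/-- The projective action of a matrix on points.  For `g` in `SO⁺(1,3)` and `‖x‖ ≤ 1` the time
coordinate of `g (1, x)` is positive, so the division is meaningful. -/
def act (g : Matrix.GeneralLinearGroup (Fin 4) ℝ) (x : E3) : E3 :=
  dehomog ((g : Matrix (Fin 4) (Fin 4) ℝ).mulVec (homog x))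

/-- `g` is an orientation-preserving isometry of hyperbolic 3-space: an element of `SO⁺(1,3)`. -/
structure IsOrientedIsometry (g : Matrix.GeneralLinearGroup (Fin 4) ℝ) : Prop where
  form : ∀ X Y : Fin 4 → ℝ,
    mink ((g : Matrix (Fin 4) (Fin 4) ℝ).mulVec X) ((g : Matrix (Fin 4) (Fin 4) ℝ).mulVec Y)
      = mink X Y
  det : (g : Matrix (Fin 4) (Fin 4) ℝ).det = 1
  time : 0 < (g : Matrix (Fin 4) (Fin 4) ℝ) 0 0

/-- A Kleinian group: a discrete group of orientation-preserving isometries. -/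
structure IsKleinian (G : Subgroup (Matrix.GeneralLinearGroup (Fin 4) ℝ)) : Prop where
  isometry : ∀ g ∈ G, IsOrientedIsometry g
  discrete : DiscreteTopology G

/-- An isometry is elliptic if it is not the identity and fixes a point of hyperbolic space. -/
def IsElliptic (g : Matrix.GeneralLinearGroup (Fin 4) ℝ) : Prop :=
  g ≠ 1 ∧ ∃ x ∈ hyperbolicSpace, act g x = x

/-- A (convex, nondegenerate, finite-sided) ideal polyhedron, together with its ideal vertices:
the convex hull of finitely many points at infinity, with nonempty interior. -/
def IsIdealPolyhedron (P : Set E3) : Prop :=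
  ∃ S : Set E3, S.Finite ∧ S ⊆ idealBoundary ∧ P = convexHull ℝ S ∧ (interior P).Nonempty

/-- The `k`-dimensional faces of `P`: vertices for `k = 0` (as singletons), edges for `k = 1`,
polygonal faces for `k = 2`, and `P` itself for `k = 3`. -/
def faces (P : Set E3) (k : ℕ) : Set (Set E3) :=
  {F | F.Nonempty ∧ IsExposed ℝ P F ∧ Module.finrank ℝ (vectorSpan ℝ F) = k}

/-- `g` is the face pairing transformation of `G` that carries the polygonal face `F` of `P` to a
face `g F` of `P`, the polyhedra `g P` and `P` meeting exactly along `g F`. -/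
structure IsFacePairing (G : Subgroup (Matrix.GeneralLinearGroup (Fin 4) ℝ)) (P F : Set E3)
    (g : Matrix.GeneralLinearGroup (Fin 4) ℝ) : Prop where
  mem : g ∈ G
  source : F ∈ faces P 2
  target : act g '' F ∈ faces P 2
  inter : act g '' P ∩ P = act g '' F

/-- `P` is a fundamental polyhedron of `G`: the translates of `P` fill hyperbolic space without
overlap on interiors, and the faces of `P` are matched by face pairings. -/
structure IsFundamentalPolyhedron (G : Subgroup (Matrix.GeneralLinearGroup (Fin 4) ℝ))
    (P : Set E3) : Prop where
  cover : ∀ x ∈ hyperbolicSpace, ∃ g ∈ G, x ∈ act g '' P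
  disjoint : ∀ g ∈ G, g ≠ 1 → Disjoint (act g '' interior P) (interior P)
  pairing : ∀ F ∈ faces P 2, ∃ g, IsFacePairing G P F g

/-- `N` is the outward unit normal (in Minkowski space) of the hyperbolic plane that contains the
face `F` of `P`. -/
structure IsOutwardUnitNormal (P F : Set E3) (N : Fin 4 → ℝ) : Prop where
  unit : mink N N = 1
  nonpos : ∀ x ∈ P, mink N (homog x) ≤ 0
  face : F = {x ∈ P | mink N (homog x) = 0}

/-- `θ` is the hyperbolic interior dihedral angle of `P` at `e`: there are two distinct faces of
`P` containing `e` and `π - θ` is the angle between their outward unit normals. -/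
def IsDihedralAngle (P e : Set E3) (θ : ℝ) : Prop :=
  ∃ F ∈ faces P 2, ∃ F' ∈ faces P 2, F ≠ F' ∧ e ⊆ F ∧ e ⊆ F' ∧
    ∃ N N' : Fin 4 → ℝ, IsOutwardUnitNormal P F N ∧ IsOutwardUnitNormal P F' N' ∧
      θ = Real.pi - Real.arccos (mink N N')

/-- The interior dihedral angle of `P` at the edge `e`.  (For an edge of an ideal polyhedron
there is exactly one `θ` as in `IsDihedralAngle`.) -/
def dihedralAngle (P e : Set E3) : ℝ := Classical.epsilon (IsDihedralAngle P e)

/-- Two `k`-dimensional faces are directly identified if a face pairing, applied to the paired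
face in which the first one lies, carries the first one to the second. -/
def identified (G : Subgroup (Matrix.GeneralLinearGroup (Fin 4) ℝ)) (P : Set E3) (k : ℕ)
    (A B : faces P k) : Prop :=
  ∃ F g, IsFacePairing G P F g ∧ (A : Set E3) ⊆ F ∧ (B : Set E3) = act g '' (A : Set E3)

/-- Classes of `k`-dimensional faces under the equivalence relation generated by the face
pairings: vertex classes for `k = 0`, edge classes for `k = 1`. -/
def FaceClass (G : Subgroup (Matrix.GeneralLinearGroup (Fin 4) ℝ)) (P : Set E3) (k : ℕ) : Type :=
  Quot (identified G P k)

/-- The class of a face. -/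
def faceClass (G : Subgroup (Matrix.GeneralLinearGroup (Fin 4) ℝ)) (P : Set E3) (k : ℕ)
    (A : faces P k) : FaceClass G P k :=
  Quot.mk _ A

/-- The quotient space: `P` (with its ideal vertices), each point of a polygonal face being glued
to its image under the face pairing. -/
def QuotientSpace (G : Subgroup (Matrix.GeneralLinearGroup (Fin 4) ℝ)) (P : Set E3) : Type :=
  Quot (fun x y : P => ∃ F g, IsFacePairing G P F g ∧ (x : E3) ∈ F ∧ (y : E3) = act g x)

instance (G : Subgroup (Matrix.GeneralLinearGroup (Fin 4) ℝ)) (P : Set E3) :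
    TopologicalSpace (QuotientSpace G P) :=
  inferInstanceAs (TopologicalSpace (Quot _))

/-- The open `k`-cells of the quotient space: the images of the relative interiors of the
`k`-dimensional faces of `P`. -/
def quotientCells (G : Subgroup (Matrix.GeneralLinearGroup (Fin 4) ℝ)) (P : Set E3) (k : ℕ) :
    Set (Set (QuotientSpace G P)) :=
  {c | ∃ A ∈ faces P k, c = Quot.mk _ '' {x : P | (x : E3) ∈ intrinsicInterior ℝ A}}

/-- The Euler characteristic of the quotient space: the alternating sum, over the dimensions
`0, 1, 2, 3`, of the numbers of cells. -/
def quotientEulerChar (G : Subgroup (Matrix.GeneralLinearGroup (Fin 4) ℝ)) (P : Set E3) : ℤ :=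
  ∑ k ∈ Finset.range 4, (-1) ^ k * ((quotientCells G P k).ncard : ℤ)

end KleinianPolyhedron

end

open KleinianPolyhedron

open KleinianPolyhedron

set_option linter.unusedSectionVars false

/-! Two facts about a convex ideal polyhedron carry the theorem. The first is Euler's formula. The
second says that the exterior dihedral angles at the edges issuing from an ideal vertex sum to `2π`,
because the link of an ideal vertex is a Euclidean polygon. Summing the second fact over all
vertices counts each edge twice, so the interior angles sum to `π (Ē - V̄)`. By hypothesis they also
sum to `2π E`, one `2π` for each edge class, and the first claim follows.

For the second claim, the open cells of the quotient correspond to the classes of faces of `P`. Each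
polygonal face has only one pairing, and no face is paired with itself: an isometry that preserves a
polygonal face permutes its ideal vertices and so fixes a point of hyperbolic space, which makes it
elliptic. The pairing is therefore a fixed-point-free involution, so there are `F̄ / 2` face
classes. Hence `q = V - E + F̄ / 2 - 1`, and this is `V` by Euler's formula and the first claim.

Both facts are obtained by linear algebra in the cone over `P` in Minkowski space, whose generators
are null vectors. A face is the set of generators at which some nonnegative functional vanishes. A
plane of functionals that contains a positive one cuts the cone of nonnegative functionals in two
extreme rays (`exists_extreme_pair`). This gives the two facets at an edge, the two edges of a facet
at a vertex, and the two tangents to a polygon from a generic outer point.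

Euler's formula (`IsVertexFamily.euler`) is a double count. A generic line through an interior point
meets the plane of each facet `F` in a point `Y F`, and the pairs `(v, F)` are counted for which the
line from `v` to `Y F` is tangent to `F`. A facet contributes two pairs, except the first and the
last facet along the line, which contribute none. A vertex contributes its number of facets minus
two. Hence `2E - 2V = 2(F - 2)`.

The angle sum (`sum_exterior_angles`) is a Crofton argument. The angle between two unit vectors of a
plane is half the measure of the set of directions that separate them, and almost every direction
separates the facet normals at exactly two of the edges issuing from the vertex. The exterior angles
therefore sum to half the integral of `2` over `[0, 2π]`. -/

namespace IdealPolyhedra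

/-! ### Extreme rays of planar cones of functionals -/

open Module

/-- The cone of nonnegative elements of a plane of functions has exactly two extreme rays. -/
theorem exists_extreme_pair {ι V : Type*} [Finite ι] [AddCommGroup V] [Module ℝ V]
    (ev : ι → Dual ℝ V) (hV : finrank ℝ V = 2) (hinj : ∀ l, (∀ i, ev i l = 0) → l = 0)
    (h : V) (hpos : ∀ i, 0 < ev i h) :
    ∃ a b : V, (∀ i, 0 ≤ ev i a) ∧ (∀ i, 0 ≤ ev i b) ∧ (∃ i, ev i a = 0 ∧ 0 < ev i b) ∧
      (∃ i, ev i b = 0 ∧ 0 < ev i a) ∧ (∀ i, 0 < ev i a ∨ 0 < ev i b) ∧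
      ∀ l, (∀ i, 0 ≤ ev i l) → ∃ α β : ℝ, 0 ≤ α ∧ 0 ≤ β ∧ l = α • a + β • b := by
  have : Nontrivial V := Module.nontrivial_of_finrank_pos (R := ℝ) (by omega)
  have hfd : FiniteDimensional ℝ V := Module.finite_of_finrank_pos (by omega)
  have hne : Nonempty ι := by
    by_contra hc
    rw [not_nonempty_iff] at hc
    obtain ⟨w, hw⟩ := exists_ne (0 : V)
    exact hw (hinj w fun i => hc.elim i)
  have hh : h ≠ 0 := by
    rintro rfl
    obtain ⟨i⟩ := hne
    simpa using hpos i
  obtain ⟨g, hg⟩ : ∃ g : V, ∀ l : V, ∃ α β : ℝ, l = α • h + β • g := by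
    have h1 : finrank ℝ (Submodule.span ℝ {h}) = 1 := finrank_span_singleton hh
    obtain ⟨g, hg⟩ : ∃ g, g ∉ Submodule.span ℝ {h} := by
      by_contra! hc
      have : Submodule.span ℝ {h} = ⊤ := by ext; simp [hc]
      rw [this, finrank_top] at h1
      omega
    have hli : LinearIndependent ℝ ![h, g] := by
      rw [LinearIndependent.pair_iff' hh]
      intro a ha
      exact hg (Submodule.mem_span_singleton.2 ⟨a, ha⟩)
    have htop := hli.span_eq_top_of_card_eq_finrank (by simp [hV])
    refine ⟨g, fun l => ?_⟩
    have hl : l ∈ Submodule.span ℝ (Set.range ![h, g]) := htop ▸ Submodule.mem_top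
    simp only [Matrix.range_cons, Matrix.range_empty, Set.union_empty, Set.singleton_union] at hl
    obtain ⟨α, β, e⟩ := Submodule.mem_span_pair.1 hl
    exact ⟨α, β, e.symm⟩
  -- Positivity of `α h + β g` at `i` depends only on the ratio of the values of `g` and `h` there.
  -- The largest and the smallest ratio give the two binding constraints, hence the extreme rays `q
  -- M • h - g` and `g - q m • h`.
  obtain ⟨M, hM⟩ := Finite.exists_max fun i => ev i g / ev i h
  obtain ⟨m, hm⟩ := Finite.exists_min fun i => ev i g / ev i h
  set q : ι → ℝ := fun i => ev i g / ev i h with hq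
  have hqg : ∀ i, ev i g = q i * ev i h := fun i => by
    simp only [hq]; field_simp [(hpos i).ne']
  -- If all ratios agreed, `g` would be a multiple of `h` and the plane would be a line.
  have hlt : q m < q M := by
    refine lt_of_le_of_ne (hm M) fun heq => ?_
    have hgz : g = q M • h := by
      rw [← sub_eq_zero]
      refine hinj _ fun i => ?_
      have : q i = q M := le_antisymm (hM i) (heq ▸ hm i)
      simp [hqg, this]
    have hall : ∀ l : V, ∃ c : ℝ, c • h = l := fun l => by
      obtain ⟨α, β, e⟩ := hg l
      exact ⟨α + β * q M, by rw [e, hgz]; module⟩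
    have : finrank ℝ V = 1 := finrank_eq_one h hh hall
    omega
  have ha : ∀ i, ev i (q M • h - g) = (q M - q i) * ev i h := fun i => by
    simp [hqg]; ring
  have hb : ∀ i, ev i (g - q m • h) = (q i - q m) * ev i h := fun i => by
    simp [hqg]; ring
  refine ⟨q M • h - g, g - q m • h, fun i => ?_, fun i => ?_, ⟨M, ?_, ?_⟩, ⟨m, ?_, ?_⟩, ?_, ?_⟩
  · rw [ha]; exact mul_nonneg (sub_nonneg.2 (hM i)) (hpos i).le
  · rw [hb]; exact mul_nonneg (sub_nonneg.2 (hm i)) (hpos i).le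
  · rw [ha]; ring
  · rw [hb]; exact mul_pos (sub_pos.2 hlt) (hpos _)
  · rw [hb]; ring
  · rw [ha]; exact mul_pos (sub_pos.2 hlt) (hpos _)
  · intro i
    rw [ha, hb]
    rcases lt_or_ge (q i) (q M) with h1 | h1
    · exact Or.inl (mul_pos (sub_pos.2 h1) (hpos _))
    · exact Or.inr (mul_pos (sub_pos.2 (hlt.trans_le h1)) (hpos _))
  · intro l hl
    obtain ⟨α, β, e⟩ := hg l
    have hD : q M - q m ≠ 0 := (sub_pos.2 hlt).ne'
    have hl' : l = ((α + β * q m) / (q M - q m)) • (q M • h - g) +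
        ((α + β * q M) / (q M - q m)) • (g - q m • h) := by
      rw [e]
      match_scalars <;> field_simp <;> ring
    have hev : ∀ i, ev i l = (α + β * q i) * ev i h := fun i => by
      simp [e, hqg]; ring
    refine ⟨_, _, div_nonneg ?_ (sub_pos.2 hlt).le, div_nonneg ?_ (sub_pos.2 hlt).le, hl'⟩
    · have := hl m
      rw [hev] at this
      exact nonneg_of_mul_nonneg_left this (hpos m)
    · have := hl M
      rw [hev] at this
      exact nonneg_of_mul_nonneg_left this (hpos M)

/-- A generic plane of functions that contains a positive one supports the cone of evaluations
along exactly two rays. -/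
theorem ncard_tangent_rays {ι V : Type*} [Finite ι] [AddCommGroup V] [Module ℝ V]
    (ev : ι → Dual ℝ V) (hV : finrank ℝ V = 3) (hinj : ∀ l, (∀ i, ev i l = 0) → l = 0)
    (Y : Dual ℝ V) (hY : Y ≠ 0) (h : V) (hpos : ∀ i, 0 < ev i h) (hYh : Y h = 0)
    (hgen : ∀ l, (∀ i, 0 ≤ ev i l) → ∀ i j, i ≠ j → ev i l = 0 → ev j l = 0 → Y l = 0 → l = 0) :
    {i | ∃ l, Y l = 0 ∧ ∀ j, 0 ≤ ev j l ∧ (ev j l = 0 ↔ j = i)}.ncard = 2 := by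
  have hfd : FiniteDimensional ℝ V := Module.finite_of_finrank_pos (by omega)
  -- The kernel of `Y` is a plane that contains the positive function `h`. Genericity then makes
  -- each of its two extreme rays vanish at a single index.
  obtain ⟨⟨a, ha⟩, ⟨b, hb⟩, ha0, hb0, ⟨i, hia, hib⟩, ⟨j, hjb, hja⟩, hab, hcone⟩ :=
    exists_extreme_pair (V := LinearMap.ker Y) (fun i => (ev i).domRestrict (LinearMap.ker Y))
      (by have := Module.Dual.finrank_ker_add_one_of_ne_zero hY; omega)
      (fun l hl => Subtype.ext (hinj l hl)) ⟨h, hYh⟩ hpos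
  simp only [LinearMap.domRestrict_apply] at ha0 hb0 hia hib hjb hja hab hcone
  have ha1 : ∀ k, ev k a = 0 ↔ k = i := fun k => by
    refine ⟨fun hk => by_contra fun hki => ?_, fun hk => hk ▸ hia⟩
    rw [hgen a ha0 k i hki hk hia ha] at hja
    simp at hja
  have hb1 : ∀ k, ev k b = 0 ↔ k = j := fun k => by
    refine ⟨fun hk => by_contra fun hki => ?_, fun hk => hk ▸ hjb⟩
    rw [hgen b hb0 k j hki hk hjb hb] at hib
    simp at hib
  have hij : i ≠ j := by rintro rfl; exact hja.ne' hia
  rw [Set.ncard_eq_two]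
  refine ⟨i, j, hij, Set.ext fun k => ⟨?_, ?_⟩⟩
  · rintro ⟨l, hl, hk⟩
    obtain ⟨α, β, hα, hβ, e⟩ := hcone ⟨l, hl⟩ fun m => (hk m).1
    have e' : l = α • a + β • b := congrArg Subtype.val e
    have hev : ∀ m, ev m l = α * ev m a + β * ev m b := fun m => by simp [e']
    have hkk := ((hk k).2).2 rfl
    rw [hev] at hkk
    have h1 := mul_nonneg hα (ha0 k)
    have h2 := mul_nonneg hβ (hb0 k)
    have h3 : α * ev k a = 0 := by linarith
    have h4 : β * ev k b = 0 := by linarith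
    simp only [Set.mem_insert_iff, Set.mem_singleton_iff, ← ha1, ← hb1]
    by_contra! hc
    have h5 : α = 0 := (mul_eq_zero.1 h3).resolve_right hc.1
    have h6 : β = 0 := (mul_eq_zero.1 h4).resolve_right hc.2
    -- If both coefficients were zero, `l` would vanish at every index, yet `k` is its only zero.
    have h7 : ∀ m, m = k := fun m => ((hk m).2).1 (by rw [hev, h5, h6]; ring)
    exact hij ((h7 i).trans (h7 j).symm)
  · rintro (rfl | rfl)
    · exact ⟨a, ha, fun m => ⟨ha0 m, ha1 m⟩⟩
    · exact ⟨b, hb, fun m => ⟨hb0 m, hb1 m⟩⟩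

/-! ### Faces of a finitely generated cone and functionals relative to a face -/

section Faces

variable {ι W : Type*} [AddCommGroup W] [Module ℝ W]

/-- The faces of the cone generated by a finite family, as sets of indices. -/
def IsFace (x : ι → W) (T : Finset ι) : Prop :=
  ∃ l : Dual ℝ W, ∀ i, 0 ≤ l (x i) ∧ (l (x i) = 0 ↔ i ∈ T)

/-- The span of a subfamily. -/
def spanOf (x : ι → W) (T : Finset ι) : Submodule ℝ W := Submodule.span ℝ (x '' T)

theorem mem_spanOf {x : ι → W} {T : Finset ι} {i : ι} (hi : i ∈ T) : x i ∈ spanOf x T :=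
  Submodule.subset_span ⟨i, hi, rfl⟩

theorem spanOf_mono {x : ι → W} {A B : Finset ι} (h : A ⊆ B) : spanOf x A ≤ spanOf x B :=
  Submodule.span_mono (Set.image_mono (by exact_mod_cast h))

theorem eq_zero_of_mem_spanOf {x : ι → W} {T : Finset ι} {l : Dual ℝ W}
    (h : ∀ i ∈ T, l (x i) = 0) {y : W} (hy : y ∈ spanOf x T) : l y = 0 := by
  have : spanOf x T ≤ LinearMap.ker l := Submodule.span_le.2 (by rintro _ ⟨i, hi, rfl⟩; exact h i hi)
  exact this hy

theorem isFace_univ [Fintype ι] (x : ι → W) : IsFace x Finset.univ := ⟨0, by simp⟩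

variable [Fintype ι]

/-- A functional that is nonnegative on a face extends to a nonnegative one, positive off the
face. -/
theorem IsFace.exists_extend {x : ι → W} {B : Finset ι} (hB : IsFace x B) (l : Dual ℝ W)
    (hl : ∀ i ∈ B, 0 ≤ l (x i)) :
    ∃ m : Dual ℝ W, (∀ i, 0 ≤ m (x i)) ∧ (∀ i, i ∉ B → 0 < m (x i)) ∧
      ∀ y ∈ spanOf x B, m y = l y := by
  obtain ⟨p, hp⟩ := hB
  -- Adding a multiple of the functional `p` that exposes `B` changes nothing on the span of `B`; a
  -- multiple beyond all these ratios makes the values off `B` positive.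
  obtain ⟨M, hM⟩ : ∃ M : ℝ, ∀ i, i ∉ B → -l (x i) / p (x i) < M := by
    obtain ⟨M, hM⟩ := (Set.finite_range fun i => -l (x i) / p (x i)).bddAbove
    exact ⟨M + 1, fun i _ => (hM ⟨i, rfl⟩).trans_lt (lt_add_one M)⟩
  have hpos : ∀ i, i ∉ B → 0 < (l + M • p) (x i) := fun i hi => by
    have h1 : 0 < p (x i) := lt_of_le_of_ne (hp i).1 fun h => hi (((hp i).2).1 h.symm)
    have := hM i hi
    rw [div_lt_iff₀ h1] at this
    simp only [LinearMap.add_apply, LinearMap.smul_apply, smul_eq_mul]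
    linarith
  have hon : ∀ y ∈ spanOf x B, (l + M • p) y = l y := fun y hy => by
    simp [eq_zero_of_mem_spanOf (l := p) (fun i hi => ((hp i).2).2 hi) hy]
  refine ⟨l + M • p, fun i => ?_, hpos, hon⟩
  by_cases hi : i ∈ B
  · rw [hon _ (mem_spanOf hi)]; exact hl i hi
  · exact (hpos i hi).le

/-- A functional that exposes `T` within `B` can be tilted, without change on `B`, until it is
positive off `B`. Thus a face of a face is a face. -/
theorem IsFace.of_subface {x : ι → W} {B T : Finset ι} (hB : IsFace x B) (hT : T ⊆ B)
    (l : Dual ℝ W) (hl : ∀ i ∈ B, 0 ≤ l (x i) ∧ (l (x i) = 0 ↔ i ∈ T)) : IsFace x T := by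
  obtain ⟨m, h0, h1, h2⟩ := hB.exists_extend l fun i hi => (hl i hi).1
  refine ⟨m, fun i => ⟨h0 i, ?_⟩⟩
  by_cases hi : i ∈ B
  · rw [h2 _ (mem_spanOf hi)]; exact (hl i hi).2
  · exact ⟨fun h => ((h1 i hi).ne' h).elim, fun h => (hi (hT h)).elim⟩

/-- The functionals on the span of `B` that vanish on `A`. -/
def relDual (x : ι → W) (A B : Finset ι) : Submodule ℝ (Dual ℝ (spanOf x B)) :=
  (Submodule.comap (spanOf x B).subtype (spanOf x A)).dualAnnihilator

variable [FiniteDimensional ℝ W]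

/-- `relDual x A B` is the dual of the quotient of the two spans, so a difference of ranks two or
three becomes the dimension required by the lemmas on extreme rays. -/
theorem finrank_relDual {x : ι → W} {A B : Finset ι} (h : A ⊆ B) :
    finrank ℝ (spanOf x A) + finrank ℝ (relDual x A B) = finrank ℝ (spanOf x B) := by
  have h1 := Subspace.finrank_add_finrank_dualAnnihilator_eq
    (Submodule.comap (spanOf x B).subtype (spanOf x A))
  have h2 := (Submodule.comapSubtypeEquivOfLe (spanOf_mono (x := x) h)).finrank_eq
  rw [h2] at h1
  exact h1

/-- Restriction of a functional that vanishes on `A`. -/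
def relRestrict {x : ι → W} {A B : Finset ι} (l : Dual ℝ W) (hl : ∀ i ∈ A, l (x i) = 0) :
    relDual x A B :=
  ⟨l.domRestrict (spanOf x B), by
    rw [relDual, Submodule.mem_dualAnnihilator]
    intro w hw
    exact eq_zero_of_mem_spanOf hl hw⟩

theorem relDual_vanish {x : ι → W} {A B : Finset ι} (l : relDual x A B) {i : ι} (hi : i ∈ A)
    (hiB : i ∈ B) : l.1 ⟨x i, mem_spanOf hiB⟩ = 0 :=
  (Submodule.mem_dualAnnihilator _).1 l.2 _ (mem_spanOf (x := x) hi)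

/-- Evaluation of functionals vanishing on `A` at the members of `B` not in `A`. -/
def relEval (x : ι → W) (A B : Finset ι) (i : {i // i ∈ B ∧ i ∉ A}) : Dual ℝ (relDual x A B) :=
  (Dual.eval ℝ (spanOf x B) ⟨x i, mem_spanOf i.2.1⟩).domRestrict _

theorem relEval_inj {x : ι → W} {A B : Finset ι} (l : relDual x A B)
    (h : ∀ i, relEval x A B i l = 0) : l = 0 := by
  obtain ⟨m, hm⟩ := LinearMap.exists_extend l.1
  have hm' : ∀ y (hy : y ∈ spanOf x B), l.1 ⟨y, hy⟩ = m y := fun y hy => by rw [← hm]; rfl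
  refine Subtype.ext (LinearMap.ext fun y => ?_)
  rw [hm' y.1 y.2]
  refine eq_zero_of_mem_spanOf (fun i hi => ?_) y.2
  rw [← hm' _ (mem_spanOf hi)]
  by_cases hA : i ∈ A
  · exact relDual_vanish l hA hi
  · exact h ⟨i, hi, hA⟩

theorem exists_extend_relDual {x : ι → W} {A B : Finset ι} (l : relDual x A B) :
    ∃ m : Dual ℝ W, ∃ hm : ∀ i ∈ A, m (x i) = 0, A ⊆ B → l = relRestrict m hm := by
  by_cases hAB : A ⊆ B
  · obtain ⟨m, hm⟩ := LinearMap.exists_extend l.1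
    have hm' : ∀ y (hy : y ∈ spanOf x B), l.1 ⟨y, hy⟩ = m y := fun y hy => by rw [← hm]; rfl
    refine ⟨m, fun i hi => ?_, fun _ => ?_⟩
    · rw [← hm' _ (mem_spanOf (hAB hi))]; exact relDual_vanish l hi (hAB hi)
    · exact Subtype.ext (LinearMap.ext fun y => hm' y.1 y.2)
  · exact ⟨0, by simp, fun h => (hAB h).elim⟩

/-- Between two faces whose ranks differ by two lie exactly two faces; in terms of functionals. -/
theorem IsFace.exists_pair {x : ι → W} {A B : Finset ι} (hA : IsFace x A) (hB : IsFace x B)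
    (hAB : A ⊆ B) (hr : finrank ℝ (spanOf x B) = finrank ℝ (spanOf x A) + 2) :
    ∃ a b : Dual ℝ W, (∀ i, 0 ≤ a (x i)) ∧ (∀ i, 0 ≤ b (x i)) ∧
      (∀ i, a (x i) = 0 → i ∈ B) ∧ (∀ i, b (x i) = 0 → i ∈ B) ∧
      (∀ i ∈ A, a (x i) = 0 ∧ b (x i) = 0) ∧
      (∃ i ∈ B, a (x i) = 0 ∧ 0 < b (x i)) ∧ (∃ i ∈ B, b (x i) = 0 ∧ 0 < a (x i)) ∧
      (∀ i ∈ B, i ∉ A → 0 < a (x i) ∨ 0 < b (x i)) ∧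
      ∀ l : Dual ℝ W, (∀ i ∈ B, 0 ≤ l (x i)) → (∀ i ∈ A, l (x i) = 0) →
        ∃ α β : ℝ, 0 ≤ α ∧ 0 ≤ β ∧ ∀ y ∈ spanOf x B, l y = α * a y + β * b y := by
  obtain ⟨h, hh⟩ := hA
  have hV : finrank ℝ (relDual x A B) = 2 := by
    have := finrank_relDual (x := x) hAB
    omega
  obtain ⟨a, b, ha, hb, ⟨i, hia, hib⟩, ⟨j, hjb, hja⟩, hab, hcone⟩ :=
    exists_extreme_pair (relEval x A B) hV relEval_inj
      (relRestrict h fun i hi => ((hh i).2).2 hi)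
      (fun i : {i // i ∈ B ∧ i ∉ A} =>
        lt_of_le_of_ne (hh i).1 fun e => i.2.2 (((hh i).2).1 e.symm))
  obtain ⟨a, haA, rfl'⟩ := exists_extend_relDual a
  obtain rfl := rfl' hAB
  obtain ⟨b, hbA, rfl''⟩ := exists_extend_relDual b
  obtain rfl := rfl'' hAB
  have key : ∀ l : Dual ℝ W, ∀ hl : ∀ i ∈ A, l (x i) = 0, ∀ i, ∀ hi : i ∈ B, ∀ hiA : i ∉ A,
      relEval x A B ⟨i, hi, hiA⟩ (relRestrict l hl) = l (x i) := fun _ _ _ _ _ => rfl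
  have nn : ∀ l : Dual ℝ W, ∀ hl : ∀ i ∈ A, l (x i) = 0,
      (∀ i, 0 ≤ relEval x A B i (relRestrict l hl)) → ∀ i ∈ B, 0 ≤ l (x i) := by
    intro l hl h i hi
    by_cases hiA : i ∈ A
    · rw [hl i hiA]
    · exact h ⟨i, hi, hiA⟩
  -- The extreme rays are controlled only on `B`; the extensions are nonnegative everywhere and have
  -- no zeros outside `B`.
  obtain ⟨a', ha0, ha1, ha2⟩ := hB.exists_extend a (nn a haA ha)
  obtain ⟨b', hb0, hb1, hb2⟩ := hB.exists_extend b (nn b hbA hb)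
  have ea : ∀ i ∈ B, a' (x i) = a (x i) := fun i hi => ha2 _ (mem_spanOf hi)
  have eb : ∀ i ∈ B, b' (x i) = b (x i) := fun i hi => hb2 _ (mem_spanOf hi)
  refine ⟨a', b', ha0, hb0, fun i h0 => by_contra fun hi => (ha1 i hi).ne' h0,
    fun i h0 => by_contra fun hi => (hb1 i hi).ne' h0,
    fun i hi => ⟨(ea i (hAB hi)).trans (haA i hi), (eb i (hAB hi)).trans (hbA i hi)⟩,
    ⟨i, i.2.1, (ea i i.2.1).trans hia, hib.trans_eq (eb i i.2.1).symm⟩,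
    ⟨j, j.2.1, (eb j j.2.1).trans hjb, hja.trans_eq (ea j j.2.1).symm⟩, ?_, ?_⟩
  · intro k hk hkA
    rw [ea k hk, eb k hk]
    exact hab ⟨k, hk, hkA⟩
  · intro l hl hlA
    obtain ⟨α, β, hα, hβ, e⟩ := hcone (relRestrict l hlA) fun i => hl i i.2.1
    refine ⟨α, β, hα, hβ, fun y hy => ?_⟩
    rw [ha2 y hy, hb2 y hy]
    exact congrArg (fun m : relDual x A B => m.1 ⟨y, hy⟩) e

/-- Between two faces whose ranks differ by three, a generic line is tangent along exactly two
rays. -/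
theorem ncard_tangent {x : ι → W} {A B : Finset ι} (hAB : A ⊆ B)
    (hr : finrank ℝ (spanOf x B) = finrank ℝ (spanOf x A) + 3) {Y : W} (hYB : Y ∈ spanOf x B)
    (hY : ∃ l : Dual ℝ W, (∀ i ∈ A, l (x i) = 0) ∧ l Y ≠ 0)
    (h : Dual ℝ W) (hA : ∀ i ∈ A, h (x i) = 0) (hpos : ∀ i ∈ B, i ∉ A → 0 < h (x i))
    (hYh : h Y = 0)
    (hgen : ∀ l : Dual ℝ W, (∀ i ∈ B, 0 ≤ l (x i)) → (∀ i ∈ A, l (x i) = 0) → ∀ i ∈ B, ∀ j ∈ B,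
      i ∉ A → j ∉ A → i ≠ j → l (x i) = 0 → l (x j) = 0 → l Y = 0 → ∀ k ∈ B, l (x k) = 0) :
    {i | i ∈ B ∧ i ∉ A ∧ ∃ l : Dual ℝ W, l Y = 0 ∧ (∀ j ∈ A, l (x j) = 0) ∧
      ∀ j ∈ B, j ∉ A → 0 ≤ l (x j) ∧ (l (x j) = 0 ↔ j = i)}.ncard = 2 := by
  have hV : finrank ℝ (relDual x A B) = 3 := by
    have := finrank_relDual (x := x) hAB
    omega
  have hc := ncard_tangent_rays (relEval x A B) hV relEval_inj
    ((Dual.eval ℝ (spanOf x B) ⟨Y, hYB⟩).domRestrict _) ?_ (relRestrict h hA)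
    (fun i : {i // i ∈ B ∧ i ∉ A} => hpos i i.2.1 i.2.2) hYh ?_
  · rw [← hc, ← Set.ncard_image_of_injective _ Subtype.val_injective]
    congr 1
    ext i
    simp only [Set.mem_ofPred_eq, Set.mem_image, Subtype.exists, exists_and_right, exists_eq_right]
    constructor
    · rintro ⟨hi, hiA, l, hlY, hlA, hl⟩
      refine ⟨⟨hi, hiA⟩, _, (relRestrict l hlA).2, hlY, fun j => ⟨(hl j j.2.1 j.2.2).1, ?_⟩⟩
      exact ((hl j j.2.1 j.2.2).2).trans (by rw [Subtype.ext_iff])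
    · rintro ⟨⟨hi, hiA⟩, l, hl', hlY, hl⟩
      obtain ⟨m, hmA, hm⟩ := exists_extend_relDual (⟨l, hl'⟩ : relDual x A B)
      have hm1 := hm hAB
      rw [Subtype.ext_iff] at hm1
      simp only at hm1
      subst hm1
      refine ⟨hi, hiA, m, hlY, hmA, fun j hj hjA => ⟨(hl ⟨j, hj, hjA⟩).1, ?_⟩⟩
      exact ((hl ⟨j, hj, hjA⟩).2).trans (by rw [Subtype.ext_iff])
  · obtain ⟨l, hl, hlY⟩ := hY
    intro h0
    exact hlY (congrArg (fun m : Dual ℝ (relDual x A B) => m (relRestrict l hl)) h0)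
  · intro l hl i j hij hi hj hlY
    obtain ⟨m, hmA, hm⟩ := exists_extend_relDual l
    obtain rfl := hm hAB
    have := hgen m (fun k hk => by
      by_cases hkA : k ∈ A
      · rw [hmA k hkA]
      · exact hl ⟨k, hk, hkA⟩) hmA i i.2.1 j j.2.1 i.2.2 j.2.2 (fun e => hij (Subtype.ext e)) hi hj hlY
    exact relEval_inj _ fun k => this k k.2.1

end Faces

/-! ### Vertices, edges and facets of a three-dimensional polytope -/

section Polytope

variable {ι W : Type*} [Fintype ι] [AddCommGroup W] [Module ℝ W] [FiniteDimensional ℝ W]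

/-- The cone over a three-dimensional polytope, any three of whose vertices are in general
position, is generated by `x`. -/
structure IsVertexFamily (x : ι → W) : Prop where
  finrank_eq : finrank ℝ W = 4
  span_eq : spanOf x Finset.univ = ⊤
  indep : ∀ T : Finset ι, T.card ≤ 3 → LinearIndepOn ℝ x (T : Set ι)
  vertex : ∀ i, IsFace x {i}

open Classical in
/-- The two-dimensional faces. -/
noncomputable def facets (x : ι → W) : Finset (Finset ι) :=
  Finset.univ.filter fun T => IsFace x T ∧ finrank ℝ (spanOf x T) = 3

open Classical in
/-- The one-dimensional faces. -/
noncomputable def edges (x : ι → W) : Finset (Finset ι) :=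
  Finset.univ.filter fun T => IsFace x T ∧ T.card = 2

open Classical in
/-- A functional that exposes the face `T`. -/
noncomputable def normal (x : ι → W) (T : Finset ι) : Dual ℝ W :=
  if h : IsFace x T then h.choose else 0

variable {x : ι → W}

theorem mem_facets {T : Finset ι} : T ∈ facets x ↔ IsFace x T ∧ finrank ℝ (spanOf x T) = 3 := by
  simp [facets]

theorem mem_edges {T : Finset ι} : T ∈ edges x ↔ IsFace x T ∧ T.card = 2 := by
  simp [edges]

theorem IsFace.normal_nonneg {T : Finset ι} (h : IsFace x T) (i : ι) : 0 ≤ normal x T (x i) := by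
  rw [normal, dif_pos h]; exact (h.choose_spec i).1

theorem IsFace.normal_eq_zero {T : Finset ι} (h : IsFace x T) {i : ι} :
    normal x T (x i) = 0 ↔ i ∈ T := by
  rw [normal, dif_pos h]; exact (h.choose_spec i).2

theorem IsFace.normal_pos {T : Finset ι} (h : IsFace x T) {i : ι} (hi : i ∉ T) :
    0 < normal x T (x i) :=
  lt_of_le_of_ne (h.normal_nonneg i) fun e => hi (h.normal_eq_zero.1 e.symm)

theorem IsFace.normal_spanOf {T : Finset ι} (h : IsFace x T) {y : W} (hy : y ∈ spanOf x T) :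
    normal x T y = 0 :=
  eq_zero_of_mem_spanOf (fun _ hi => h.normal_eq_zero.2 hi) hy

namespace IsVertexFamily

theorem rank_eq_card (hx : IsVertexFamily x) {T : Finset ι} (hT : T.card ≤ 3) :
    finrank ℝ (spanOf x T) = T.card := by
  have h := hx.indep T hT
  have h1 := finrank_span_eq_card (R := ℝ) (b := fun i : T => x i) h
  rw [spanOf, Set.image_eq_range]
  simpa using h1

theorem three_le_rank (hx : IsVertexFamily x) {T : Finset ι} (hT : 3 ≤ T.card) :
    3 ≤ finrank ℝ (spanOf x T) := by
  obtain ⟨U, hU, hc⟩ := Finset.exists_subset_card_eq hT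
  rw [← hc, ← hx.rank_eq_card hc.le]
  exact Submodule.finrank_mono (spanOf_mono hU)

theorem rank_empty (hx : IsVertexFamily x) : finrank ℝ (spanOf x ∅) = 0 := by
  simpa using hx.rank_eq_card (T := ∅) (by simp)

theorem rank_singleton (hx : IsVertexFamily x) (i : ι) : finrank ℝ (spanOf x {i}) = 1 := by
  simpa using hx.rank_eq_card (T := {i}) (by simp)

theorem rank_univ (hx : IsVertexFamily x) : finrank ℝ (spanOf x Finset.univ) = 4 := by
  rw [hx.span_eq, finrank_top, hx.finrank_eq]

/-- General position gives rank at least three, and the exposing functional, nonzero at the omitted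
vertex, keeps the rank below four. -/
theorem mem_facets_of_card (hx : IsVertexFamily x) {T : Finset ι} (hT : IsFace x T)
    (hc : 3 ≤ T.card) {i : ι} (hi : i ∉ T) : T ∈ facets x := by
  refine mem_facets.2 ⟨hT, le_antisymm ?_ (hx.three_le_rank hc)⟩
  have h1 : spanOf x T ≠ ⊤ := fun h =>
    (hT.normal_pos hi).ne' (hT.normal_spanOf (h ▸ Submodule.mem_top))
  have := Submodule.finrank_lt h1
  rw [hx.finrank_eq] at this
  omega

theorem exists_notMem (hx : IsVertexFamily x) {F : Finset ι} (hF : F ∈ facets x) :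
    ∃ i, i ∉ F := by
  by_contra! h
  have : F = Finset.univ := by ext; simp [h]
  have h1 := (mem_facets.1 hF).2
  rw [this, hx.rank_univ] at h1
  omega

theorem three_le_card (hx : IsVertexFamily x) {F : Finset ι} (hF : F ∈ facets x) :
    3 ≤ F.card := by
  by_contra! h
  have h1 := (mem_facets.1 hF).2
  rw [hx.rank_eq_card (by omega)] at h1
  omega

/-- The span of a facet is a hyperplane that any vertex off the facet completes, so the value at
that one vertex determines a functional vanishing on the facet. -/
theorem eq_smul_normal (hx : IsVertexFamily x) {F : Finset ι} (hF : F ∈ facets x) {l : Dual ℝ W}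
    (hl : ∀ i ∈ F, l (x i) = 0) : ∃ c : ℝ, l = c • normal x F := by
  obtain ⟨i, hi⟩ := hx.exists_notMem hF
  obtain ⟨hf, hr⟩ := mem_facets.1 hF
  have hpos := hf.normal_pos hi
  have htop : spanOf x F ⊔ Submodule.span ℝ {x i} = ⊤ := by
    apply Submodule.eq_top_of_finrank_eq
    refine le_antisymm (Submodule.finrank_le _) ?_
    rw [hx.finrank_eq]
    have hlt : spanOf x F < spanOf x F ⊔ Submodule.span ℝ {x i} := by
      refine lt_of_le_of_ne le_sup_left fun h => hpos.ne' (hf.normal_spanOf ?_)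
      rw [h]
      exact Submodule.mem_sup_right (Submodule.mem_span_singleton_self _)
    have := Submodule.finrank_lt_finrank_of_lt hlt
    omega
  refine ⟨l (x i) / normal x F (x i), LinearMap.ext fun y => ?_⟩
  have hy : y ∈ spanOf x F ⊔ Submodule.span ℝ {x i} := htop ▸ Submodule.mem_top
  obtain ⟨u, hu, w, hw, rfl⟩ := Submodule.mem_sup.1 hy
  obtain ⟨c, rfl⟩ := Submodule.mem_span_singleton.1 hw
  simp only [map_add, map_smul, LinearMap.smul_apply, eq_zero_of_mem_spanOf hl hu,
    hf.normal_spanOf hu, smul_eq_mul]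
  field_simp
  ring

theorem facets_eq_of_subset {F G : Finset ι} (hF : F ∈ facets x)
    (hG : G ∈ facets x) (h : F ⊆ G) : F = G := by
  refine h.antisymm fun i hi => ?_
  have h1 : spanOf x F = spanOf x G := Submodule.eq_of_le_of_finrank_eq (spanOf_mono h)
    ((mem_facets.1 hF).2.trans (mem_facets.1 hG).2.symm)
  have h2 := (mem_facets.1 hF).1
  exact h2.normal_eq_zero.1 (h2.normal_spanOf (h1 ▸ mem_spanOf hi))

theorem mem_spanOf_facet (hx : IsVertexFamily x) {F : Finset ι} (hF : F ∈ facets x) {y : W}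
    (hy : normal x F y = 0) : y ∈ spanOf x F := by
  by_contra h
  obtain ⟨f, hf, hm⟩ := Submodule.exists_dual_map_eq_bot_of_notMem h inferInstance
  obtain ⟨c, rfl⟩ := hx.eq_smul_normal hF (l := f) fun i hi => by
    have : f (x i) ∈ (spanOf x F).map f := ⟨_, mem_spanOf hi, rfl⟩
    rw [hm] at this
    simpa using this
  exact hf (by simp [hy])

open Classical in
-- The zeros include the vertices of `T` and the extra vertex `i`, so at least three, while `j`
-- keeps the exposed face proper.
theorem zeroSet_eq (hx : IsVertexFamily x) {l : Dual ℝ W} (h0 : ∀ i, 0 ≤ l (x i)) {T : Finset ι}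
    (hT : ∀ i ∈ T, l (x i) = 0) (hc : 2 ≤ T.card) {i j : ι} (hiT : i ∉ T) (hi : l (x i) = 0)
    (hj : l (x j) ≠ 0) : (Finset.univ.filter fun k => l (x k) = 0) ∈ facets x := by
  have hf : IsFace x (Finset.univ.filter fun k => l (x k) = 0) := ⟨l, fun k => ⟨h0 k, by simp⟩⟩
  refine hx.mem_facets_of_card hf ?_ (i := j) (by simpa using hj)
  have : insert i T ⊆ Finset.univ.filter fun k => l (x k) = 0 := by
    intro k hk
    rcases Finset.mem_insert.1 hk with rfl | hk
    · simpa using hi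
    · simpa using hT k hk
  have := Finset.card_le_card this
  rw [Finset.card_insert_of_notMem hiT] at this
  omega

/-- An edge lies in exactly two two-dimensional faces. -/
theorem edge_facets (hx : IsVertexFamily x) {e : Finset ι} (he : e ∈ edges x) :
    ∃ F ∈ facets x, ∃ G ∈ facets x, F ≠ G ∧ e ⊆ F ∧ e ⊆ G ∧ (∀ i, i ∈ F → i ∈ G → i ∈ e) ∧
      (∀ H ∈ facets x, e ⊆ H → H = F ∨ H = G) ∧
      ∀ l : Dual ℝ W, (∀ i, 0 ≤ l (x i)) → (∀ i ∈ e, l (x i) = 0) →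
        ∃ α β : ℝ, 0 ≤ α ∧ 0 ≤ β ∧ l = α • normal x F + β • normal x G := by
  classical
  obtain ⟨hef, hec⟩ := mem_edges.1 he
  -- Between an edge (rank two) and the whole polytope (rank four) lie two extreme functionals,
  -- whose zero sets are the two facets.
  obtain ⟨a, b, ha, hb, -, -, h0, ⟨i, -, hia, hib⟩, ⟨j, -, hjb, hja⟩, hab, hcone⟩ :=
    hef.exists_pair (isFace_univ x) (Finset.subset_univ e)
      (by rw [hx.rank_univ, hx.rank_eq_card (by omega), hec])
  have hiT : i ∉ e := fun h => hib.ne' (h0 i h).2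
  have hjT : j ∉ e := fun h => hja.ne' (h0 j h).1
  have hF := hx.zeroSet_eq ha (fun k hk => (h0 k hk).1) hec.ge hiT hia hja.ne'
  have hG := hx.zeroSet_eq hb (fun k hk => (h0 k hk).2) hec.ge hjT hjb hib.ne'
  set F := Finset.univ.filter fun k => a (x k) = 0
  set G := Finset.univ.filter fun k => b (x k) = 0
  have hmF : ∀ k, k ∈ F ↔ a (x k) = 0 := fun k => by simp [F]
  have hmG : ∀ k, k ∈ G ↔ b (x k) = 0 := fun k => by simp [G]
  have heF : e ⊆ F := fun k hk => (hmF k).2 (h0 k hk).1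
  have heG : e ⊆ G := fun k hk => (hmG k).2 (h0 k hk).2
  obtain ⟨c, hc⟩ := hx.eq_smul_normal hF (l := a) fun k hk => (hmF k).1 hk
  obtain ⟨d, hd⟩ := hx.eq_smul_normal hG (l := b) fun k hk => (hmG k).1 hk
  have hc0 : 0 ≤ c := by
    rw [hc] at hja
    exact (pos_of_mul_pos_left hja ((mem_facets.1 hF).1.normal_nonneg j)).le
  have hd0 : 0 ≤ d := by
    rw [hd] at hib
    exact (pos_of_mul_pos_left hib ((mem_facets.1 hG).1.normal_nonneg i)).le
  have hcone' : ∀ l : Dual ℝ W, (∀ i, 0 ≤ l (x i)) → (∀ i ∈ e, l (x i) = 0) →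
        ∃ α β : ℝ, 0 ≤ α ∧ 0 ≤ β ∧ l = α • normal x F + β • normal x G := by
    intro l hl hle
    obtain ⟨α, β, hα, hβ, h⟩ := hcone l (fun i _ => hl i) hle
    refine ⟨α * c, β * d, mul_nonneg hα hc0, mul_nonneg hβ hd0, LinearMap.ext fun y => ?_⟩
    rw [h y (hx.span_eq ▸ Submodule.mem_top), hc, hd]
    simp only [LinearMap.smul_apply, LinearMap.add_apply, smul_eq_mul]
    ring
  refine ⟨F, hF, G, hG, fun h => ?_, heF, heG, fun k h1 h2 => ?_, fun H hH heH => ?_, hcone'⟩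
  · exact hib.ne' ((hmG i).1 (h ▸ (hmF i).2 hia))
  · by_contra hk
    rcases hab k (Finset.mem_univ k) hk with h | h
    · exact h.ne' ((hmF k).1 h1)
    · exact h.ne' ((hmG k).1 h2)
  · obtain ⟨hHf, -⟩ := mem_facets.1 hH
    -- On `H` both nonnegative terms of this combination vanish, so a nonzero coefficient forces `H`
    -- into the corresponding facet.
    obtain ⟨α, β, hα, hβ, h⟩ := hcone' (normal x H) hHf.normal_nonneg
      fun k hk => hHf.normal_eq_zero.2 (heH hk)
    have hFn := (mem_facets.1 hF).1
    have hGn := (mem_facets.1 hG).1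
    have hsub : ∀ k ∈ H, α * normal x F (x k) = 0 ∧ β * normal x G (x k) = 0 := by
      intro k hk
      have h1 := hHf.normal_eq_zero.2 hk
      rw [h] at h1
      simp only [LinearMap.smul_apply, LinearMap.add_apply, smul_eq_mul] at h1
      have := mul_nonneg hα (hFn.normal_nonneg k)
      have := mul_nonneg hβ (hGn.normal_nonneg k)
      constructor <;> linarith
    by_cases hα0 : α = 0
    · right
      refine facets_eq_of_subset hH hG fun k hk => ?_
      have hβ0 : β ≠ 0 := by
        rintro rfl
        obtain ⟨m, hm⟩ := hx.exists_notMem hH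
        have := hHf.normal_pos hm
        rw [h, hα0] at this
        simp at this
      exact hGn.normal_eq_zero.1 ((mul_eq_zero.1 (hsub k hk).2).resolve_left hβ0)
    · left
      refine facets_eq_of_subset hH hF fun k hk => ?_
      exact hFn.normal_eq_zero.1 ((mul_eq_zero.1 (hsub k hk).1).resolve_left hα0)

/-- A facet other than `F` through an edge of `F` induces on `F` the functional that supports
the edge. -/
theorem exists_adjacent (hx : IsVertexFamily x) [DecidableEq ι] {F : Finset ι} (hF : F ∈ facets x) {v i j : ι}
    (hv : v ∈ F) (hiv : i ≠ v) {a b : Dual ℝ W} (ha : ∀ k, 0 ≤ a (x k))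
    (haF : ∀ k, a (x k) = 0 → k ∈ F) (hav : a (x v) = 0)
    (hia : a (x i) = 0) (hib : 0 < b (x i)) (hj : j ∈ F) (hja : 0 < a (x j))
    (hcone : ∀ l : Dual ℝ W, (∀ i ∈ F, 0 ≤ l (x i)) → l (x v) = 0 →
        ∃ α β : ℝ, 0 ≤ α ∧ 0 ≤ β ∧ ∀ y ∈ spanOf x F, l y = α * a y + β * b y) :
    {v, i} ∈ edges x ∧ (∀ k, a (x k) = 0 → k = v ∨ k = i) ∧
      ∃ G ∈ facets x, G ≠ F ∧ v ∈ G ∧ i ∈ G ∧ ∃ c : ℝ, 0 < c ∧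
        ∀ y ∈ spanOf x F, a y = c * normal x G y := by
  classical
  obtain ⟨hFf, -⟩ := mem_facets.1 hF
  -- A third zero would make the zero set a facet inside `F`, hence `F` itself, although `a` is
  -- positive at `j ∈ F`.
  have hzero : ∀ k, a (x k) = 0 → k = v ∨ k = i := by
    intro k hk
    by_contra! hkk
    have hZ := hx.zeroSet_eq (T := {v, i}) ha (by simp [hav, hia]) (by
      rw [Finset.card_pair hiv.symm]) (i := k) (j := j) (by simp [hkk]) hk hja.ne'
    have := facets_eq_of_subset hZ hF fun k hk => haF k (by simpa using hk)
    rw [← this] at hj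
    exact hja.ne' (by simpa using hj)
  have he : {v, i} ∈ edges x := by
    refine mem_edges.2 ⟨⟨a, fun k => ⟨ha k, fun h => by simpa using hzero k h, fun h => ?_⟩⟩,
      Finset.card_pair hiv.symm⟩
    simp only [Finset.mem_insert, Finset.mem_singleton] at h
    rcases h with rfl | rfl <;> assumption
  refine ⟨he, hzero, ?_⟩
  obtain ⟨G, hG, hGF, heG⟩ : ∃ G ∈ facets x, G ≠ F ∧ {v, i} ⊆ G := by
    obtain ⟨G, hG, H, hH, hGH, heG, heH, -, -, -⟩ := hx.edge_facets he
    by_cases h : G = F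
    · exact ⟨H, hH, fun h' => hGH (h.trans h'.symm), heH⟩
    · exact ⟨G, hG, h, heG⟩
  obtain ⟨hGf, -⟩ := mem_facets.1 hG
  have hvG : v ∈ G := heG (by simp)
  have hiG : i ∈ G := heG (by simp)
  obtain ⟨α, β, hα, hβ, h⟩ := hcone (normal x G) (fun k _ => hGf.normal_nonneg k)
    (hGf.normal_eq_zero.2 hvG)
  have h1 := h _ (mem_spanOf (haF i hia))
  rw [hGf.normal_eq_zero.2 hiG, hia] at h1
  have hβ0 : β = 0 := by
    by_contra hne
    have := mul_pos (lt_of_le_of_ne hβ (Ne.symm hne)) hib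
    linarith
  subst hβ0
  have hα0 : α ≠ 0 := by
    rintro rfl
    refine hGF (facets_eq_of_subset hF hG fun k hk => ?_).symm
    exact hGf.normal_eq_zero.1 (by rw [h _ (mem_spanOf hk)]; ring)
  refine ⟨G, hG, hGF, hvG, hiG, α⁻¹, inv_pos.2 (lt_of_le_of_ne hα (Ne.symm hα0)), fun y hy => ?_⟩
  rw [h y hy]
  field_simp
  ring

/-- The two edges of a two-dimensional face `F` at a vertex `v`, and the adjacent facets. -/
theorem corner (hx : IsVertexFamily x) [DecidableEq ι] {F : Finset ι} (hF : F ∈ facets x) {v : ι}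
    (hv : v ∈ F) :
    ∃ i ∈ F, ∃ j ∈ F, i ≠ j ∧ {v, i} ∈ edges x ∧ {v, j} ∈ edges x ∧
      (∀ e ∈ edges x, v ∈ e → e ⊆ F → e = {v, i} ∨ e = {v, j}) ∧
      ∃ G ∈ facets x, ∃ H ∈ facets x, G ≠ F ∧ H ≠ F ∧ v ∈ G ∧ v ∈ H ∧
        0 < normal x G (x j) ∧ 0 < normal x H (x i) ∧ i ∈ G ∧ j ∈ H ∧
        (∀ k ∈ F, k ≠ v → 0 < normal x G (x k) ∨ 0 < normal x H (x k)) ∧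
        ∀ l : Dual ℝ W, (∀ i ∈ F, 0 ≤ l (x i)) → l (x v) = 0 →
          ∃ α β : ℝ, 0 ≤ α ∧ 0 ≤ β ∧ ∀ y ∈ spanOf x F, l y = α * normal x G y + β * normal x H y := by
  obtain ⟨hFf, hFr⟩ := mem_facets.1 hF
  obtain ⟨a, b, ha, hb, haF, hbF, h0, ⟨i, hi, hia, hib⟩, ⟨j, hj, hjb, hja⟩, hab, hcone⟩ :=
    (hx.vertex v).exists_pair hFf (by simpa using hv) (by rw [hFr, hx.rank_singleton])
  have hav := (h0 v (by simp)).1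
  have hbv := (h0 v (by simp)).2
  have hiv : i ≠ v := by rintro rfl; exact hib.ne' hbv
  have hjv : j ≠ v := by rintro rfl; exact hja.ne' hav
  have hcone1 : ∀ l : Dual ℝ W, (∀ i ∈ F, 0 ≤ l (x i)) → l (x v) = 0 →
        ∃ α β : ℝ, 0 ≤ α ∧ 0 ≤ β ∧ ∀ y ∈ spanOf x F, l y = α * a y + β * b y :=
    fun l hl hlv => hcone l hl (by simpa using hlv)
  have hcone2 : ∀ l : Dual ℝ W, (∀ i ∈ F, 0 ≤ l (x i)) → l (x v) = 0 →
        ∃ α β : ℝ, 0 ≤ α ∧ 0 ≤ β ∧ ∀ y ∈ spanOf x F, l y = α * b y + β * a y := by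
    intro l hl hlv
    obtain ⟨α, β, hα, hβ, h⟩ := hcone1 l hl hlv
    exact ⟨β, α, hβ, hα, fun y hy => by rw [h y hy]; ring⟩
  obtain ⟨hei, hzi, G, hG, hGF, hvG, hiG, c, hc, hGa⟩ :=
    hx.exists_adjacent hF hv hiv ha haF hav hia hib hj hja hcone1
  obtain ⟨hej, hzj, H, hH, hHF, hvH, hjH, d, hd, hHb⟩ :=
    hx.exists_adjacent hF hv hjv hb hbF hbv hjb hja hi hib hcone2
  have hGpos : ∀ k ∈ F, 0 < a (x k) → 0 < normal x G (x k) := fun k hk h => by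
    rw [hGa _ (mem_spanOf hk)] at h
    exact pos_of_mul_pos_right h hc.le
  have hHpos : ∀ k ∈ F, 0 < b (x k) → 0 < normal x H (x k) := fun k hk h => by
    rw [hHb _ (mem_spanOf hk)] at h
    exact pos_of_mul_pos_right h hd.le
  refine ⟨i, hi, j, hj, by rintro rfl; exact hib.ne' hjb, hei, hej, ?_, G, hG, H, hH, hGF, hHF,
    hvG, hvH, hGpos j hj hja, hHpos i hi hib, hiG, hjH, ?_, ?_⟩
  · intro e he hve heF
    obtain ⟨hef, hec⟩ := mem_edges.1 he
    obtain ⟨k, hkv, hek⟩ : ∃ k, k ≠ v ∧ e = {v, k} := by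
      obtain ⟨p, q, hpq, rfl⟩ := Finset.card_eq_two.1 hec
      rcases Finset.mem_insert.1 hve with rfl | h
      · exact ⟨q, hpq.symm, rfl⟩
      · rw [Finset.mem_singleton] at h
        subst h
        exact ⟨p, hpq, Finset.pair_comm _ _⟩
    have hkF : k ∈ F := heF (by simp [hek])
    -- One of `a`, `b` is positive at the other end `k` of `e`, so its coefficient is zero; the
    -- remaining term vanishes at `j` or at `i`, which puts that vertex in `e`.
    obtain ⟨α, β, hα, hβ, h⟩ := hcone1 (normal x e) (fun m _ => hef.normal_nonneg m)
      (hef.normal_eq_zero.2 hve)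
    have hk := h _ (mem_spanOf hkF)
    rw [hef.normal_eq_zero.2 (by simp [hek])] at hk
    have h1 := mul_nonneg hα (ha k)
    have h2 := mul_nonneg hβ (hb k)
    rcases hab k hkF (by simpa using hkv) with h3 | h3
    · right
      have hα0 : α = 0 := (mul_eq_zero.1 (by linarith : α * a (x k) = 0)).resolve_right h3.ne'
      have : j ∈ e := hef.normal_eq_zero.1 (by rw [h _ (mem_spanOf hj), hα0, hjb]; ring)
      rw [hek] at this ⊢
      simp only [Finset.mem_insert, Finset.mem_singleton, hjv, false_or] at this
      rw [this]
    · left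
      have hβ0 : β = 0 := (mul_eq_zero.1 (by linarith : β * b (x k) = 0)).resolve_right h3.ne'
      have : i ∈ e := hef.normal_eq_zero.1 (by rw [h _ (mem_spanOf hi), hβ0, hia]; ring)
      rw [hek] at this ⊢
      simp only [Finset.mem_insert, Finset.mem_singleton, hiv, false_or] at this
      rw [this]
  · intro k hk hkv
    exact (hab k hk (by simpa using hkv)).imp (hGpos k hk) (hHpos k hk)
  · intro l hl hlv
    obtain ⟨α, β, hα, hβ, h⟩ := hcone1 l hl hlv
    exact ⟨α * c, β * d, mul_nonneg hα hc.le, mul_nonneg hβ hd.le, fun y hy => by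
      rw [h y hy, hGa y hy, hHb y hy]; ring⟩

end IsVertexFamily

end Polytope

/-! ### Euler's formula by counting tangents -/

/-- Only the unique minimum and the unique maximum are dropped. The count is applied to all facets
and to the facets at one vertex. -/
theorem card_strictly_between {α : Type*} [DecidableEq α] (s : Finset α) (f : α → ℝ)
    (hf : ∀ a ∈ s, ∀ b ∈ s, a ≠ b → f a ≠ f b) (hs : 1 < s.card)
    [DecidablePred fun a => (∃ b ∈ s, f b < f a) ∧ ∃ c ∈ s, f a < f c] :
    (s.filter fun a => (∃ b ∈ s, f b < f a) ∧ ∃ c ∈ s, f a < f c).card + 2 = s.card := by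
  have hne : s.Nonempty := Finset.card_pos.1 (by omega)
  obtain ⟨M, hM, hMax⟩ := s.exists_max_image f hne
  obtain ⟨m, hm, hMin⟩ := s.exists_min_image f hne
  have hmM : m ≠ M := by
    rintro rfl
    obtain ⟨a, ha, b, hb, hab⟩ := Finset.one_lt_card.1 hs
    exact hf a ha b hb hab (le_antisymm ((hMax a ha).trans (hMin b hb))
      ((hMax b hb).trans (hMin a ha)))
  have : s.filter (fun a => (∃ b ∈ s, f b < f a) ∧ ∃ c ∈ s, f a < f c) = (s.erase m).erase M := by
    ext a
    simp only [Finset.mem_filter, Finset.mem_erase]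
    constructor
    · rintro ⟨ha, ⟨b, hb, hba⟩, ⟨c, hc, hac⟩⟩
      refine ⟨?_, ?_, ha⟩
      · rintro rfl; exact (hMax c hc).not_gt hac
      · rintro rfl; exact (hMin b hb).not_gt hba
    · rintro ⟨h1, h2, ha⟩
      exact ⟨ha, ⟨m, hm, lt_of_le_of_ne (hMin a ha) (hf m hm a ha h2.symm)⟩,
        ⟨M, hM, lt_of_le_of_ne (hMax a ha) (hf a ha M hM h1)⟩⟩
  rw [this, Finset.card_erase_of_mem (Finset.mem_erase.2 ⟨hmM.symm, hM⟩),
    Finset.card_erase_of_mem hm]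
  omega

namespace IsVertexFamily

variable {ι W : Type*} [Fintype ι] [AddCommGroup W] [Module ℝ W] [FiniteDimensional ℝ W]
  {x : ι → W}

theorem four_le_card (hx : IsVertexFamily x) : 4 ≤ Fintype.card ι := by
  by_contra! h
  have h1 := hx.rank_eq_card (T := Finset.univ) (by rw [Finset.card_univ]; omega)
  rw [hx.rank_univ, Finset.card_univ] at h1
  omega

/-- The functional exposing a vertex is positive at all other vertices, so the sum of two of them is
positive everywhere. -/
theorem exists_pos_dual (hx : IsVertexFamily x) : ∃ h : Dual ℝ W, ∀ i, 0 < h (x i) := by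
  have : 1 < Fintype.card ι := by have := hx.four_le_card; omega
  obtain ⟨i, j, hij⟩ := Fintype.exists_pair_of_one_lt_card this
  refine ⟨normal x {i} + normal x {j}, fun k => ?_⟩
  have hi := (hx.vertex i).normal_nonneg k
  have hj := (hx.vertex j).normal_nonneg k
  rw [LinearMap.add_apply]
  by_cases hk : k = i
  · have := (hx.vertex j).normal_pos (i := k) (by simp [hk, hij])
    linarith
  · have := (hx.vertex i).normal_pos (i := k) (by simp [hk])
    linarith

/-- A supporting plane at `v` is rotated until it meets a further vertex `t`. Then it contains a
third vertex and exposes a facet, or `{v, t}` is an edge, which lies in facets. -/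
theorem exists_facet (hx : IsVertexFamily x) (v : ι) : ∃ F ∈ facets x, v ∈ F := by
  classical
  have hc := hx.four_le_card
  obtain ⟨i, hi, j, hj, hij⟩ : ∃ i ∈ Finset.univ.erase v, ∃ j ∈ Finset.univ.erase v, i ≠ j := by
    apply Finset.one_lt_card.1
    rw [Finset.card_erase_of_mem (Finset.mem_univ v), Finset.card_univ]
    omega
  have hiv : i ≠ v := (Finset.mem_erase.1 hi).1
  have hjv : j ≠ v := (Finset.mem_erase.1 hj).1
  have pos : ∀ k m : ι, m ≠ k → 0 < normal x {k} (x m) := fun k m h =>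
    (hx.vertex k).normal_pos (by simpa using h)
  have zero : ∀ k : ι, normal x {k} (x k) = 0 := fun k => (hx.vertex k).normal_eq_zero.2 (by simp)
  -- The coefficients make `f` vanish at `v`. Its signs at `i` and `j` are opposite.
  set f : Dual ℝ W := normal x {j} (x v) • normal x {i} - normal x {i} (x v) • normal x {j} with hf
  have hfv : f (x v) = 0 := by simp [hf]; ring
  have hfi : f (x i) < 0 := by
    have := mul_pos (pos i v hiv.symm) (pos j i hij)
    simp [hf, zero, this]
  have hfj : 0 < f (x j) := by
    have := mul_pos (pos j v hjv.symm) (pos i j hij.symm)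
    simp [hf, zero, this]
  -- The maximal ratio `c` is the least multiple of the functional exposing `v` that dominates `f`.
  -- Equality at `t` makes `t` a zero of `c • normal x {v} - f`, while the negative value of `f` at
  -- `i` keeps it from vanishing there.
  obtain ⟨t, ht, hmax⟩ := (Finset.univ.erase v).exists_max_image
    (fun k => f (x k) / normal x {v} (x k)) ⟨i, hi⟩
  have htv : t ≠ v := (Finset.mem_erase.1 ht).1
  set c := f (x t) / normal x {v} (x t) with hcdef
  have hc0 : 0 < c := (div_pos hfj (pos v j hjv)).trans_le (hmax j hj)
  set a : Dual ℝ W := c • normal x {v} - f with ha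
  have ha0 : ∀ k, 0 ≤ a (x k) := by
    intro k
    by_cases hk : k = v
    · simp [ha, hk, zero, hfv]
    · have := hmax k (by simp [hk])
      rw [div_le_iff₀ (pos v k hk)] at this
      simp [ha, this]
  have hav : a (x v) = 0 := by simp [ha, zero, hfv]
  have hat : a (x t) = 0 := by
    have := (pos v t htv).ne'
    simp only [ha, hcdef, LinearMap.sub_apply, LinearMap.smul_apply, smul_eq_mul]
    field_simp
    ring
  have hai : 0 < a (x i) := by
    have := mul_pos hc0 (pos v i hiv)
    simp only [ha, LinearMap.sub_apply, LinearMap.smul_apply, smul_eq_mul]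
    linarith
  by_cases h3 : ∃ k, k ≠ v ∧ k ≠ t ∧ a (x k) = 0
  · obtain ⟨k, hkv, hkt, hk⟩ := h3
    refine ⟨_, hx.zeroSet_eq (T := {v, t}) ha0 (by simp [hav, hat])
      (Finset.card_pair htv.symm).ge (i := k) (by simp [hkv, hkt]) hk hai.ne', by simp [hav]⟩
  · push Not at h3
    have he : {v, t} ∈ edges x := by
      refine mem_edges.2 ⟨⟨a, fun k => ⟨ha0 k, fun h => ?_, fun h => ?_⟩⟩, Finset.card_pair htv.symm⟩
      · by_contra hk
        simp only [Finset.mem_insert, Finset.mem_singleton, not_or] at hk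
        exact h3 k hk.1 hk.2 h
      · simp only [Finset.mem_insert, Finset.mem_singleton] at h
        rcases h with rfl | rfl <;> assumption
    obtain ⟨F, hF, -, -, -, heF, -⟩ := hx.edge_facets he
    exact ⟨F, hF, heF (by simp)⟩

open Classical in
theorem card_facets_edge (hx : IsVertexFamily x) {e : Finset ι} (he : e ∈ edges x) :
    ((facets x).filter fun F => e ⊆ F).card = 2 := by
  obtain ⟨F, hF, G, hG, hFG, heF, heG, -, h, -⟩ := hx.edge_facets he
  rw [Finset.card_eq_two]
  refine ⟨F, G, hFG, Finset.ext fun H => ?_⟩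
  simp only [Finset.mem_filter, Finset.mem_insert, Finset.mem_singleton]
  refine ⟨fun hH => h H hH.1 hH.2, ?_⟩
  rintro (rfl | rfl)
  exacts [⟨hF, heF⟩, ⟨hG, heG⟩]

open Classical in
theorem card_edges_corner (hx : IsVertexFamily x) {F : Finset ι} (hF : F ∈ facets x) {v : ι}
    (hv : v ∈ F) : (((edges x).filter fun e => e ⊆ F).filter fun e => v ∈ e).card = 2 := by
  obtain ⟨i, hi, j, hj, hij, hei, hej, h, -⟩ := hx.corner hF hv
  rw [Finset.card_eq_two]
  refine ⟨{v, i}, {v, j}, fun h => ?_, Finset.ext fun e => ?_⟩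
  · have h1 : i ∈ ({v, j} : Finset ι) := h ▸ (by simp)
    have h2 := (mem_edges.1 hei).2
    simp only [Finset.mem_insert, Finset.mem_singleton, hij, or_false] at h1
    simp [h1] at h2
  · simp only [Finset.mem_filter, Finset.mem_insert, Finset.mem_singleton]
    constructor
    · rintro ⟨⟨he, heF⟩, hve⟩
      exact h e he hve heF
    · rintro (rfl | rfl)
      · exact ⟨⟨hei, by simp [Finset.insert_subset_iff, hv, hi]⟩, by simp⟩
      · exact ⟨⟨hej, by simp [Finset.insert_subset_iff, hv, hj]⟩, by simp⟩

/-- The number of incidences of vertices and two-dimensional faces. -/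
theorem sum_card_facets (hx : IsVertexFamily x) : ∑ F ∈ facets x, F.card = 2 * (edges x).card := by
  classical
  have h1 : ∀ F ∈ facets x, ((edges x).filter fun e => e ⊆ F).card = F.card := by
    intro F hF
    have := Finset.card_mul_eq_card_mul (s := F) (t := (edges x).filter fun e => e ⊆ F)
      (r := fun v e => v ∈ e) (m := 2) (n := 2) (fun v hv => hx.card_edges_corner hF hv)
      (fun e he => by
        simp only [Finset.mem_filter] at he
        rw [← (mem_edges.1 he.1).2, Finset.bipartiteBelow, Finset.filter_mem_eq_inter,
          Finset.inter_eq_right.2 he.2])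
    omega
  rw [← Finset.sum_congr rfl h1]
  -- Each edge lies in two facets, and within a facet there are as many edges as vertices.
  have h2 := Finset.sum_card_bipartiteAbove_eq_sum_card_bipartiteBelow (s := edges x)
    (t := facets x) (fun e F => e ⊆ F)
  simp only [Finset.bipartiteAbove, Finset.bipartiteBelow] at h2
  rw [← h2, Finset.sum_congr rfl fun e he => hx.card_facets_edge he]
  simp [mul_comm]

/-- The line joining `v` to the point `Y` of the plane of `F` is tangent to `F`. -/
def IsTangent (x : ι → W) (Y : W) (F : Finset ι) (v : ι) : Prop :=
  ∃ l : Dual ℝ W, l Y = 0 ∧ ∀ j ∈ F, 0 ≤ l (x j) ∧ (l (x j) = 0 ↔ j = v)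

/-- On the plane of `F`, the normals of all facets at `v` are nonnegative combinations of those of
the two facets `G`, `H` adjacent to `F` at `v`. Both signs therefore occur at `Y` exactly when `G`
and `H` have opposite signs there, that is, when some positive combination of their normals vanishes
at `Y`. -/
theorem isTangent_iff (hx : IsVertexFamily x) {F : Finset ι} (hF : F ∈ facets x) {Y : W}
    (hY : Y ∈ spanOf x F) (hgen : ∀ G ∈ facets x, G ≠ F → normal x G Y ≠ 0) {v : ι} (hv : v ∈ F) :
    IsTangent x Y F v ↔ (∃ G ∈ facets x, v ∈ G ∧ normal x G Y < 0) ∧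
      ∃ H ∈ facets x, v ∈ H ∧ 0 < normal x H Y := by
  classical
  obtain ⟨i, hi, j, hj, hij, hei, hej, -, G, hG, H, hH, hGF, hHF, hvG, hvH, hGj, hHi, hiG, hjH, hpos,
    hcone⟩ := hx.corner hF hv
  have hG0 := hgen G hG hGF
  have hH0 := hgen H hH hHF
  have hGf := (mem_facets.1 hG).1
  have hHf := (mem_facets.1 hH).1
  have comb : ∀ K ∈ facets x, v ∈ K → ∃ α β : ℝ, 0 ≤ α ∧ 0 ≤ β ∧
      normal x K Y = α * normal x G Y + β * normal x H Y := by
    intro K hK hvK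
    have hKf := (mem_facets.1 hK).1
    obtain ⟨α, β, hα, hβ, h⟩ := hcone (normal x K) (fun i _ => hKf.normal_nonneg i)
      (hKf.normal_eq_zero.2 hvK)
    exact ⟨α, β, hα, hβ, h Y hY⟩
  constructor
  · rintro ⟨l, hlY, hl⟩
    obtain ⟨α, β, hα, hβ, h⟩ := hcone l (fun k hk => (hl k hk).1) (((hl v hv).2).2 rfl)
    have h1 := h Y hY
    rw [hlY] at h1
    have hβ' : 0 < β := by
      refine lt_of_le_of_ne hβ fun h0 => ?_
      have h2 := h _ (mem_spanOf hi)
      rw [hGf.normal_eq_zero.2 hiG, ← h0] at h2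
      have := ((hl i hi).2).1 (by linarith)
      subst this
      simpa using (mem_edges.1 hei).2
    have hα' : 0 < α := by
      refine lt_of_le_of_ne hα fun h0 => ?_
      have h2 := h _ (mem_spanOf hj)
      rw [hHf.normal_eq_zero.2 hjH, ← h0] at h2
      have := ((hl j hj).2).1 (by linarith)
      subst this
      simpa using (mem_edges.1 hej).2
    rcases lt_or_gt_of_ne hG0 with h2 | h2
    · refine ⟨⟨G, hG, hvG, h2⟩, H, hH, hvH, ?_⟩
      have := mul_neg_of_pos_of_neg hα' h2
      exact pos_of_mul_pos_right (by linarith) hβ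
    · refine ⟨⟨H, hH, hvH, ?_⟩, G, hG, hvG, h2⟩
      have := mul_pos hα' h2
      by_contra! h3
      have := mul_nonneg hβ h3
      linarith
  · rintro ⟨⟨K, hK, hvK, hK0⟩, L, hL, hvL, hL0⟩
    have hopp : normal x G Y * normal x H Y < 0 := by
      obtain ⟨α, β, hα, hβ, h⟩ := comb K hK hvK
      obtain ⟨γ, δ, hγ, hδ, h'⟩ := comb L hL hvL
      rcases lt_or_gt_of_ne hG0 with h2 | h2 <;> rcases lt_or_gt_of_ne hH0 with h3 | h3
      · have := mul_nonneg hγ (neg_nonneg.2 h2.le)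
        have := mul_nonneg hδ (neg_nonneg.2 h3.le)
        linarith
      · exact mul_neg_of_neg_of_pos h2 h3
      · exact mul_neg_of_pos_of_neg h2 h3
      · have := mul_nonneg hα h2.le
        have := mul_nonneg hβ h3.le
        linarith
    -- The weights are exchanged so that the two terms, of opposite sign, cancel at `Y`.
    refine ⟨|normal x H Y| • normal x G + |normal x G Y| • normal x H, ?_, fun k hk => ?_⟩
    · simp only [LinearMap.add_apply, LinearMap.smul_apply, smul_eq_mul]
      rcases lt_or_gt_of_ne hG0 with h2 | h2
      · rw [abs_of_neg h2, abs_of_pos (pos_of_mul_neg_right hopp h2.le)]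
        ring
      · rw [abs_of_pos h2, abs_of_neg (neg_of_mul_neg_right hopp h2.le)]
        ring
    · have h1 := mul_nonneg (abs_nonneg (normal x H Y)) (hGf.normal_nonneg k)
      have h2 := mul_nonneg (abs_nonneg (normal x G Y)) (hHf.normal_nonneg k)
      simp only [LinearMap.add_apply, LinearMap.smul_apply, smul_eq_mul]
      refine ⟨by linarith, fun h => by_contra fun hkv => ?_, ?_⟩
      · rcases hpos k hk hkv with h3 | h3
        · have := mul_pos (abs_pos.2 hH0) h3
          linarith
        · have := mul_pos (abs_pos.2 hG0) h3
          linarith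
      · rintro rfl
        rw [hGf.normal_eq_zero.2 hvG, hHf.normal_eq_zero.2 hvH]
        ring

/-- A point of the plane of `F` with both signs among the facet normals lies outside `F`, and two
tangents to a convex polygon issue from a generic outer point. -/
theorem ncard_isTangent (hx : IsVertexFamily x) {F : Finset ι} (hF : F ∈ facets x) {Y : W}
    (hY : Y ∈ spanOf x F) (hgen : ∀ G ∈ facets x, G ≠ F → normal x G Y ≠ 0)
    {G H : Finset ι} (hG : G ∈ facets x) (hGY : normal x G Y < 0) (hH : H ∈ facets x)
    (hHY : 0 < normal x H Y) : {v | v ∈ F ∧ IsTangent x Y F v}.ncard = 2 := by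
  classical
  have hGf := (mem_facets.1 hG).1
  have hHf := (mem_facets.1 hH).1
  -- A positive functional is corrected at `Y` by a nonnegative multiple of the normal of `G` or of
  -- `H`, according to the sign of its value there.
  obtain ⟨h, hpos, hhY⟩ : ∃ h : Dual ℝ W, (∀ i, 0 < h (x i)) ∧ h Y = 0 := by
    obtain ⟨h, hpos⟩ := hx.exists_pos_dual
    rcases le_total 0 (h Y) with h0 | h0
    · refine ⟨h + (h Y / -normal x G Y) • normal x G, fun i => ?_, ?_⟩
      · have := mul_nonneg (div_nonneg h0 (neg_nonneg.2 hGY.le)) (hGf.normal_nonneg i)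
        have := hpos i
        simp only [LinearMap.add_apply, LinearMap.smul_apply, smul_eq_mul]
        linarith
      · simp only [LinearMap.add_apply, LinearMap.smul_apply, smul_eq_mul]
        field_simp [hGY.ne]
        ring
    · refine ⟨h + (-h Y / normal x H Y) • normal x H, fun i => ?_, ?_⟩
      · have := mul_nonneg (div_nonneg (neg_nonneg.2 h0) hHY.le) (hHf.normal_nonneg i)
        have := hpos i
        simp only [LinearMap.add_apply, LinearMap.smul_apply, smul_eq_mul]
        linarith
      · simp only [LinearMap.add_apply, LinearMap.smul_apply, smul_eq_mul]
        field_simp [hHY.ne']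
        ring
  rw [← ncard_tangent (x := x) (A := ∅) (B := F) (Finset.empty_subset F)
    (by rw [hx.rank_empty, (mem_facets.1 hF).2]) hY ⟨normal x G, by simp, hGY.ne⟩ h (by simp)
    (fun i _ _ => hpos i) hhY]
  · congr 1
    ext v
    simp [IsTangent]
  · intro l hl _ i hi j hj _ _ hij hli hlj hlY
    obtain ⟨-, -, -, -, -, -, -, -, K, hK, L, hL, hKF, hLF, -, -, -, -, -, -, hab, hcone⟩ :=
      hx.corner hF hi
    have hKf := (mem_facets.1 hK).1
    have hLf := (mem_facets.1 hL).1
    -- The zero at `j` removes one of the two adjacent normals; the zero at `Y`, where neither of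
    -- them vanishes, removes the other.
    obtain ⟨α, β, hα, hβ, hc⟩ := hcone l hl hli
    have h1 := hc _ (mem_spanOf hj)
    have h2 := hc _ hY
    rw [hlj] at h1
    rw [hlY] at h2
    have h3 := mul_nonneg hα (hKf.normal_nonneg j)
    have h4 := mul_nonneg hβ (hLf.normal_nonneg j)
    have : α = 0 ∧ β = 0 := by
      rcases hab j hj hij.symm with h5 | h5
      · have hα0 : α = 0 :=
          (mul_eq_zero.1 (by linarith : α * normal x K (x j) = 0)).resolve_right h5.ne'
        rw [hα0, zero_mul, zero_add] at h2
        exact ⟨hα0, (mul_eq_zero.1 h2.symm).resolve_right (hgen L hL hLF)⟩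
      · have hβ0 : β = 0 :=
          (mul_eq_zero.1 (by linarith : β * normal x L (x j) = 0)).resolve_right h5.ne'
        rw [hβ0, zero_mul, add_zero] at h2
        exact ⟨(mul_eq_zero.1 h2.symm).resolve_right (hgen K hK hKF), hβ0⟩
    intro k hk
    rw [hc _ (mem_spanOf hk), this.1, this.2]
    ring

/-- Any two facets are independent, so a generic point separates them. -/
theorem exists_generic (o : W) (ho : ∀ F ∈ facets x, 0 < normal x F o) :
    ∃ d : W, ∀ F ∈ facets x, ∀ G ∈ facets x, F ≠ G →
      normal x F o * normal x G d ≠ normal x G o * normal x F d := by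
  let I := {p : Finset ι × Finset ι // p.1 ∈ facets x ∧ p.2 ∈ facets x ∧ p.1 ≠ p.2}
  have hne : ∀ p : I, normal x p.1.1 o • normal x p.1.2 - normal x p.1.2 o • normal x p.1.1 ≠ 0 := by
    rintro ⟨⟨F, G⟩, hF, hG, hFG⟩ h0
    simp only at h0 hF hG hFG
    refine hFG (facets_eq_of_subset hF hG fun i hi => ?_)
    have h1 := congrArg (fun l : Dual ℝ W => l (x i)) h0
    simp only [LinearMap.sub_apply, LinearMap.smul_apply, smul_eq_mul, LinearMap.zero_apply,
      (mem_facets.1 hF).1.normal_eq_zero.2 hi, mul_zero, sub_zero] at h1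
    exact (mem_facets.1 hG).1.normal_eq_zero.1 ((mul_eq_zero.1 h1).resolve_left (ho F hF).ne')
  obtain ⟨f, hf⟩ := Module.exists_dual_forall_apply_ne_zero (K := ℝ) _ hne
  obtain ⟨d, rfl⟩ := (Module.evalEquiv ℝ W).surjective f
  refine ⟨d, fun F hF G hG hFG h => ?_⟩
  apply hf ⟨(F, G), hF, hG, hFG⟩
  simp [h]

/-- **Euler's formula**. -/
theorem euler (hx : IsVertexFamily x) :
    (edges x).card + 2 = Fintype.card ι + (facets x).card := by
  classical
  -- The sum of all generators is an interior point of the cone.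
  set o : W := ∑ i, x i with ho
  have hopos : ∀ F ∈ facets x, 0 < normal x F o := by
    intro F hF
    obtain ⟨i, hi⟩ := hx.exists_notMem hF
    have hFf := (mem_facets.1 hF).1
    rw [ho, map_sum]
    exact Finset.sum_pos' (fun j _ => hFf.normal_nonneg j) ⟨i, Finset.mem_univ i, hFf.normal_pos hi⟩
  obtain ⟨d, hd⟩ := exists_generic o hopos
  set f : Finset ι → ℝ := fun F => normal x F d / normal x F o with hfdef
  have hfinj : ∀ F ∈ facets x, ∀ G ∈ facets x, F ≠ G → f F ≠ f G := by
    intro F hF G hG hFG h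
    rw [hfdef, div_eq_div_iff (hopos F hF).ne' (hopos G hG).ne'] at h
    exact hd F hF G hG hFG (by linarith)
  -- `Y F` is the combination of `o` and `d` that lies in the plane of `F`. Its sign with respect to
  -- another facet `G` is the sign of `f G - f F`, so `f` is the order in which the line through `o`
  -- and `d` meets the planes of the facets.
  set Y : Finset ι → W := fun F => normal x F o • d - normal x F d • o with hYdef
  have hYval : ∀ F ∈ facets x, ∀ G ∈ facets x,
      normal x G (Y F) = normal x F o * normal x G o * (f G - f F) := by
    intro F hF G hG
    have h1 := (hopos F hF).ne'
    have h2 := (hopos G hG).ne'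
    simp only [hYdef, hfdef, map_sub, map_smul, smul_eq_mul]
    field_simp
  have hYmem : ∀ F ∈ facets x, Y F ∈ spanOf x F := fun F hF =>
    hx.mem_spanOf_facet hF (by rw [hYval F hF F hF]; ring)
  have hneg : ∀ F ∈ facets x, ∀ G ∈ facets x, normal x G (Y F) < 0 ↔ f G < f F := by
    intro F hF G hG
    have := mul_pos (hopos F hF) (hopos G hG)
    rw [hYval F hF G hG]
    constructor
    · intro h
      by_contra! h'
      have := mul_nonneg this.le (sub_nonneg.2 h')
      linarith
    · intro h
      exact mul_neg_of_pos_of_neg this (sub_neg.2 h)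
  have hpos : ∀ F ∈ facets x, ∀ G ∈ facets x, 0 < normal x G (Y F) ↔ f F < f G := by
    intro F hF G hG
    have := mul_pos (hopos F hF) (hopos G hG)
    rw [hYval F hF G hG, mul_pos_iff_of_pos_left this, sub_pos]
  have hgen : ∀ F ∈ facets x, ∀ G ∈ facets x, G ≠ F → normal x G (Y F) ≠ 0 := by
    intro F hF G hG hGF
    rcases lt_or_gt_of_ne (hfinj G hG F hF hGF) with h | h
    · exact ((hneg F hF G hG).2 h).ne
    · exact ((hpos F hF G hG).2 h).ne'
  have htan : ∀ F ∈ facets x, ∀ v ∈ F, IsTangent x (Y F) F v ↔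
      (∃ G ∈ (facets x).filter (fun F => v ∈ F), f G < f F) ∧
        ∃ G ∈ (facets x).filter (fun F => v ∈ F), f F < f G := by
    intro F hF v hv
    rw [hx.isTangent_iff hF (hYmem F hF) (hgen F hF) hv]
    simp only [Finset.mem_filter, and_assoc]
    refine and_congr (exists_congr fun G => and_congr_right fun hG => and_congr_right fun _ => ?_)
      (exists_congr fun G => and_congr_right fun hG => and_congr_right fun _ => ?_)
    exacts [hneg F hF G hG, hpos F hF G hG]
  have hcardv : ∀ v : ι, 1 < ((facets x).filter fun F => v ∈ F).card := by
    intro v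
    obtain ⟨F, hF, hv⟩ := hx.exists_facet v
    obtain ⟨-, -, -, -, -, -, -, -, G, hG, -, -, hGF, -, hvG, -⟩ := hx.corner hF hv
    exact Finset.one_lt_card.2 ⟨F, by simp [hF, hv], G, by simp [hG, hvG], hGF.symm⟩
  have hcard : 1 < (facets x).card := by
    obtain ⟨v⟩ : Nonempty ι := Fintype.card_pos_iff.1 (by have := hx.four_le_card; omega)
    exact (hcardv v).trans_le (Finset.card_filter_le _ _)
  -- The tangent pairs are counted by vertices and by facets.
  have hdc := Finset.sum_card_bipartiteAbove_eq_sum_card_bipartiteBelow (s := Finset.univ)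
    (t := facets x) (fun v F => v ∈ F ∧ IsTangent x (Y F) F v)
  simp only [Finset.bipartiteAbove, Finset.bipartiteBelow] at hdc
  have hV : ∀ v : ι, ((facets x).filter fun F => v ∈ F ∧ IsTangent x (Y F) F v).card + 2 =
      ((facets x).filter fun F => v ∈ F).card := by
    intro v
    rw [← card_strictly_between ((facets x).filter fun F => v ∈ F) f
      (fun F hF G hG => hfinj F (Finset.mem_filter.1 hF).1 G (Finset.mem_filter.1 hG).1) (hcardv v),
      Finset.filter_filter]
    congr 2
    refine Finset.filter_congr fun F hF => and_congr_right fun hv => htan F hF v hv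
  have hF : ∀ F ∈ facets x, (Finset.univ.filter fun v => v ∈ F ∧ IsTangent x (Y F) F v).card =
      if (∃ G ∈ facets x, f G < f F) ∧ ∃ G ∈ facets x, f F < f G then 2 else 0 := by
    intro F hF
    split_ifs with h
    · obtain ⟨⟨G, hG, hGF⟩, H, hH, hFH⟩ := h
      rw [← hx.ncard_isTangent hF (hYmem F hF) (hgen F hF) hG ((hneg F hF G hG).2 hGF) hH
        ((hpos F hF H hH).2 hFH), ← Set.ncard_coe_finset]
      congr 1
      ext v
      simp
    · rw [Finset.card_eq_zero, Finset.filter_eq_empty_iff]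
      rintro v - ⟨hv, ht⟩
      rw [htan F hF v hv] at ht
      obtain ⟨⟨G, hG, hGF⟩, H, hH, hFH⟩ := ht
      exact h ⟨⟨G, (Finset.mem_filter.1 hG).1, hGF⟩, H, (Finset.mem_filter.1 hH).1, hFH⟩
  rw [Finset.sum_congr rfl hF, ← Finset.sum_filter, Finset.sum_const, smul_eq_mul] at hdc
  have hbt := card_strictly_between (facets x) f hfinj hcard
  have hinc := Finset.sum_card_bipartiteAbove_eq_sum_card_bipartiteBelow (s := Finset.univ)
    (t := facets x) (fun (v : ι) F => v ∈ F)
  simp only [Finset.bipartiteAbove, Finset.bipartiteBelow] at hinc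
  -- What remains is `2 (F - 2) + 2 V = 2 E`, where the right side counts incidences of vertices and
  -- facets.
  rw [← Finset.sum_congr rfl fun v _ => hV v, Finset.sum_add_distrib, hdc] at hinc
  simp only [Finset.sum_const, Finset.card_univ, smul_eq_mul, Finset.filter_univ_mem,
    hx.sum_card_facets] at hinc
  omega

end IsVertexFamily

/-! ### The Klein model and ideal polyhedra as cones over null vectors -/

section Model

/-- The inclusion of `ℝ³` as the vectors of time coordinate `0`. -/
def spatial : E3 →ₗ[ℝ] (Fin 4 → ℝ) where
  toFun y := Fin.cons 0 fun i : Fin 3 => y i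
  map_add' y z := by ext i; refine Fin.cases ?_ (fun j => ?_) i <;> simp
  map_smul' c y := by ext i; refine Fin.cases ?_ (fun j => ?_) i <;> simp

@[simp] theorem spatial_zero (y : E3) : spatial y 0 = 0 := rfl

@[simp] theorem spatial_succ (y : E3) (i : Fin 3) : spatial y i.succ = y i := rfl

@[simp] theorem homog_zero (y : E3) : homog y 0 = 1 := rfl

@[simp] theorem homog_succ (y : E3) (i : Fin 3) : homog y i.succ = y i := rfl

theorem spatial_injective : Function.Injective spatial := fun y z h => by
  ext i
  simpa using congrFun h i.succ

theorem homog_injective : Function.Injective homog := fun y z h => by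
  ext i
  simpa using congrFun h i.succ

theorem homog_add (y z : E3) : homog (y + z) = homog y + spatial z := by
  ext i; refine Fin.cases ?_ (fun j => ?_) i <;> simp

theorem homog_sub_homog (y z : E3) : homog y - homog z = spatial (y - z) := by
  ext i; refine Fin.cases ?_ (fun j => ?_) i <;> simp

theorem homog_combo {a b : ℝ} (hab : a + b = 1) (y z : E3) :
    homog (a • y + b • z) = a • homog y + b • homog z := by
  ext i; refine Fin.cases ?_ (fun j => ?_) i <;> simp [hab]

theorem homog_sum {α : Type*} (T : Finset α) (w : α → ℝ) (hw : ∑ i ∈ T, w i = 1) (y : α → E3) :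
    homog (∑ i ∈ T, w i • y i) = ∑ i ∈ T, w i • homog (y i) := by
  ext i; refine Fin.cases ?_ (fun j => ?_) i <;> simp [hw]

theorem mink_homog (y z : E3) : mink (homog y) (homog z) = inner ℝ y z - 1 := by
  simp only [mink, homog_zero, homog_succ, PiLp.inner_apply]
  simp [mul_comm]
  ring

theorem mink_comm (X Y : Fin 4 → ℝ) : mink X Y = mink Y X := by
  simp [mink, mul_comm]

/-- The Minkowski form as a linear functional of its second argument. -/
def minkDual (N : Fin 4 → ℝ) : Dual ℝ (Fin 4 → ℝ) where
  toFun Y := mink N Y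
  map_add' Y Z := by simp only [mink, Fin.sum_univ_three, Pi.add_apply]; ring
  map_smul' c Y := by
    simp only [mink, Fin.sum_univ_three, Pi.smul_apply, smul_eq_mul, RingHom.id_apply]; ring

@[simp] theorem minkDual_apply (N Y : Fin 4 → ℝ) : minkDual N Y = mink N Y := rfl

/-- Every functional is a Minkowski product. -/
theorem exists_minkDual (l : Dual ℝ (Fin 4 → ℝ)) : ∃ N, l = minkDual N := by
  refine ⟨Fin.cons (-l (Pi.single 0 1)) fun i : Fin 3 => l (Pi.single i.succ 1), ?_⟩
  refine LinearMap.pi_ext' fun i => LinearMap.ext_ring ?_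
  refine Fin.cases ?_ (fun j => ?_) i
  · simp [mink, Fin.succ_ne_zero]
  · simp [mink, Pi.single_apply, Fin.succ_inj, (Fin.succ_ne_zero _).symm]

/-- The span of the homogeneous coordinates is the direct sum of the direction, at time zero, and
the line of one point at time one. This is the shift between dimension and rank. -/
theorem finrank_span_homog {A : Set E3} (hA : A.Nonempty) :
    finrank ℝ (Submodule.span ℝ (homog '' A)) = finrank ℝ (vectorSpan ℝ A) + 1 := by
  obtain ⟨p, hp⟩ := hA
  have h1 : Submodule.span ℝ (homog '' A) =
      (vectorSpan ℝ A).map spatial ⊔ Submodule.span ℝ {homog p} := by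
    rw [vectorSpan_eq_span_vsub_set_right ℝ hp, Submodule.map_span]
    apply le_antisymm
    · rw [Submodule.span_le]
      rintro _ ⟨y, hy, rfl⟩
      have : homog y = spatial (y - p) + homog p := by rw [← homog_sub_homog]; simp
      rw [this]
      refine Submodule.add_mem_sup (Submodule.subset_span ⟨_, ⟨y, hy, rfl⟩, rfl⟩)
        (Submodule.mem_span_singleton_self _)
    · rw [sup_le_iff, Submodule.span_le, Submodule.span_singleton_le_iff_mem]
      refine ⟨?_, Submodule.subset_span ⟨p, hp, rfl⟩⟩
      rintro _ ⟨_, ⟨y, hy, rfl⟩, rfl⟩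
      simp only [vsub_eq_sub, ← homog_sub_homog]
      exact Submodule.sub_mem _ (Submodule.subset_span ⟨y, hy, rfl⟩)
        (Submodule.subset_span ⟨p, hp, rfl⟩)
  have h2 : (vectorSpan ℝ A).map spatial ⊓ Submodule.span ℝ {homog p} = ⊥ := by
    rw [eq_bot_iff]
    rintro _ ⟨⟨y, -, rfl⟩, hc⟩
    obtain ⟨c, hc⟩ := Submodule.mem_span_singleton.1 hc
    have h0 := congrFun hc 0
    have : c = 0 := by simpa using h0
    simp [← hc, this]
  have h3 := Submodule.finrank_sup_add_finrank_inf_eq ((vectorSpan ℝ A).map spatial)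
    (Submodule.span ℝ {homog p})
  have h4 : homog p ≠ 0 := fun h => by simpa using congrFun h 0
  rw [h2, finrank_bot, finrank_span_singleton h4, ← h1,
    ← (Submodule.equivMapOfInjective spatial spatial_injective (vectorSpan ℝ A)).finrank_eq] at h3
  exact h3

/-- An affine function is a linear functional of the homogeneous coordinates, so the set where `l`
is maximal becomes the zero set of the nonnegative functional `max l - l`. -/
theorem isExposed_iff {P F : Set E3} (hF : F.Nonempty) :
    IsExposed ℝ P F ↔ ∃ l : Dual ℝ (Fin 4 → ℝ), (∀ y ∈ P, 0 ≤ l (homog y)) ∧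
      F = {y ∈ P | l (homog y) = 0} := by
  constructor
  · intro h
    obtain ⟨l, rfl⟩ := h hF
    obtain ⟨p, hp, hmax⟩ := hF
    let m : Dual ℝ (Fin 4 → ℝ) := (l p) • LinearMap.proj 0 -
      (l : E3 →ₗ[ℝ] ℝ) ∘ₗ (WithLp.linearEquiv 2 ℝ (Fin 3 → ℝ)).symm.toLinearMap ∘ₗ
        LinearMap.funLeft ℝ ℝ Fin.succ
    have hm : ∀ y : E3, m (homog y) = l p - l y := fun y => by
      have : (WithLp.linearEquiv 2 ℝ (Fin 3 → ℝ)).symm (LinearMap.funLeft ℝ ℝ Fin.succ (homog y)) = y := by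
        ext i; simp [LinearMap.funLeft]
      simp only [m, LinearMap.sub_apply, LinearMap.smul_apply, LinearMap.comp_apply,
        LinearEquiv.coe_coe, this]
      simp
    refine ⟨m, fun y hy => by rw [hm]; exact sub_nonneg.2 (hmax y hy), ?_⟩
    ext y
    simp only [Set.mem_ofPred_eq, hm, sub_eq_zero]
    refine and_congr_right fun hy => ⟨fun h => le_antisymm (h p hp) (hmax y hy), fun h z hz => ?_⟩
    rw [← h]
    exact hmax z hz
  · rintro ⟨l, hl, rfl⟩ -
    obtain ⟨p, hp, hp0⟩ := hF
    refine ⟨-(LinearMap.toContinuousLinearMap (l ∘ₗ spatial)), ?_⟩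
    have hm : ∀ y : E3, l (homog y) = l (homog 0) + l (spatial y) := fun y => by
      rw [← map_add, ← homog_add, zero_add]
    ext y
    simp only [Set.mem_ofPred_eq, neg_apply, neg_le_neg_iff,
      LinearMap.coe_toContinuousLinearMap', LinearMap.comp_apply]
    refine and_congr_right fun hy => ⟨fun h z hz => ?_, fun h => ?_⟩
    · have := hl z hz
      rw [hm] at this h
      linarith
    · have h1 := h p hp
      have := hl y hy
      rw [hm] at this hp0 ⊢
      linarith

/-- The polytope spanned by a set of indices of vertices. -/
def hull {S : Finset E3} (T : Finset S) : Set E3 := convexHull ℝ ((↑) '' (T : Set S))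

/-- Homogeneous coordinates of the vertices. -/
def vert (S : Finset E3) (s : S) : Fin 4 → ℝ := homog s

theorem hull_univ (S : Finset E3) : hull (Finset.univ : Finset S) = convexHull ℝ (S : Set E3) := by
  simp [hull]

theorem mem_hull_iff {S : Finset E3} {T : Finset S} {y : E3} :
    y ∈ hull T ↔ ∃ w : S → ℝ, (∀ s ∈ T, 0 ≤ w s) ∧ ∑ s ∈ T, w s = 1 ∧ ∑ s ∈ T, w s • (s : E3) = y := by
  classical
  have h1 : ((↑) '' (T : Set S) : Set E3) = ((T.map (Function.Embedding.subtype _) : Finset E3) : Set E3) := by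
    simp
  rw [hull, h1, Finset.mem_convexHull']
  simp only [Finset.mem_map, Finset.sum_map, Function.Embedding.subtype_apply]
  constructor
  · rintro ⟨w, hw, h1, h2⟩
    exact ⟨fun s => w s, fun s hs => hw s ⟨s, hs, rfl⟩, h1, h2⟩
  · rintro ⟨w, hw, h1, h2⟩
    refine ⟨fun y => if h : y ∈ S then w ⟨y, h⟩ else 0, ?_, ?_, ?_⟩
    · rintro _ ⟨s, hs, rfl⟩
      simpa using hw s hs
    · simpa using h1
    · simpa using h2

theorem mem_hull {S : Finset E3} {T : Finset S} {s : S} (hs : s ∈ T) : (s : E3) ∈ hull T :=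
  subset_convexHull _ _ ⟨s, hs, rfl⟩

theorem hull_mono {S : Finset E3} {T U : Finset S} (h : T ⊆ U) : hull T ⊆ hull U :=
  convexHull_mono (Set.image_mono (by exact_mod_cast h))

theorem convex_hull {S : Finset E3} (T : Finset S) : Convex ℝ (hull T) := convex_convexHull _ _

theorem hull_nonempty {S : Finset E3} {T : Finset S} : (hull T).Nonempty ↔ T.Nonempty := by
  simp [hull]

theorem eval_nonneg_of_mem_hull {S : Finset E3} {T : Finset S} {l : Dual ℝ (Fin 4 → ℝ)}
    (hl : ∀ s ∈ T, 0 ≤ l (vert S s)) {y : E3} (hy : y ∈ hull T) : 0 ≤ l (homog y) := by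
  obtain ⟨w, hw, h1, rfl⟩ := mem_hull_iff.1 hy
  rw [homog_sum _ _ h1, map_sum]
  refine Finset.sum_nonneg fun s hs => ?_
  rw [map_smul]
  exact mul_nonneg (hw s hs) (hl s hs)

theorem eval_eq_zero_of_mem_hull {S : Finset E3} {T : Finset S} {l : Dual ℝ (Fin 4 → ℝ)}
    (hl : ∀ s ∈ T, l (vert S s) = 0) {y : E3} (hy : y ∈ hull T) : l (homog y) = 0 := by
  obtain ⟨w, hw, h1, rfl⟩ := mem_hull_iff.1 hy
  rw [homog_sum _ _ h1, map_sum]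
  refine Finset.sum_eq_zero fun s hs => ?_
  rw [map_smul, ← vert, hl s hs, smul_zero]

/-- The zero set, in the hull of `U`, of a functional nonnegative on `U`. -/
theorem hull_inter_zero {S : Finset E3} {T U : Finset S} {l : Dual ℝ (Fin 4 → ℝ)} (hTU : T ⊆ U)
    (hl : ∀ s ∈ U, 0 ≤ l (vert S s) ∧ (l (vert S s) = 0 ↔ s ∈ T)) :
    {y ∈ hull U | l (homog y) = 0} = hull T := by
  ext y
  constructor
  · rintro ⟨hy, h0⟩
    obtain ⟨w, hw, h1, rfl⟩ := mem_hull_iff.1 hy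
    rw [homog_sum _ _ h1, map_sum, Finset.sum_eq_zero_iff_of_nonneg] at h0
    · have hz : ∀ s ∈ U, s ∉ T → w s = 0 := fun s hs hsT => by
        have := h0 s hs
        rw [map_smul, ← vert, smul_eq_mul] at this
        exact (mul_eq_zero.1 this).resolve_right fun h => hsT (((hl s hs).2).1 h)
      refine mem_hull_iff.2 ⟨w, fun s hs => hw s (hTU hs), ?_, ?_⟩
      · rw [← h1]
        exact Finset.sum_subset hTU hz
      · exact Finset.sum_subset hTU fun s hs hsT => by rw [hz s hs hsT, zero_smul]
    · intro s hs
      rw [map_smul]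
      exact mul_nonneg (hw s hs) (hl s hs).1
  · intro hy
    exact ⟨hull_mono hTU hy, eval_eq_zero_of_mem_hull (fun s hs => ((hl s (hTU hs)).2).2 hs) hy⟩

theorem finrank_hull {S : Finset E3} {T : Finset S} (hT : T.Nonempty) :
    finrank ℝ (spanOf (vert S) T) = finrank ℝ (vectorSpan ℝ (hull T)) + 1 := by
  have h1 : vectorSpan ℝ (hull T) = vectorSpan ℝ ((↑) '' (T : Set S) : Set E3) := by
    rw [← direction_affineSpan, hull, affineSpan_convexHull, direction_affineSpan]
  rw [h1, ← finrank_span_homog (by simpa using hT), spanOf, Set.image_image]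
  rfl

open Classical in
theorem mem_faces_iff {S : Finset E3} {k : ℕ} {F : Set E3} :
    F ∈ faces (convexHull ℝ (S : Set E3)) k ↔ ∃ T : Finset S, T.Nonempty ∧ IsFace (vert S) T ∧
      finrank ℝ (spanOf (vert S) T) = k + 1 ∧ F = hull T := by
  rw [← hull_univ]
  constructor
  · rintro ⟨hne, hex, hr⟩
    obtain ⟨l, hl, hF⟩ := (isExposed_iff hne).1 hex
    have hl' : ∀ s : S, 0 ≤ l (vert S s) := fun s => hl _ (mem_hull (Finset.mem_univ s))
    set T : Finset S := Finset.univ.filter fun s => l (vert S s) = 0 with hT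
    have hF' : F = hull T := by
      rw [hF]
      exact hull_inter_zero (Finset.subset_univ T) fun s _ => ⟨hl' s, by simp [hT]⟩
    have hTne : T.Nonempty := hull_nonempty.1 (hF' ▸ hne)
    refine ⟨T, hTne, ⟨l, fun s => ⟨hl' s, by simp [hT]⟩⟩, ?_, hF'⟩
    rw [finrank_hull hTne, ← hF', hr]
  · rintro ⟨T, hTne, ⟨l, hl⟩, hr, rfl⟩
    have hne : (hull T).Nonempty := hull_nonempty.2 hTne
    refine ⟨hne, (isExposed_iff hne).2 ⟨l, fun y hy =>
      eval_nonneg_of_mem_hull (fun s _ => (hl s).1) hy, ?_⟩, ?_⟩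
    · exact (hull_inter_zero (Finset.subset_univ T) fun s _ => hl s).symm
    · have := finrank_hull hTne
      omega

theorem IsFace.mem_of_mem_hull {S : Finset E3} {T : Finset S} (hT : IsFace (vert S) T) {s : S}
    (hs : (s : E3) ∈ hull T) : s ∈ T := by
  obtain ⟨l, hl⟩ := hT
  exact ((hl s).2).1 (eval_eq_zero_of_mem_hull (fun t ht => ((hl t).2).2 ht) hs)

theorem IsFace.hull_subset_iff {S : Finset E3} {T U : Finset S} (hU : IsFace (vert S) U) :
    hull T ⊆ hull U ↔ T ⊆ U :=
  ⟨fun h _ hs => hU.mem_of_mem_hull (h (mem_hull hs)), hull_mono⟩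

theorem IsFace.hull_inj {S : Finset E3} {T U : Finset S} (hT : IsFace (vert S) T)
    (hU : IsFace (vert S) U) (h : hull T = hull U) : T = U :=
  (hU.hull_subset_iff.1 h.subset).antisymm (hT.hull_subset_iff.1 h.symm.subset)

theorem inner_lt_one {y z : E3} (hy : ‖y‖ = 1) (hz : ‖z‖ = 1) (h : y ≠ z) : inner ℝ y z < 1 := by
  refine lt_of_le_of_ne ?_ fun e => h ((inner_eq_one_iff_of_norm_eq_one hy hz).1 e)
  have := real_inner_le_norm y z
  rwa [hy, hz, one_mul] at this

theorem mink_homog_neg {y z : E3} (hy : ‖y‖ = 1) (hz : ‖z‖ = 1) (h : y ≠ z) :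
    mink (homog y) (homog z) < 0 := by
  rw [mink_homog]
  linarith [inner_lt_one hy hz h]

theorem mink_homog_self {y : E3} (hy : ‖y‖ = 1) : mink (homog y) (homog y) = 0 := by
  rw [mink_homog, real_inner_self_eq_norm_sq, hy]
  norm_num

/-- Distinct null vectors of the future cone have negative Minkowski product. This yields both the
independence of triples and the functionals that expose the vertices. -/
theorem isVertexFamily {S : Finset E3} (hS : ∀ s ∈ S, ‖s‖ = 1)
    (hint : (interior (convexHull ℝ (S : Set E3))).Nonempty) : IsVertexFamily (vert S) := by
  classical
  have hspan : spanOf (vert S) Finset.univ = ⊤ := by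
    apply Submodule.eq_top_of_finrank_eq
    have hne : (S : Set E3).Nonempty := by
      by_contra h
      rw [Set.not_nonempty_iff_eq_empty] at h
      simp [h] at hint
    have hne' : (Finset.univ : Finset S).Nonempty := by
      obtain ⟨s, hs⟩ := hne
      exact ⟨⟨s, hs⟩, Finset.mem_univ _⟩
    have h1 := interior_convexHull_nonempty_iff_affineSpan_eq_top.1 hint
    rw [finrank_hull hne', hull_univ, ← direction_affineSpan, affineSpan_convexHull, h1,
      AffineSubspace.direction_top, finrank_top]
    simp
  refine ⟨by simp, hspan, fun T hT => ?_, fun i => ?_⟩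
  · have hcard : 3 ≤ Fintype.card S := by
      have h1 := finrank_range_le_card (R := ℝ) (vert S)
      rw [spanOf, Finset.coe_univ, Set.image_univ] at hspan
      rw [Set.finrank, hspan, finrank_top] at h1
      simp only [finrank_fintype_fun_eq_card, Fintype.card_fin] at h1
      omega
    -- Subfamilies of independent families are independent, so exactly three vertices suffice.
    obtain ⟨U, hTU, hU⟩ := Finset.exists_superset_card_eq hT hcard
    refine LinearIndepOn.mono ?_ (by exact_mod_cast hTU : (T : Set S) ⊆ U)
    obtain ⟨a, b, c, hab, hac, hbc, rfl⟩ := Finset.card_eq_three.1 hU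
    rw [linearIndepOn_finset_iff]
    intro f hf
    have hne : ∀ s t : S, s ≠ t → mink (homog s) (homog t) < 0 := fun s t h =>
      mink_homog_neg (hS s s.2) (hS t t.2) fun e => h (Subtype.ext e)
    rw [Finset.sum_insert (by simp [hab, hac]), Finset.sum_insert (by simp [hbc]),
      Finset.sum_singleton] at hf
    -- Pairing the relation with the three vectors gives a symmetric system with zero diagonal and
    -- off-diagonal entries `p`, `q`, `r`. Its determinant `2pqr` is nonzero.
    have ha := congrArg (minkDual (homog a)) hf
    have hb := congrArg (minkDual (homog b)) hf
    have hc := congrArg (minkDual (homog c)) hf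
    simp only [map_add, map_smul, minkDual_apply, vert, smul_eq_mul, map_zero,
      mink_homog_self (hS a a.2), mink_homog_self (hS b b.2), mink_homog_self (hS c c.2),
      mink_comm (homog b) (homog a), mink_comm (homog c) (homog a),
      mink_comm (homog c) (homog b)] at ha hb hc
    have h1 := (hne a b hab).ne
    have h2 := (hne a c hac).ne
    have h3 := (hne b c hbc).ne
    set p := mink (homog a) (homog b)
    set q := mink (homog a) (homog c)
    set r := mink (homog b) (homog c)
    have hfc : f c = 0 := by
      have : f c * (q * r) = 0 := by linear_combination (r * ha + q * hb - p * hc) / 2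
      exact (mul_eq_zero.1 this).resolve_right (mul_ne_zero h2 h3)
    have hfb : f b = 0 := by
      rw [hfc] at ha
      exact (mul_eq_zero.1 (by linarith : f b * p = 0)).resolve_right h1
    have hfa : f a = 0 := by
      rw [hfc] at hb
      exact (mul_eq_zero.1 (by linarith : f a * p = 0)).resolve_right h1
    simp [hfa, hfb, hfc]
  · refine ⟨-minkDual (homog i), fun j => ?_⟩
    simp only [LinearMap.neg_apply, minkDual_apply, vert, Finset.mem_singleton]
    by_cases h : j = i
    · simp [h, mink_homog_self (hS i i.2)]
    · have := mink_homog_neg (hS i i.2) (hS j j.2) fun e => h (Subtype.ext e.symm)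
      simp only [neg_eq_zero, h, iff_false]
      exact ⟨by linarith, this.ne⟩

end Model

/-! ### Links of vertices: edges separated by a generic direction -/

namespace IsVertexFamily

variable {ι W : Type*} [Fintype ι] [AddCommGroup W] [Module ℝ W] [FiniteDimensional ℝ W]
  {x : ι → W}

/-- The edges at a vertex `v` whose two facets are separated by a generic direction. -/
theorem card_separated_edges (hx : IsVertexFamily x) (v : ι) (Y : W) (h : Dual ℝ W)
    (hv : h (x v) = 0) (hpos : ∀ i, i ≠ v → 0 < h (x i)) (hY : h Y = 0)
    (hgen : ∀ F ∈ facets x, v ∈ F → normal x F Y ≠ 0)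
    [DecidablePred fun e => v ∈ e ∧ ∃ F ∈ facets x, ∃ G ∈ facets x, e ⊆ F ∧ e ⊆ G ∧
      normal x F Y < 0 ∧ 0 < normal x G Y] :
    ((edges x).filter fun e => v ∈ e ∧ ∃ F ∈ facets x, ∃ G ∈ facets x, e ⊆ F ∧ e ⊆ G ∧
      normal x F Y < 0 ∧ 0 < normal x G Y).card = 2 := by
  classical
  -- Working modulo `v` replaces the polytope by the polygon that is its link. The two tangents to
  -- that polygon from `Y` pass through two of its vertices, which are the edges at `v`.
  have hcard := ncard_tangent (x := x) (A := {v}) (B := Finset.univ) (Finset.subset_univ _)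
    (by rw [hx.rank_univ, hx.rank_singleton]) (hx.span_eq ▸ Submodule.mem_top : Y ∈ _) ?_ h
    (by simpa using hv) (fun i _ hi => hpos i (by simpa using hi)) hY ?_
  · rw [← hcard, ← Set.ncard_coe_finset]
    refine (Set.ncard_congr (fun i _ => {v, i}) ?_ ?_ ?_).symm
    · rintro i ⟨-, hiv, l, hlY, hlv, hl⟩
      replace hlv : l (x v) = 0 := hlv v (by simp)
      replace hiv : i ≠ v := by simpa using hiv
      replace hl : ∀ j, j ≠ v → 0 ≤ l (x j) ∧ (l (x j) = 0 ↔ j = i) := fun j hj =>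
        hl j (Finset.mem_univ j) (by simpa using hj)
      have hl0 : ∀ j, 0 ≤ l (x j) := fun j => by
        by_cases hj : j = v
        · rw [hj, hlv]
        · exact (hl j hj).1
      have hl1 : ∀ j, l (x j) = 0 ↔ j ∈ ({v, i} : Finset ι) := fun j => by
        by_cases hj : j = v
        · simp [hj, hlv]
        · simp [hj, (hl j hj).2]
      have he : {v, i} ∈ edges x :=
        mem_edges.2 ⟨⟨l, fun j => ⟨hl0 j, hl1 j⟩⟩, Finset.card_pair hiv.symm⟩
      obtain ⟨F, hF, G, hG, hFG, heF, heG, hFGe, -, hcone⟩ := hx.edge_facets he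
      obtain ⟨α, β, hα, hβ, hlc⟩ := hcone l hl0 fun j hj => (hl1 j).2 hj
      have third : ∀ K ∈ facets x, ∃ k ∈ K, k ∉ ({v, i} : Finset ι) := fun K hK => by
        by_contra! hsub
        have := Finset.card_le_card (show K ⊆ {v, i} from hsub)
        have := hx.three_le_card hK
        have := (mem_edges.1 he).2
        omega
      -- A zero coefficient would make `l` vanish on a whole facet, which has a vertex outside `{v,
      -- i}`.
      have hβ' : 0 < β := by
        obtain ⟨k, hk, hke⟩ := third F hF
        refine lt_of_le_of_ne hβ fun h0 => hke ((hl1 k).1 ?_)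
        rw [hlc, ← h0]
        simp [(mem_facets.1 hF).1.normal_eq_zero.2 hk]
      have hα' : 0 < α := by
        obtain ⟨k, hk, hke⟩ := third G hG
        refine lt_of_le_of_ne hα fun h0 => hke ((hl1 k).1 ?_)
        rw [hlc, ← h0]
        simp [(mem_facets.1 hG).1.normal_eq_zero.2 hk]
      have hsum : α * normal x F Y + β * normal x G Y = 0 := by
        rw [← hlY, hlc]; simp
      simp only [Finset.coe_filter, Set.mem_ofPred_eq]
      refine ⟨he, by simp, ?_⟩
      rcases lt_or_gt_of_ne (hgen F hF (heF (by simp))) with h1 | h1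
      · refine ⟨F, hF, G, hG, heF, heG, h1, ?_⟩
        have := mul_neg_of_pos_of_neg hα' h1
        exact pos_of_mul_pos_right (by linarith) hβ
      · refine ⟨G, hG, F, hF, heG, heF, ?_, h1⟩
        have := mul_pos hα' h1
        by_contra! h3
        have := mul_nonneg hβ h3
        linarith
    · rintro i j ⟨-, hi, -⟩ - hij
      have : i ∈ ({v, j} : Finset ι) := hij ▸ (by simp)
      simp only [Finset.mem_insert, Finset.mem_singleton] at this hi
      exact this.resolve_left hi
    · intro e he
      simp only [Finset.coe_filter, Set.mem_ofPred_eq] at he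
      obtain ⟨he, hve, F, hF, G, hG, heF, heG, hFY, hGY⟩ := he
      obtain ⟨i, hiv, rfl⟩ : ∃ i, i ≠ v ∧ {v, i} = e := by
        obtain ⟨p, q, hpq, rfl⟩ := Finset.card_eq_two.1 (mem_edges.1 he).2
        rcases Finset.mem_insert.1 hve with rfl | h
        · exact ⟨q, hpq.symm, rfl⟩
        · rw [Finset.mem_singleton] at h
          subst h
          exact ⟨p, hpq, Finset.pair_comm _ _⟩
      have hFG : F ≠ G := by rintro rfl; exact hFY.not_gt hGY
      have hmeet : ∀ k, k ∈ F → k ∈ G → k ∈ ({v, i} : Finset ι) := by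
        obtain ⟨F', hF', G', hG', hFG', -, -, hmeet, huniq, -⟩ := hx.edge_facets he
        rcases huniq F hF heF with rfl | rfl <;> rcases huniq G hG heG with rfl | rfl
        exacts [(hFG rfl).elim, hmeet, fun k h1 h2 => hmeet k h2 h1, (hFG rfl).elim]
      have hFf := (mem_facets.1 hF).1
      have hGf := (mem_facets.1 hG).1
      -- Both weights are positive, and they make the combination vanish at `Y`; its common zeros on
      -- `F` and `G` are those of the edge.
      refine ⟨i, ⟨Finset.mem_univ i, by simpa using hiv,
        normal x G Y • normal x F - normal x F Y • normal x G, ?_, ?_, ?_⟩, rfl⟩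
      · simp; ring
      · intro j hj
        rw [Finset.mem_singleton] at hj
        simp [hj, hFf.normal_eq_zero.2 (heF hve), hGf.normal_eq_zero.2 (heG hve)]
      · intro j _ hj
        have h1 := mul_nonneg hGY.le (hFf.normal_nonneg j)
        have h2 := mul_nonneg (neg_nonneg.2 hFY.le) (hGf.normal_nonneg j)
        simp only [LinearMap.sub_apply, LinearMap.smul_apply, smul_eq_mul]
        refine ⟨by linarith, fun h0 => ?_, ?_⟩
        · have h3 := (mul_eq_zero.1 (by linarith : normal x G Y * normal x F (x j) = 0)).resolve_left hGY.ne'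
          have h4 := (mul_eq_zero.1 (by linarith : normal x F Y * normal x G (x j) = 0)).resolve_left hFY.ne
          have := hmeet j (hFf.normal_eq_zero.1 h3) (hGf.normal_eq_zero.1 h4)
          simp only [Finset.mem_insert, Finset.mem_singleton] at this hj
          exact this.resolve_left hj
        · rintro rfl
          rw [hFf.normal_eq_zero.2 (heF (by simp)), hGf.normal_eq_zero.2 (heG (by simp))]
          ring
  · obtain ⟨F, hF, hvF⟩ := hx.exists_facet v
    exact ⟨normal x F, by simpa using (mem_facets.1 hF).1.normal_eq_zero.2 hvF, hgen F hF hvF⟩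
  · intro l hl hlv i _ j _ hi hj hij hli hlj hlY k _
    by_contra hk
    have hl0 : l (x v) = 0 := hlv v (by simp)
    simp only [Finset.mem_singleton] at hi hj
    -- A nonzero nonnegative functional with the zeros `v`, `i`, `j` is a multiple of a facet
    -- normal, and no normal of a facet at `v` vanishes at `Y`.
    have hZ := hx.zeroSet_eq (l := l) (fun i => hl i (Finset.mem_univ i)) (T := {v, i})
      (by simp [hl0, hli]) (Finset.card_pair (Ne.symm hi)).ge (i := j) (j := k)
      (by simp [hj, Ne.symm hij]) hlj hk
    obtain ⟨c, hc⟩ := hx.eq_smul_normal hZ (l := l) fun i hi => by simpa using hi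
    have hvZ : v ∈ Finset.univ.filter fun k => l (x k) = 0 := by simp [hl0]
    rw [hc, LinearMap.smul_apply, smul_eq_mul] at hlY
    have hc0 := (mul_eq_zero.1 hlY).resolve_right (hgen _ hZ hvZ)
    exact hk (by rw [hc, hc0]; simp)

end IsVertexFamily

/-! ### Angles as measures of separating directions -/

section Crofton

open Real MeasureTheory Set

theorem cos_lt_neg_cos_iff {δ u : ℝ} (h0 : 0 ≤ δ) (hπ : δ ≤ π) (hu : u ∈ Icc 0 (2 * π)) :
    cos u < -cos δ ↔ u ∈ Ioo (π - δ) (π + δ) := by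
  rw [← cos_pi_sub]
  have h1 : π - δ ∈ Icc 0 π := ⟨by linarith, by linarith⟩
  rcases le_total u π with h | h
  · rw [strictAntiOn_cos.lt_iff_gt ⟨hu.1, h⟩ h1, mem_Ioo]
    refine ⟨fun h' => ⟨h', ?_⟩, fun h' => h'.1⟩
    rcases h0.lt_or_eq with h2 | h2
    · linarith
    · rw [← h2] at h'; linarith
  · have : cos u = cos (2 * π - u) := by rw [cos_two_pi_sub]
    rw [this, strictAntiOn_cos.lt_iff_gt ⟨by linarith [hu.2], by linarith⟩ h1, mem_Ioo]
    refine ⟨fun h' => ⟨?_, by linarith⟩, fun h' => by linarith [h'.2]⟩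
    rcases h0.lt_or_eq with h2 | h2
    · linarith
    · rw [← h2] at h'; linarith

theorem intervalIntegrable_indicator {s : Set ℝ} (hs : MeasurableSet s) (a b : ℝ) :
    IntervalIntegrable (s.indicator fun _ => (1 : ℝ)) volume a b := by
  rw [intervalIntegrable_iff]
  exact (integrableOn_const (by simp [uIoc]) (by simp)).indicator hs

theorem integral_indicator_cos {δ : ℝ} (h0 : 0 ≤ δ) (hπ : δ ≤ π) :
    ∫ u in (0)..(2 * π), {u | cos u < -cos δ}.indicator (fun _ => (1 : ℝ)) u = 2 * δ := by
  have hpi := pi_pos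
  have h1 : ∫ u in (0)..(2 * π), {u | cos u < -cos δ}.indicator (fun _ => (1 : ℝ)) u =
      ∫ u in (0)..(2 * π), (Ioo (π - δ) (π + δ)).indicator (fun _ => (1 : ℝ)) u := by
    refine intervalIntegral.integral_congr fun u hu => ?_
    rw [uIcc_of_le (by linarith)] at hu
    simp only [indicator_apply, mem_ofPred_eq, cos_lt_neg_cos_iff h0 hπ hu]
  rw [h1, intervalIntegral.integral_of_le (by linarith), ← integral_Icc_eq_integral_Ioc,
    setIntegral_indicator measurableSet_Ioo, inter_eq_right.2, setIntegral_const]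
  · simp
    rw [max_eq_left] <;> linarith
  · intro u hu
    exact ⟨by linarith [hu.1], by linarith [hu.2]⟩

theorem exists_cos_sin {p q : ℝ} (h : p ^ 2 + q ^ 2 = 1) : ∃ α, p = cos α ∧ q = sin α := by
  have hn : ‖(⟨p, q⟩ : ℂ)‖ = 1 := by
    rw [Complex.norm_def, Complex.normSq_mk, ← sq, ← sq, h, Real.sqrt_one]
  refine ⟨Complex.arg ⟨p, q⟩, ?_, ?_⟩
  · rw [Complex.cos_arg (by rintro h0; rw [h0] at hn; simp at hn), hn]; simp
  · rw [Complex.sin_arg, hn]; simp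

/-- The angle between two unit vectors of the plane is proportional to the measure of the set of
directions that separate them. -/
theorem integral_separating {p q p' q' : ℝ} (h : p ^ 2 + q ^ 2 = 1) (h' : p' ^ 2 + q' ^ 2 = 1) :
    ∫ t in (0)..(2 * π), {t | (p * cos t + q * sin t) * (p' * cos t + q' * sin t) < 0}.indicator
      (fun _ => (1 : ℝ)) t = 2 * arccos (p * p' + q * q') := by
  obtain ⟨α, rfl, rfl⟩ := exists_cos_sin h
  obtain ⟨β, rfl, rfl⟩ := exists_cos_sin h'
  set c := cos α * cos β + sin α * sin β with hc
  have hcc : c = cos (α - β) := by rw [hc, cos_sub]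
  have hcos : cos (arccos c) = c := cos_arccos (hcc ▸ neg_one_le_cos _) (hcc ▸ cos_le_one _)
  set g : ℝ → ℝ := {u | cos u < -cos (arccos c)}.indicator fun _ => (1 : ℝ) with hg
  have hper : Function.Periodic g (2 * π) := fun u => by
    simp [hg, indicator_apply]
  -- By `2 cos (t - α) cos (t - β) = cos (2t - α - β) + cos (α - β)`, separation is a condition on
  -- `2t - (α + β)` alone. As `t` runs over `[0, 2π]` this argument runs over two periods, and the
  -- substitution contributes a factor `1/2`.
  have h1 : (fun t => {t | (cos α * cos t + sin α * sin t) * (cos β * cos t + sin β * sin t) < 0}.indicator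
      (fun _ => (1 : ℝ)) t) = fun t => g (2 * t - (α + β)) := by
    ext t
    have : (cos α * cos t + sin α * sin t) * (cos β * cos t + sin β * sin t) < 0 ↔
        cos (2 * t - (α + β)) < -cos (arccos c) := by
      have e1 : 2 * t - (α + β) = (t - α) + (t - β) := by ring
      have e2 : c = cos ((t - α) - (t - β)) := by
        rw [hcc, ← cos_neg]; congr 1; ring
      have e3 : cos α * cos t + sin α * sin t = cos (t - α) := by rw [cos_sub]; ring
      have e4 : cos β * cos t + sin β * sin t = cos (t - β) := by rw [cos_sub]; ring
      rw [hcos, e2, e1, e3, e4, cos_add, cos_sub (t - α) (t - β)]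
      constructor <;> intro h <;> linarith
    simp only [hg, indicator_apply, mem_ofPred_eq, this]
  rw [h1, intervalIntegral.integral_comp_mul_sub g (by norm_num)]
  have hint : ∀ a b, IntervalIntegrable g volume a b := fun a b =>
    intervalIntegrable_indicator (measurableSet_lt measurable_cos measurable_const) a b
  have h2 : 2 * (2 * π) - (α + β) = (2 * 0 - (α + β)) + (2 : ℤ) • (2 * π) := by
    simp; ring
  rw [h2, hper.intervalIntegral_add_zsmul_eq _ _ hint, hper.intervalIntegral_add_eq _ 0, zero_add, hg,
    integral_indicator_cos (arccos_nonneg c) (arccos_le_pi c)]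
  simp

end Crofton

/-! ### Unit normals, dihedral angles and the angle sum at an ideal vertex -/

section Angles

/-- The spatial part of a vector of Minkowski space. -/
def spatialPart (N : Fin 4 → ℝ) : E3 := WithLp.toLp 2 fun i : Fin 3 => N i.succ

theorem mink_eq (X Y : Fin 4 → ℝ) :
    mink X Y = inner ℝ (spatialPart X) (spatialPart Y) - X 0 * Y 0 := by
  simp only [mink, spatialPart, PiLp.inner_apply, Fin.sum_univ_three]
  simp [mul_comm]
  ring

@[simp] theorem spatialPart_homog (y : E3) : spatialPart (homog y) = y := by
  ext i; simp [spatialPart]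

@[simp] theorem spatialPart_spatial (y : E3) : spatialPart (spatial y) = y := by
  ext i; simp [spatialPart]

theorem minkDual_injective : Function.Injective minkDual := fun N N' h => by
  have h1 : ∀ Y, mink N Y = mink N' Y := fun Y => congrArg (fun l : Dual ℝ (Fin 4 → ℝ) => l Y) h
  ext i
  refine Fin.cases ?_ (fun j => ?_) i
  · simpa [mink, Pi.single_apply, Fin.succ_ne_zero] using h1 (Pi.single 0 1)
  · simpa [mink, Pi.single_apply, (Fin.succ_ne_zero _).symm] using h1 (Pi.single j.succ 1)

theorem minkDual_smul (c : ℝ) (N : Fin 4 → ℝ) : minkDual (c • N) = c • minkDual N := by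
  ext Y
  simp only [mink, minkDual, Fin.sum_univ_three, Pi.smul_apply, smul_eq_mul, LinearMap.smul_apply,
    LinearMap.comp_apply, LinearMap.coe_mk, AddHom.coe_mk]
  ring

theorem mink_smul_smul (c d : ℝ) (X Y : Fin 4 → ℝ) : mink (c • X) (d • Y) = c * d * mink X Y := by
  simp only [mink, Fin.sum_univ_three, Pi.smul_apply, smul_eq_mul]
  ring

/-- A vector orthogonal to two distinct ideal points is spacelike. -/
theorem mink_self_pos {N : Fin 4 → ℝ} (hN : N ≠ 0) {y z : E3} (hy : ‖y‖ = 1) (hz : ‖z‖ = 1)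
    (hyz : y ≠ z) (h1 : mink N (homog y) = 0) (h2 : mink N (homog z) = 0) : 0 < mink N N := by
  -- Subtracting `N 0` times the null vector `homog y`, orthogonal to `N`, keeps the Minkowski
  -- square and leaves a purely spatial vector. If it were zero for both `y` and `z`, then `N` would
  -- be a multiple of both null vectors, hence zero.
  have key : ∀ y : E3, ‖y‖ = 1 → mink N (homog y) = 0 →
      mink N N = ‖spatialPart N - N 0 • y‖ ^ 2 := by
    intro y hy h
    rw [mink_eq] at h ⊢
    simp only [spatialPart_homog, homog_zero, mul_one] at h
    rw [norm_sub_sq_real, norm_smul, hy, inner_smul_right, real_inner_self_eq_norm_sq,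
      mul_one, Real.norm_eq_abs, sq_abs]
    linear_combination (2 * N 0) * h
  have hy' := key y hy h1
  have hz' := key z hz h2
  refine lt_of_le_of_ne (hy' ▸ sq_nonneg _) fun h0 => ?_
  rw [← h0] at hy' hz'
  have e1 : spatialPart N = N 0 • y := by
    rw [← sub_eq_zero, ← norm_eq_zero]; exact pow_eq_zero_iff (two_ne_zero) |>.1 hy'.symm
  have e2 : spatialPart N = N 0 • z := by
    rw [← sub_eq_zero, ← norm_eq_zero]; exact pow_eq_zero_iff (two_ne_zero) |>.1 hz'.symm
  have h00 : N 0 = 0 := by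
    by_contra hne
    exact hyz (smul_right_injective E3 hne (e1.symm.trans e2))
  apply hN
  ext i
  refine Fin.cases h00 (fun j => ?_) i
  have := congrArg (fun w : E3 => w j) e1
  simpa [spatialPart, h00] using this

variable {S : Finset E3}

theorem hull_facet_eq {T : Finset S} {N : Fin 4 → ℝ} {c : ℝ} (hT : IsFace (vert S) T) (hc : 0 < c)
    (hN : minkDual N = -(c • normal (vert S) T)) :
    (∀ y ∈ convexHull ℝ (S : Set E3), mink N (homog y) ≤ 0) ∧
      hull T = {y ∈ convexHull ℝ (S : Set E3) | mink N (homog y) = 0} := by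
  have hN' : ∀ Y, mink N Y = -(c * normal (vert S) T Y) := fun Y =>
    congrArg (fun l : Dual ℝ (Fin 4 → ℝ) => l Y) hN
  rw [← hull_univ]
  constructor
  · intro y hy
    have := eval_nonneg_of_mem_hull (fun s _ => hT.normal_nonneg s) hy
    rw [hN']
    have := mul_nonneg hc.le this
    linarith
  · rw [← hull_inter_zero (Finset.subset_univ T)
      fun s _ => ⟨hT.normal_nonneg s, hT.normal_eq_zero⟩]
    simp [hN', hc.ne']

/-- The vector representing the facet functional is orthogonal to two ideal points, hence spacelike,
and can be normalized. -/
theorem exists_outward_normal (hS : ∀ s ∈ S, ‖s‖ = 1) (hx : IsVertexFamily (vert S))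
    {F : Finset S} (hF : F ∈ facets (vert S)) :
    ∃ N, IsOutwardUnitNormal (convexHull ℝ (S : Set E3)) (hull F) N := by
  obtain ⟨hFf, -⟩ := mem_facets.1 hF
  obtain ⟨N, hN⟩ := exists_minkDual (normal (vert S) F)
  obtain ⟨s, hs, t, ht, hst⟩ := Finset.one_lt_card.1
    (lt_of_lt_of_le (by norm_num) (hx.three_le_card hF))
  have hN0 : N ≠ 0 := by
    rintro rfl
    obtain ⟨i, hi⟩ := hx.exists_notMem hF
    have := hFf.normal_pos hi
    rw [hN] at this
    simp [mink] at this
  have ev : ∀ u ∈ F, mink N (homog u) = 0 := fun u hu => by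
    have := hFf.normal_eq_zero.2 hu
    rwa [hN] at this
  have hpos := mink_self_pos hN0 (hS s s.2) (hS t t.2) (fun h => hst (Subtype.ext h))
    (ev s hs) (ev t ht)
  set r := Real.sqrt (mink N N) with hr
  have hr0 : 0 < r := Real.sqrt_pos.2 hpos
  have hd : minkDual ((-r⁻¹) • N) = -(r⁻¹ • normal (vert S) F) := by
    rw [minkDual_smul, hN]
    exact LinearMap.ext fun Y => by simp
  obtain ⟨h1, h2⟩ := hull_facet_eq hFf (inv_pos.2 hr0) hd
  refine ⟨(-r⁻¹) • N, ?_, h1, h2⟩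
  rw [mink_smul_smul]
  have : r * r = mink N N := Real.mul_self_sqrt hpos.le
  rw [← this]
  field_simp

/-- Functionals vanishing on the facet form a line. The sign is decided at a vertex off the facet,
and the unit condition excludes zero. -/
theorem outward_normal_eq (hx : IsVertexFamily (vert S)) {F : Finset S} (hF : F ∈ facets (vert S))
    {N : Fin 4 → ℝ} (hN : IsOutwardUnitNormal (convexHull ℝ (S : Set E3)) (hull F) N) :
    ∃ c : ℝ, 0 < c ∧ minkDual N = -(c • normal (vert S) F) := by
  have hon : ∀ s ∈ F, minkDual N (vert S s) = 0 := fun s hs => by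
    have h := mem_hull hs
    rw [hN.face] at h
    exact h.2
  obtain ⟨c, hc⟩ := hx.eq_smul_normal hF hon
  obtain ⟨i, hi⟩ := hx.exists_notMem hF
  have h1 : mink N (homog i) ≤ 0 :=
    hN.nonpos _ (hull_univ S ▸ mem_hull (Finset.mem_univ i))
  have h2 := (mem_facets.1 hF).1.normal_pos hi
  have h3 : minkDual N (vert S i) = c * normal (vert S) F (vert S i) := by rw [hc]; rfl
  rw [minkDual_apply, vert] at h3
  have hc0 : c ≠ 0 := by
    rintro rfl
    have : N = 0 := minkDual_injective (LinearMap.ext fun Y => by rw [hc]; simp [mink])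
    have := hN.unit
    simp_all [mink]
  refine ⟨-c, neg_pos.2 (lt_of_le_of_ne ?_ hc0), hc.trans (LinearMap.ext fun Y => by simp)⟩
  by_contra! hpos
  have := mul_pos hpos h2
  rw [vert] at this
  linarith

theorem outward_normal_unique (hx : IsVertexFamily (vert S)) {F : Finset S}
    (hF : F ∈ facets (vert S)) {N N' : Fin 4 → ℝ}
    (hN : IsOutwardUnitNormal (convexHull ℝ (S : Set E3)) (hull F) N)
    (hN' : IsOutwardUnitNormal (convexHull ℝ (S : Set E3)) (hull F) N') : N = N' := by
  obtain ⟨c, hc, e⟩ := outward_normal_eq hx hF hN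
  obtain ⟨c', hc', e'⟩ := outward_normal_eq hx hF hN'
  have h1 : N' = (c' / c) • N := by
    apply minkDual_injective
    rw [minkDual_smul, e, e', smul_neg, smul_smul, div_mul_cancel₀ _ hc.ne']
  have h2 := hN'.unit
  rw [h1, mink_smul_smul, hN.unit, mul_one, ← sq] at h2
  rw [h1, (pow_eq_one_iff_of_nonneg (div_pos hc' hc).le two_ne_zero).1 h2, one_smul]

theorem mem_faces_two (hx : IsVertexFamily (vert S)) {F : Set E3} :
    F ∈ faces (convexHull ℝ (S : Set E3)) 2 ↔ ∃ T ∈ facets (vert S), F = hull T := by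
  rw [mem_faces_iff]
  constructor
  · rintro ⟨T, -, hT, hr, rfl⟩
    exact ⟨T, mem_facets.2 ⟨hT, hr⟩, rfl⟩
  · rintro ⟨T, hT, rfl⟩
    have := hx.three_le_card hT
    exact ⟨T, Finset.card_pos.1 (by omega), (mem_facets.1 hT).1, (mem_facets.1 hT).2, rfl⟩

theorem mem_faces_one (hx : IsVertexFamily (vert S)) {F : Set E3} :
    F ∈ faces (convexHull ℝ (S : Set E3)) 1 ↔ ∃ T ∈ edges (vert S), F = hull T := by
  rw [mem_faces_iff]
  constructor
  · rintro ⟨T, -, hT, hr, rfl⟩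
    refine ⟨T, mem_edges.2 ⟨hT, ?_⟩, rfl⟩
    have : T.card ≤ 3 := by
      by_contra! h
      have := hx.three_le_rank (T := T) (by omega)
      omega
    rw [← hx.rank_eq_card this, hr]
  · rintro ⟨T, hT, rfl⟩
    obtain ⟨hf, hc⟩ := mem_edges.1 hT
    exact ⟨T, Finset.card_pos.1 (by omega), hf, by rw [hx.rank_eq_card (by omega), hc], rfl⟩

theorem mem_faces_zero (hx : IsVertexFamily (vert S)) {F : Set E3} :
    F ∈ faces (convexHull ℝ (S : Set E3)) 0 ↔ ∃ s : S, F = hull {s} := by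
  rw [mem_faces_iff]
  constructor
  · rintro ⟨T, -, hT, hr, rfl⟩
    have : T.card ≤ 3 := by
      by_contra! h
      have := hx.three_le_rank (T := T) (by omega)
      omega
    rw [hx.rank_eq_card this] at hr
    obtain ⟨s, rfl⟩ := Finset.card_eq_one.1 (by simpa using hr)
    exact ⟨s, rfl⟩
  · rintro ⟨s, rfl⟩
    exact ⟨{s}, Finset.singleton_nonempty s, hx.vertex s, hx.rank_singleton s, rfl⟩

theorem mem_faces_three (hx : IsVertexFamily (vert S)) {F : Set E3} :
    F ∈ faces (convexHull ℝ (S : Set E3)) 3 ↔ F = convexHull ℝ (S : Set E3) := by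
  rw [mem_faces_iff, ← hull_univ]
  constructor
  · rintro ⟨T, -, hT, hr, rfl⟩
    congr 1
    by_contra hne
    obtain ⟨i, hi⟩ : ∃ i, i ∉ T := by
      by_contra! h
      exact hne (Finset.eq_univ_of_forall h)
    have h1 : spanOf (vert S) T = ⊤ :=
      Submodule.eq_top_of_finrank_eq (by rw [hr, hx.finrank_eq])
    exact (hT.normal_pos hi).ne' (hT.normal_spanOf (h1 ▸ Submodule.mem_top))
  · rintro rfl
    refine ⟨Finset.univ, ?_, isFace_univ _, hx.rank_univ, rfl⟩
    have := hx.four_le_card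
    exact Finset.card_pos.1 (by rw [Finset.card_univ]; omega)

/-- The dihedral angle at an edge, from the unit normals of the two facets at the edge. -/
theorem dihedralAngle_eq (hx : IsVertexFamily (vert S)) {e F G : Finset S}
    (he : e ∈ edges (vert S)) (hF : F ∈ facets (vert S)) (hG : G ∈ facets (vert S)) (hFG : F ≠ G)
    (heF : e ⊆ F) (heG : e ⊆ G) {N N' : Fin 4 → ℝ}
    (hN : IsOutwardUnitNormal (convexHull ℝ (S : Set E3)) (hull F) N)
    (hN' : IsOutwardUnitNormal (convexHull ℝ (S : Set E3)) (hull G) N') :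
    dihedralAngle (convexHull ℝ (S : Set E3)) (hull e) = Real.pi - Real.arccos (mink N N') := by
  have hFf := (mem_facets.1 hF).1
  have hGf := (mem_facets.1 hG).1
  have hex : IsDihedralAngle (convexHull ℝ (S : Set E3)) (hull e)
      (Real.pi - Real.arccos (mink N N')) :=
    ⟨hull F, (mem_faces_two hx).2 ⟨F, hF, rfl⟩, hull G, (mem_faces_two hx).2 ⟨G, hG, rfl⟩,
      fun h => hFG (hFf.hull_inj hGf h), hull_mono heF, hull_mono heG, N, N', hN, hN', rfl⟩
  -- Whatever witness is chosen, its two faces are the two facets at the edge in some order, and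
  -- their unit normals are unique.
  obtain ⟨A, hA, B, hB, hAB, heA, heB, M, M', hM, hM', hθ⟩ :=
    Classical.epsilon_spec (p := IsDihedralAngle (convexHull ℝ (S : Set E3)) (hull e)) ⟨_, hex⟩
  obtain ⟨A, hAf, rfl⟩ := (mem_faces_two hx).1 hA
  obtain ⟨B, hBf, rfl⟩ := (mem_faces_two hx).1 hB
  clear hA hB
  have hAB' : A ≠ B := fun h => hAB (h ▸ rfl)
  replace heA := (mem_facets.1 hAf).1.hull_subset_iff.1 heA
  replace heB := (mem_facets.1 hBf).1.hull_subset_iff.1 heB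
  rw [dihedralAngle, hθ]
  obtain ⟨F', -, G', -, -, -, -, -, huniq, -⟩ := hx.edge_facets he
  have h2 : (A = F ∧ B = G) ∨ (A = G ∧ B = F) := by
    rcases huniq A hAf heA with rfl | rfl <;> rcases huniq B hBf heB with rfl | rfl <;>
      rcases huniq F hF heF with rfl | rfl <;> rcases huniq G hG heG with rfl | rfl <;>
      simp_all
  rcases h2 with ⟨rfl, rfl⟩ | ⟨rfl, rfl⟩
  · rw [outward_normal_unique hx hAf hM hN, outward_normal_unique hx hBf hM' hN']
  · rw [outward_normal_unique hx hAf hM hN', outward_normal_unique hx hBf hM' hN, mink_comm]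

theorem exists_orthonormal_frame {v : E3} (hv : ‖v‖ = 1) :
    ∃ b : OrthonormalBasis (Fin 3) ℝ E3, b 0 = v := by
  obtain ⟨b, hb⟩ := Orthonormal.exists_orthonormalBasis_extension_of_card_eq (𝕜 := ℝ) (E := E3)
    (ι := Fin 3) (by simp) (v := fun _ => v) (s := {0}) (by
      rw [orthonormal_iff_ite]
      rintro ⟨i, rfl⟩ ⟨j, rfl⟩
      simp [hv])
  exact ⟨b, hb 0 rfl⟩

open Classical Real MeasureTheory Set in
/-- The exterior dihedral angles at the edges issuing from an ideal vertex sum to `2π`. -/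
theorem sum_exterior_angles (hS : ∀ s ∈ S, ‖s‖ = 1) (hx : IsVertexFamily (vert S)) (v : S) :
    ∑ e ∈ (edges (vert S)).filter (fun e => v ∈ e),
      (π - dihedralAngle (convexHull ℝ (S : Set E3)) (hull e)) = 2 * π := by
  have hN := fun F hF => exists_outward_normal hS hx (F := F) hF
  choose! N hN using hN
  have hef : ∀ e ∈ edges (vert S), ∃ F G, F ∈ facets (vert S) ∧ G ∈ facets (vert S) ∧ F ≠ G ∧
      e ⊆ F ∧ e ⊆ G ∧ ∀ H ∈ facets (vert S), e ⊆ H → H = F ∨ H = G := fun e he => by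
    obtain ⟨F, hF, G, hG, hFG, heF, heG, -, hu, -⟩ := hx.edge_facets he
    exact ⟨F, G, hF, hG, hFG, heF, heG, hu⟩
  choose! f g hf hg hfg hef heg huniq using hef
  -- The quotient of the orthogonal complement of `homog v` by the line of `homog v` is a Euclidean
  -- plane, with coordinates `p`, `q` along `b 1`, `b 2`. Orthogonality to `homog v` makes the time
  -- component and the `b 0` component cancel in the Minkowski product.
  obtain ⟨b, hb⟩ := exists_orthonormal_frame (hS v v.2)
  set p : Finset S → ℝ := fun F => inner ℝ (spatialPart (N F)) (b 1) with hp
  set q : Finset S → ℝ := fun F => inner ℝ (spatialPart (N F)) (b 2) with hq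
  set d : ℝ → Fin 4 → ℝ := fun t => spatial (cos t • b 1 + sin t • b 2) with hd
  have hNd : ∀ F t, mink (N F) (d t) = p F * cos t + q F * sin t := fun F t => by
    simp only [hd, hp, hq, mink_eq, spatialPart_spatial, spatial_zero, mul_zero, sub_zero,
      inner_add_right, inner_smul_right]
    ring
  have hNv : ∀ F ∈ facets (vert S), v ∈ F → inner ℝ (spatialPart (N F)) (b 0) = N F 0 := by
    intro F hF hv
    have h := mem_hull hv
    rw [(hN F hF).face] at h
    have h2 := h.2
    rw [mink_eq] at h2
    simp only [spatialPart_homog, homog_zero, mul_one] at h2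
    rw [hb]
    linarith
  have hNN : ∀ F ∈ facets (vert S), v ∈ F → ∀ G ∈ facets (vert S), v ∈ G →
      mink (N F) (N G) = p F * p G + q F * q G := by
    intro F hF hvF G hG hvG
    have h := b.sum_inner_mul_inner (spatialPart (N F)) (spatialPart (N G))
    rw [Fin.sum_univ_three, real_inner_comm _ (b 0), real_inner_comm _ (b 1),
      real_inner_comm _ (b 2), hNv F hF hvF, hNv G hG hvG] at h
    rw [mink_eq, ← h]
    ring
  have hone : ∀ F ∈ facets (vert S), v ∈ F → p F ^ 2 + q F ^ 2 = 1 := by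
    intro F hF hvF
    rw [← (hN F hF).unit, hNN F hF hvF F hF hvF]
    ring
  set A : Finset S → Set ℝ := fun e =>
    {t | (p (f e) * cos t + q (f e) * sin t) * (p (g e) * cos t + q (g e) * sin t) < 0} with hA
  have hangle : ∀ e ∈ (edges (vert S)).filter (fun e => v ∈ e),
      π - dihedralAngle (convexHull ℝ (S : Set E3)) (hull e) =
        (∫ t in (0)..(2 * π), (A e).indicator (fun _ => (1 : ℝ)) t) / 2 := by
    intro e he
    obtain ⟨he, hve⟩ := Finset.mem_filter.1 he
    have hvf := hef e he hve
    have hvg := heg e he hve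
    rw [integral_separating (hone _ (hf e he) hvf) (hone _ (hg e he) hvg),
      dihedralAngle_eq hx he (hf e he) (hg e he) (hfg e he) (hef e he) (heg e he)
        (hN _ (hf e he)) (hN _ (hg e he)), hNN _ (hf e he) hvf _ (hg e he) hvg]
    ring
  have hmeas : ∀ e, MeasurableSet (A e) := fun e =>
    measurableSet_lt (by fun_prop) measurable_const
  -- The directions annihilated by the normal of some facet at `v` are the non-generic ones; they
  -- form a null set.
  have hbad : (⋃ F ∈ (facets (vert S)).filter (fun F => v ∈ F),
      {t : ℝ | p F * cos t + q F * sin t = 0}).Countable := by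
    refine Set.Countable.biUnion (Finset.countable_toSet _) fun F hF => ?_
    obtain ⟨hF, hvF⟩ := Finset.mem_filter.1 hF
    have h1 := hone F hF hvF
    obtain ⟨α, h2, h3⟩ := exists_cos_sin h1
    refine Set.Countable.mono ?_
      (Set.countable_range fun n : ℤ => (2 * (n : ℝ) + 1) * π / 2 + α)
    intro t ht
    rw [mem_ofPred_eq, h2, h3, mul_comm, mul_comm (sin α), ← cos_sub] at ht
    obtain ⟨n, hn⟩ := Real.cos_eq_zero_iff.1 ht
    exact ⟨n, by simp only [← hn]; ring⟩
  have hae : ∀ᵐ t : ℝ, ∑ e ∈ (edges (vert S)).filter (fun e => v ∈ e),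
      (A e).indicator (fun _ => (1 : ℝ)) t = 2 := by
    filter_upwards [hbad.ae_notMem volume] with t ht
    simp only [mem_iUnion, Finset.mem_filter, mem_ofPred_eq, exists_prop, not_exists, not_and,
      and_imp] at ht
    have hsign : ∀ F ∈ facets (vert S), ∃ c : ℝ, 0 < c ∧
        mink (N F) (d t) = -(c * normal (vert S) F (d t)) := fun F hF => by
      obtain ⟨c, hc, h⟩ := outward_normal_eq hx hF (hN F hF)
      exact ⟨c, hc, congrArg (fun l : Dual ℝ (Fin 4 → ℝ) => l (d t)) h⟩
    -- The functional `-minkDual (homog v)` is positive at the other vertices and vanishes at `v`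
    -- and at `d t`. Outward normals are negative multiples of the functionals `normal`, so products
    -- of two signs agree.
    have hcard := hx.card_separated_edges v (d t) (-minkDual (homog v)) ?_ ?_ ?_ ?_
    · have : ∀ e ∈ (edges (vert S)).filter (fun e => v ∈ e), (A e).indicator (fun _ => (1 : ℝ)) t =
          if ∃ F ∈ facets (vert S), ∃ G ∈ facets (vert S), e ⊆ F ∧ e ⊆ G ∧
            normal (vert S) F (d t) < 0 ∧ 0 < normal (vert S) G (d t) then 1 else 0 := by
        intro e he
        obtain ⟨he, hve⟩ := Finset.mem_filter.1 he
        rw [indicator_apply]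
        refine if_congr ?_ rfl rfl
        simp only [hA, mem_ofPred_eq, ← hNd]
        obtain ⟨c, hc, h1⟩ := hsign _ (hf e he)
        obtain ⟨c', hc', h2⟩ := hsign _ (hg e he)
        rw [h1, h2, neg_mul_neg, mul_mul_mul_comm,
          ← not_le, mul_nonneg_iff_of_pos_left (mul_pos hc hc'), not_le, mul_neg_iff]
        constructor
        · rintro (⟨h3, h4⟩ | ⟨h3, h4⟩)
          · exact ⟨_, hg e he, _, hf e he, heg e he, hef e he, h4, h3⟩
          · exact ⟨_, hf e he, _, hg e he, hef e he, heg e he, h3, h4⟩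
        · rintro ⟨F, hF, G, hG, heF, heG, h3, h4⟩
          rcases huniq e he F hF heF with rfl | rfl <;> rcases huniq e he G hG heG with rfl | rfl
          · exact absurd h3 h4.not_gt
          · exact Or.inr ⟨h3, h4⟩
          · exact Or.inl ⟨h4, h3⟩
          · exact absurd h3 h4.not_gt
      rw [Finset.sum_congr rfl this, Finset.sum_boole, Finset.filter_filter, ← Nat.cast_two (R := ℝ)]
      congr 1
      convert hcard
    · simp [vert, mink_homog_self (hS v v.2)]
    · intro i hi
      have := mink_homog_neg (hS v v.2) (hS i i.2) fun h => hi (Subtype.ext h.symm)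
      simpa [vert] using this
    · simp only [LinearMap.neg_apply, minkDual_apply, neg_eq_zero, hd, mink_eq,
        spatialPart_homog, spatialPart_spatial, spatial_zero, mul_zero, sub_zero, inner_add_right,
        inner_smul_right, ← hb]
      simp [b.orthonormal.inner_eq_zero (show (0 : Fin 3) ≠ 1 by decide),
        b.orthonormal.inner_eq_zero (show (0 : Fin 3) ≠ 2 by decide)]
    · intro F hF hvF h0
      obtain ⟨c, hc, h1⟩ := hsign F hF
      rw [h0, mul_zero, neg_zero, hNd] at h1
      exact ht F hF hvF h1
  rw [Finset.sum_congr rfl hangle, ← Finset.sum_div, ← intervalIntegral.integral_finsetSum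
    fun e _ => intervalIntegrable_indicator (hmeas e) _ _,
    intervalIntegral.integral_congr_ae (g := fun _ => (2 : ℝ)) (hae.mono fun t ht _ => ht)]
  simp

end Angles

/-! ### The projective action of oriented isometries -/

section Action

abbrev GL4 : Type := Matrix.GeneralLinearGroup (Fin 4) ℝ

/-- The linear action on Minkowski space. -/
def lin (g : GL4) : (Fin 4 → ℝ) →ₗ[ℝ] (Fin 4 → ℝ) := Matrix.mulVecLin (g : Matrix (Fin 4) (Fin 4) ℝ)

theorem lin_apply (g : GL4) (X : Fin 4 → ℝ) :
    lin g X = (g : Matrix (Fin 4) (Fin 4) ℝ).mulVec X := rfl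

theorem lin_mul (g h : GL4) (X : Fin 4 → ℝ) : lin (g * h) X = lin g (lin h X) := by
  simp [lin_apply, Matrix.mulVec_mulVec]

@[simp] theorem lin_one (X : Fin 4 → ℝ) : lin 1 X = X := by simp [lin_apply]

theorem lin_inv_lin (g : GL4) (X : Fin 4 → ℝ) : lin g⁻¹ (lin g X) = X := by
  rw [← lin_mul, inv_mul_cancel, lin_one]

theorem lin_injective (g : GL4) : Function.Injective (lin g) := fun X Y h => by
  rw [← lin_inv_lin g X, h, lin_inv_lin]

theorem act_eq (g : GL4) (y : E3) : act g y = dehomog (lin g (homog y)) := rfl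

theorem mink_self (X : Fin 4 → ℝ) : mink X X = ‖spatialPart X‖ ^ 2 - X 0 ^ 2 := by
  rw [mink_eq, real_inner_self_eq_norm_sq, sq (X 0)]

theorem dehomog_smul {c : ℝ} (hc : c ≠ 0) (X : Fin 4 → ℝ) : dehomog (c • X) = dehomog X := by
  ext i
  simp only [dehomog, Pi.smul_apply, smul_eq_mul]
  exact mul_div_mul_left _ _ hc

@[simp] theorem dehomog_homog (y : E3) : dehomog (homog y) = y := by
  ext i; simp [dehomog]

theorem homog_dehomog {X : Fin 4 → ℝ} (hX : X 0 ≠ 0) : homog (dehomog X) = (X 0)⁻¹ • X := by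
  ext i
  refine Fin.cases ?_ (fun j => ?_) i
  · simp [hX]
  · simp [dehomog, div_eq_inv_mul]

/-- Oriented isometries preserve the future cone. -/
theorem lin_time_pos {g : GL4} (hg : IsOrientedIsometry g) {X : Fin 4 → ℝ} (h0 : 0 < X 0)
    (hX : ‖spatialPart X‖ ≤ X 0) : 0 < lin g X 0 ∧ ‖spatialPart (lin g X)‖ ≤ lin g X 0 := by
  set A := lin g (homog 0) with hA
  set B := lin g X with hB
  have hA0 : 0 < A 0 := by
    have : A 0 = (g : Matrix (Fin 4) (Fin 4) ℝ) 0 0 := by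
      have h1 : homog 0 = Pi.single 0 1 := by
        ext i; refine Fin.cases ?_ (fun j => ?_) i <;> simp [Fin.succ_ne_zero]
      rw [hA, h1, lin_apply]
      simp
    rw [this]
    exact hg.time
  have hAA : mink A A = -1 := (hg.form _ _).trans (by rw [mink_homog]; simp)
  have hAB : mink A B = -X 0 := (hg.form _ _).trans (by rw [mink_eq]; simp)
  have hBB : mink B B = mink X X := hg.form _ _
  have h1 : ‖spatialPart A‖ ≤ A 0 := by
    rw [mink_self] at hAA
    exact abs_le_of_sq_le_sq' (by linarith) hA0.le |>.2
  have h2 : ‖spatialPart B‖ ^ 2 ≤ B 0 ^ 2 := by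
    rw [mink_self, mink_self] at hBB
    have := pow_le_pow_left₀ (norm_nonneg _) hX 2
    linarith
  have hB0 : 0 < B 0 := by
    -- `A`, the image of the time axis, is future-directed. If `B` had nonpositive time coordinate,
    -- the Cauchy–Schwarz inequality would make the product of `A` and `B` nonnegative, yet it
    -- equals `-X 0`.
    by_contra! h
    have h3 : ‖spatialPart B‖ ≤ -B 0 :=
      abs_le_of_sq_le_sq' (by rwa [neg_sq]) (neg_nonneg.2 h) |>.2
    have h4 := neg_le_of_abs_le (abs_real_inner_le_norm (spatialPart A) (spatialPart B))
    have h5 := mul_le_mul h1 h3 (norm_nonneg _) hA0.le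
    rw [mink_eq] at hAB
    linarith
  exact ⟨hB0, abs_le_of_sq_le_sq' h2 hB0.le |>.2⟩

variable {g h : GL4}

theorem lin_homog_pos (hg : IsOrientedIsometry g) {y : E3} (hy : ‖y‖ ≤ 1) :
    0 < lin g (homog y) 0 :=
  (lin_time_pos hg (by simp) (by simpa using hy)).1

theorem homog_act (hg : IsOrientedIsometry g) {y : E3} (hy : ‖y‖ ≤ 1) :
    homog (act g y) = (lin g (homog y) 0)⁻¹ • lin g (homog y) :=
  homog_dehomog (lin_homog_pos hg hy).ne'

theorem lin_homog (hg : IsOrientedIsometry g) {y : E3} (hy : ‖y‖ ≤ 1) :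
    lin g (homog y) = lin g (homog y) 0 • homog (act g y) := by
  rw [homog_act hg hy, smul_smul, mul_inv_cancel₀ (lin_homog_pos hg hy).ne', one_smul]

theorem norm_sq_act (hg : IsOrientedIsometry g) {y : E3} (hy : ‖y‖ ≤ 1) :
    ∃ c : ℝ, 0 < c ∧ ‖act g y‖ ^ 2 - 1 = c * (‖y‖ ^ 2 - 1) := by
  have h0 := lin_homog_pos hg hy
  refine ⟨(lin g (homog y) 0)⁻¹ * (lin g (homog y) 0)⁻¹, mul_pos (inv_pos.2 h0) (inv_pos.2 h0), ?_⟩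
  have h1 := mink_homog (act g y) (act g y)
  rw [homog_act hg hy, mink_smul_smul, lin_apply, hg.form, mink_homog,
    real_inner_self_eq_norm_sq, real_inner_self_eq_norm_sq] at h1
  exact h1.symm

theorem norm_act_le (hg : IsOrientedIsometry g) {y : E3} (hy : ‖y‖ ≤ 1) : ‖act g y‖ ≤ 1 := by
  obtain ⟨c, hc, h⟩ := norm_sq_act hg hy
  have h1 : ‖y‖ ^ 2 ≤ 1 := pow_le_one₀ (norm_nonneg _) hy
  have := mul_nonneg hc.le (sub_nonneg.2 h1)
  exact abs_le_of_sq_le_sq' (by linarith : ‖act g y‖ ^ 2 ≤ 1 ^ 2) zero_le_one |>.2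

theorem norm_act_eq_one (hg : IsOrientedIsometry g) {y : E3} (hy : ‖y‖ = 1) : ‖act g y‖ = 1 := by
  obtain ⟨c, hc, h⟩ := norm_sq_act hg hy.le
  rw [hy] at h
  exact (pow_eq_one_iff_of_nonneg (norm_nonneg _) two_ne_zero).1 (by linarith)

@[simp] theorem act_one (y : E3) : act 1 y = y := by simp [act_eq]

theorem act_mul (g : GL4) (hh : IsOrientedIsometry h) {y : E3} (hy : ‖y‖ ≤ 1) :
    act (g * h) y = act g (act h y) := by
  rw [act_eq, act_eq g, homog_act hh hy, map_smul,
    dehomog_smul (inv_ne_zero (lin_homog_pos hh hy).ne'), lin_mul]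

theorem act_inv_act (hg : IsOrientedIsometry g) {y : E3} (hy : ‖y‖ ≤ 1) :
    act g⁻¹ (act g y) = y := by
  rw [← act_mul _ hg hy, inv_mul_cancel, act_one]

/-- A projective map preserves segments, with weights multiplied by the positive time coordinates of
the images and then renormalized. -/
theorem act_openSegment (hg : IsOrientedIsometry g) {y z u : E3} (hy : ‖y‖ ≤ 1) (hz : ‖z‖ ≤ 1)
    (hu : u ∈ openSegment ℝ y z) : act g u ∈ openSegment ℝ (act g y) (act g z) := by
  obtain ⟨a, b, ha, hb, hab, rfl⟩ := hu
  have hy0 := lin_homog_pos hg hy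
  have hz0 := lin_homog_pos hg hz
  have h1 : lin g (homog (a • y + b • z)) =
      (a * lin g (homog y) 0) • homog (act g y) + (b * lin g (homog z) 0) • homog (act g z) := by
    rw [homog_combo hab, map_add, map_smul, map_smul, mul_smul, mul_smul, ← lin_homog hg hy,
      ← lin_homog hg hz]
  set p := a * lin g (homog y) 0
  set q := b * lin g (homog z) 0
  have hp : 0 < p := mul_pos ha hy0
  have hq : 0 < q := mul_pos hb hz0
  have h2 : p / (p + q) + q / (p + q) = 1 := by field_simp
  refine ⟨p / (p + q), q / (p + q), by positivity, by positivity, h2, ?_⟩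
  have h3 : lin g (homog (a • y + b • z)) =
      (p + q) • homog ((p / (p + q)) • act g y + (q / (p + q)) • act g z) := by
    rw [h1, homog_combo h2, smul_add, smul_smul, smul_smul, mul_div_cancel₀ _ (by positivity),
      mul_div_cancel₀ _ (by positivity)]
  rw [act_eq g (a • y + b • z), h3, dehomog_smul (by positivity), dehomog_homog]

theorem convex_act_image (hg : IsOrientedIsometry g) (hg' : IsOrientedIsometry g⁻¹) {A : Set E3}
    (hA : Convex ℝ A) (hb : ∀ y ∈ A, ‖y‖ ≤ 1) : Convex ℝ (act g '' A) := by
  rw [convex_iff_openSegment_subset]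
  rintro _ ⟨y, hy, rfl⟩ _ ⟨z, hz, rfl⟩ u hu
  have h1 := act_openSegment hg' (norm_act_le hg (hb y hy)) (norm_act_le hg (hb z hz)) hu
  rw [act_inv_act hg (hb y hy), act_inv_act hg (hb z hz)] at h1
  refine ⟨act g⁻¹ u, hA.openSegment_subset hy hz h1, ?_⟩
  have hu1 : ‖u‖ ≤ 1 := by
    have := (convex_closedBall (0 : E3) 1).openSegment_subset
      (by simpa using norm_act_le hg (hb y hy)) (by simpa using norm_act_le hg (hb z hz)) hu
    simpa using this
  have := act_inv_act hg' hu1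
  rwa [inv_inv] at this

theorem finrank_vectorSpan_act (hg : IsOrientedIsometry g) {A : Set E3} (hb : ∀ y ∈ A, ‖y‖ ≤ 1) :
    finrank ℝ (vectorSpan ℝ (act g '' A)) = finrank ℝ (vectorSpan ℝ A) := by
  rcases A.eq_empty_or_nonempty with rfl | hne
  · rw [Set.image_empty]
  have h1 := finrank_span_homog hne
  have h2 := finrank_span_homog (hne.image (act g))
  have h3 : Submodule.span ℝ (homog '' (act g '' A)) =
      (Submodule.span ℝ (homog '' A)).map (lin g) := by
    rw [Submodule.map_span]
    apply le_antisymm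
    · rw [Submodule.span_le]
      rintro _ ⟨_, ⟨y, hy, rfl⟩, rfl⟩
      rw [homog_act hg (hb y hy)]
      exact Submodule.smul_mem _ _ (Submodule.subset_span ⟨_, ⟨y, hy, rfl⟩, rfl⟩)
    · rw [Submodule.span_le]
      rintro _ ⟨_, ⟨y, hy, rfl⟩, rfl⟩
      rw [lin_homog hg (hb y hy)]
      exact Submodule.smul_mem _ _ (Submodule.subset_span ⟨_, ⟨y, hy, rfl⟩, rfl⟩)
  rw [h3, ← (Submodule.equivMapOfInjective (lin g) (lin_injective g) _).finrank_eq] at h2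
  omega

end Action

/-! ### Relative interiors through segments -/

section RelativeInterior

variable {A : Set E3} {y z : E3}

theorem mem_intrinsicInterior_iff_dist : y ∈ intrinsicInterior ℝ A ↔
    y ∈ affineSpan ℝ A ∧ ∃ ε > 0, ∀ u ∈ affineSpan ℝ A, dist u y < ε → u ∈ A := by
  rw [mem_intrinsicInterior]
  constructor
  · rintro ⟨p, hp, rfl⟩
    obtain ⟨ε, hε, h⟩ := Metric.mem_nhds_iff.1 (mem_interior_iff_mem_nhds.1 hp)
    exact ⟨p.2, ε, hε, fun u hu hd => h (show (⟨u, hu⟩ : affineSpan ℝ A) ∈ Metric.ball p ε from hd)⟩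
  · rintro ⟨hy, ε, hε, h⟩
    refine ⟨⟨y, hy⟩, mem_interior_iff_mem_nhds.2 (Metric.mem_nhds_iff.2 ⟨ε, hε, ?_⟩), rfl⟩
    intro u hu
    exact h u u.2 hu

theorem exists_add_smul_mem {w : E3} (hy : y ∈ intrinsicInterior ℝ A) (hw : w ∈ vectorSpan ℝ A) :
    ∃ ε : ℝ, 0 < ε ∧ ∀ t : ℝ, 0 ≤ t → t < ε → y + t • w ∈ A := by
  obtain ⟨hyA, ε, hε, h⟩ := mem_intrinsicInterior_iff_dist.1 hy
  refine ⟨ε / (‖w‖ + 1), by positivity, fun t ht0 ht => h _ ?_ ?_⟩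
  · rw [add_comm]
    exact AffineSubspace.vadd_mem_of_mem_direction
      (Submodule.smul_mem _ _ (by rwa [direction_affineSpan])) hyA
  · rw [dist_eq_norm, add_sub_cancel_left, norm_smul, Real.norm_eq_abs, abs_of_nonneg ht0]
    rw [lt_div_iff₀ (by positivity)] at ht
    nlinarith [norm_nonneg w]

/-- The relative interior of a convex set in terms of segments. -/
theorem mem_intrinsicInterior_iff_openSegment (hA : Convex ℝ A) :
    y ∈ intrinsicInterior ℝ A ↔ y ∈ A ∧ ∀ z ∈ A, ∃ u ∈ A, y ∈ openSegment ℝ z u := by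
  constructor
  · intro hy
    have hyA := intrinsicInterior_subset hy
    refine ⟨hyA, fun z hz => ?_⟩
    have hw : y - z ∈ vectorSpan ℝ A := vsub_mem_vectorSpan ℝ hyA hz
    obtain ⟨ε, hε, h⟩ := exists_add_smul_mem hy hw
    refine ⟨_, h (ε / 2) (by positivity) (by linarith), ?_⟩
    refine ⟨(ε / 2) / (1 + ε / 2), 1 / (1 + ε / 2), by positivity, by positivity, by field_simp; ring, ?_⟩
    match_scalars <;> field_simp
    ring
  · rintro ⟨hyA, h⟩
    obtain ⟨p, hp⟩ := Set.Nonempty.intrinsicInterior hA ⟨y, hyA⟩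
    obtain ⟨hpA, ε, hε, hball⟩ := mem_intrinsicInterior_iff_dist.1 hp
    obtain ⟨u, hu, a, b, ha, hb, hab, rfl⟩ := h p (intrinsicInterior_subset hp)
    refine mem_intrinsicInterior_iff_dist.2 ⟨subset_affineSpan ℝ A hyA, a * ε, by positivity,
      fun v hv hd => ?_⟩
    -- The homothety of ratio `a` centred at `u` carries a relative ball about `p` to one about `y`;
    -- this is the preimage of `v` under it.
    have h1 : p + a⁻¹ • (v - (a • p + b • u)) ∈ A := by
      refine hball _ ?_ ?_
      · rw [add_comm]
        exact AffineSubspace.vadd_mem_of_mem_direction (Submodule.smul_mem _ _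
          (AffineSubspace.vsub_mem_direction hv (subset_affineSpan ℝ A hyA))) hpA
      · rw [dist_eq_norm, add_sub_cancel_left, norm_smul, norm_inv, Real.norm_eq_abs,
          abs_of_pos ha, ← dist_eq_norm, inv_mul_lt_iff₀ ha]
        exact hd
    have h2 := hA h1 hu ha.le hb.le hab
    convert h2 using 1
    match_scalars <;> field_simp <;> ring

/-- The description by segments uses no metric, so it is invariant under projective maps. -/
theorem act_image_intrinsicInterior {g : GL4} (hg : IsOrientedIsometry g)
    (hg' : IsOrientedIsometry g⁻¹) (hA : Convex ℝ A) (hb : ∀ y ∈ A, ‖y‖ ≤ 1) :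
    act g '' intrinsicInterior ℝ A = intrinsicInterior ℝ (act g '' A) := by
  ext y
  rw [mem_intrinsicInterior_iff_openSegment (convex_act_image hg hg' hA hb)]
  constructor
  · rintro ⟨y, hy, rfl⟩
    rw [mem_intrinsicInterior_iff_openSegment hA] at hy
    refine ⟨⟨y, hy.1, rfl⟩, ?_⟩
    rintro _ ⟨z, hz, rfl⟩
    obtain ⟨u, hu, hyu⟩ := hy.2 z hz
    exact ⟨_, ⟨u, hu, rfl⟩, act_openSegment hg (hb z hz) (hb u hu) hyu⟩
  · rintro ⟨⟨y, hy, rfl⟩, h⟩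
    refine ⟨y, (mem_intrinsicInterior_iff_openSegment hA).2 ⟨hy, fun z hz => ?_⟩, rfl⟩
    obtain ⟨_, ⟨u, hu, rfl⟩, hyu⟩ := h _ ⟨z, hz, rfl⟩
    have := act_openSegment hg' (norm_act_le hg (hb z hz)) (norm_act_le hg (hb u hu)) hyu
    rw [act_inv_act hg (hb y hy), act_inv_act hg (hb z hz), act_inv_act hg (hb u hu)] at this
    exact ⟨u, hu, this⟩

end RelativeInterior

/-! ### Images of interiors and bodies on the same side of a face -/

section Openness

variable {g : GL4}

theorem continuousOn_act (hg : IsOrientedIsometry g) :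
    ContinuousOn (act g) (Metric.ball 0 1) := by
  have hlin : ∀ i, Continuous fun y : E3 => lin g (homog y) i := fun i => by
    have h1 : Continuous fun y : E3 => homog y := by
      refine continuous_pi fun j => ?_
      refine Fin.cases ?_ (fun k => ?_) j
      · simpa using continuous_const
      · simp only [homog_succ]; fun_prop
    exact (continuous_apply i).comp ((lin g).continuous_of_finiteDimensional.comp h1)
  have h2 : ContinuousOn (fun y : E3 => fun i : Fin 3 => lin g (homog y) i.succ / lin g (homog y) 0)
      (Metric.ball 0 1) := by
    refine continuousOn_pi.2 fun i => (hlin _).continuousOn.div (hlin 0).continuousOn fun y hy => ?_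
    exact (lin_homog_pos hg (by simpa using (Metric.mem_ball.1 hy).le)).ne'
  exact (PiLp.continuous_toLp 2 _).comp_continuousOn h2

theorem isOpen_act_image (hg : IsOrientedIsometry g) (hg' : IsOrientedIsometry g⁻¹) {U : Set E3}
    (hU : IsOpen U) (hb : U ⊆ Metric.ball 0 1) : IsOpen (act g '' U) := by
  have hlt : ∀ y : E3, ‖y‖ < 1 → ‖act g y‖ < 1 := fun y hy => by
    refine lt_of_le_of_ne (norm_act_le hg hy.le) fun h => hy.ne ?_
    rw [← act_inv_act hg hy.le]
    exact norm_act_eq_one hg' h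
  have : act g '' U = Metric.ball 0 1 ∩ act g⁻¹ ⁻¹' U := by
    ext y
    constructor
    · rintro ⟨z, hz, rfl⟩
      have hz1 : ‖z‖ < 1 := by simpa using hb hz
      refine ⟨by simpa using hlt z hz1, ?_⟩
      rwa [Set.mem_preimage, act_inv_act hg hz1.le]
    · rintro ⟨hy, hyU⟩
      refine ⟨_, hyU, ?_⟩
      have := act_inv_act hg' (y := y) (by simpa using (Metric.mem_ball.1 hy).le)
      rwa [inv_inv] at this
  rw [this]
  exact (continuousOn_act hg').isOpen_inter_preimage Metric.isOpen_ball hU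

theorem interior_subset_ball {A : Set E3} (hb : ∀ y ∈ A, ‖y‖ ≤ 1) :
    interior A ⊆ Metric.ball 0 1 := by
  rw [← interior_closedBall (0 : E3) one_ne_zero]
  exact interior_mono fun y hy => by simpa using hb y hy

theorem interior_act_image (hg : IsOrientedIsometry g) (hg' : IsOrientedIsometry g⁻¹) {A : Set E3}
    (hb : ∀ y ∈ A, ‖y‖ ≤ 1) : interior (act g '' A) = act g '' interior A := by
  apply Set.Subset.antisymm
  · have hb' : ∀ y ∈ act g '' A, ‖y‖ ≤ 1 := by
      rintro _ ⟨y, hy, rfl⟩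
      exact norm_act_le hg (hb y hy)
    have h1 := isOpen_act_image hg' (by rwa [inv_inv]) isOpen_interior (interior_subset_ball hb')
    have h2 : act g⁻¹ '' interior (act g '' A) ⊆ A := by
      rintro _ ⟨y, hy, rfl⟩
      obtain ⟨z, hz, rfl⟩ := interior_subset hy
      rwa [act_inv_act hg (hb z hz)]
    have h3 := interior_maximal h2 h1
    intro y hy
    refine ⟨act g⁻¹ y, h3 ⟨y, hy, rfl⟩, ?_⟩
    have := act_inv_act hg' (hb' y (interior_subset hy))
    rwa [inv_inv] at this
  · exact interior_maximal (Set.image_mono interior_subset)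
      (isOpen_act_image hg hg' isOpen_interior (interior_subset_ball hb))

/-- Two convex bodies on the same side of a common two-dimensional face overlap. -/
theorem interiors_overlap {F Q R : Set E3} (hF : Convex ℝ F) (hQ : Convex ℝ Q) (hR : Convex ℝ R)
    (hne : F.Nonempty) (hFQ : F ⊆ Q) (hFR : F ⊆ R) (hr : finrank ℝ (vectorSpan ℝ F) = 2)
    {l : Dual ℝ (Fin 4 → ℝ)} (hl : ∀ y ∈ F, l (homog y) = 0) {q r : E3} (hq : q ∈ interior Q)
    (hr' : r ∈ interior R) (hlq : 0 < l (homog q)) (hlr : 0 < l (homog r)) :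
    (interior Q ∩ interior R).Nonempty := by
  obtain ⟨p, hp⟩ := Set.Nonempty.intrinsicInterior hF hne
  have hpF := intrinsicInterior_subset hp
  have hsp : ∀ y z : E3, (l ∘ₗ spatial) (y - z) = l (homog y) - l (homog z) := fun y z => by
    rw [LinearMap.comp_apply, ← homog_sub_homog, map_sub]
  have hker : vectorSpan ℝ F = LinearMap.ker (l ∘ₗ spatial) := by
    apply Submodule.eq_of_le_of_finrank_eq
    · rw [vectorSpan_eq_span_vsub_set_right ℝ hpF, Submodule.span_le]
      rintro _ ⟨y, hy, rfl⟩
      show (l ∘ₗ spatial) (y - p) = 0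
      rw [hsp, hl y hy, hl p hpF, sub_zero]
    · have h0 : (l ∘ₗ spatial : Dual ℝ E3) ≠ 0 := fun h => by
        have := hsp q p
        rw [h, hl p hpF, LinearMap.zero_apply] at this
        linarith
      have := Module.Dual.finrank_ker_add_one_of_ne_zero h0
      rw [finrank_euclideanSpace_fin] at this
      omega
  -- With this ratio `q - p` and `κ (r - p)` have equal height over the plane of `F`, so their
  -- difference is parallel to `F`. Then `((1 - t + κt) p + t q) / (1 + κt)` equals a point on the
  -- segment from `p + t w ∈ F` to `r`, and it is interior to both bodies.
  set κ := l (homog q) / l (homog r) with hκ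
  have hκ0 : 0 < κ := div_pos hlq hlr
  have hw : (q - p) - κ • (r - p) ∈ vectorSpan ℝ F := by
    rw [hker, LinearMap.mem_ker, map_sub, map_smul, hsp, hsp, hl p hpF, hκ, smul_eq_mul]
    field_simp
    ring
  obtain ⟨ε, hε, h⟩ := exists_add_smul_mem hp hw
  obtain ⟨t, ht0, htε, ht1⟩ : ∃ t : ℝ, 0 < t ∧ t < ε ∧ t < 1 :=
    ⟨min ε 1 / 2, by positivity, by linarith [min_le_left ε 1, lt_min hε one_pos],
      by linarith [min_le_right ε 1, lt_min hε one_pos]⟩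
  have hD : 0 < 1 + κ * t := by positivity
  have hz1 := hR.combo_self_interior_mem_interior (hFR (h t ht0.le htε)) hr'
    (by positivity : 0 ≤ 1 / (1 + κ * t)) (by positivity : 0 < κ * t / (1 + κ * t))
    (by field_simp)
  have h2 : 0 ≤ (1 - t + κ * t) / (1 + κ * t) := by
    have := mul_pos hκ0 ht0
    exact div_nonneg (by linarith) hD.le
  have hz2 := hQ.combo_self_interior_mem_interior (hFQ hpF) hq h2
    (by positivity : 0 < t / (1 + κ * t)) (by field_simp; ring)
  refine ⟨_, hz2, ?_⟩
  convert hz1 using 1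
  match_scalars <;> field_simp <;> ring

end Openness

/-! ### Cells of the quotient and classes of faces -/

section Gluing

variable {S : Finset E3} {P : Set E3} {G : Subgroup GL4} {F : Set E3} {g : GL4} {k : ℕ}

theorem norm_le_one_of_mem (hS : ∀ s ∈ S, ‖s‖ = 1) (hP : P = convexHull ℝ (S : Set E3)) {y : E3}
    (hy : y ∈ P) : ‖y‖ ≤ 1 := by
  have h1 : convexHull ℝ (S : Set E3) ⊆ Metric.closedBall 0 1 :=
    convexHull_min (fun s hs => by simpa using (hS s hs).le) (convex_closedBall _ _)
  simpa using h1 (hP ▸ hy)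

/-- By strict convexity of the ball, a point of the sphere is not a convex combination of other
points of the sphere. -/
theorem mem_of_norm_eq_one (hS : ∀ s ∈ S, ‖s‖ = 1) {y : E3}
    (hy : y ∈ convexHull ℝ (S : Set E3)) (h1 : ‖y‖ = 1) : y ∈ S := by
  obtain ⟨w, hw, hw1, hwy⟩ := Finset.mem_convexHull'.1 hy
  by_contra hyS
  have hlt : ∀ s ∈ S, inner ℝ y s < 1 := fun s hs =>
    inner_lt_one h1 (hS s hs) (by rintro rfl; exact hyS hs)
  have h2 : ∑ s ∈ S, w s * inner ℝ y s = 1 := by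
    have : inner ℝ y (∑ s ∈ S, w s • s) = 1 := by
      rw [hwy, real_inner_self_eq_norm_sq, h1]; norm_num
    rw [inner_sum] at this
    simpa [inner_smul_right] using this
  have h3 : ∑ s ∈ S, w s * (1 - inner ℝ y s) = 0 := by
    simp only [mul_sub, mul_one, Finset.sum_sub_distrib, hw1, h2, sub_self]
  rw [Finset.sum_eq_zero_iff_of_nonneg fun s hs => mul_nonneg (hw s hs) (sub_pos.2 (hlt s hs)).le] at h3
  have h4 : ∀ s ∈ S, w s = 0 := fun s hs =>
    (mul_eq_zero.1 (h3 s hs)).resolve_right (sub_pos.2 (hlt s hs)).ne'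
  rw [Finset.sum_eq_zero h4] at hw1
  norm_num at hw1

theorem exists_face_functional {A : Set E3} (hA : A ∈ faces P k) :
    ∃ l : Dual ℝ (Fin 4 → ℝ), (∀ y ∈ P, 0 ≤ l (homog y)) ∧ A = {y ∈ P | l (homog y) = 0} :=
  (isExposed_iff hA.1).1 hA.2.1

theorem face_subset {A : Set E3} (hA : A ∈ faces P k) : A ⊆ P := hA.2.1.subset

theorem face_convex (hP : P = convexHull ℝ (S : Set E3)) {A : Set E3} (hA : A ∈ faces P k) :
    Convex ℝ A := hA.2.1.convex (hP ▸ convex_convexHull ℝ _)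

/-- A nonnegative functional that vanishes inside a segment vanishes at its ends, and every point of
`A` is the end of a segment in `A` through `y`. -/
theorem face_subset_of_mem (hP : P = convexHull ℝ (S : Set E3)) {A B : Set E3} {m : ℕ}
    (hA : A ∈ faces P k) (hB : B ∈ faces P m) {y : E3} (hy : y ∈ intrinsicInterior ℝ A)
    (hyB : y ∈ B) : A ⊆ B := by
  obtain ⟨l, hl, rfl⟩ := exists_face_functional hB
  intro z hz
  obtain ⟨u, hu, a, b, ha, hb, hab, hyu⟩ :=
    ((mem_intrinsicInterior_iff_openSegment (face_convex hP hA)).1 hy).2 z hz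
  have h1 := hyB.2
  rw [← hyu, homog_combo hab, map_add, map_smul, map_smul, smul_eq_mul, smul_eq_mul] at h1
  have h2 := mul_nonneg ha.le (hl z (face_subset hA hz))
  have h3 := mul_nonneg hb.le (hl u (face_subset hA hu))
  exact ⟨face_subset hA hz, (mul_eq_zero.1 (by linarith : a * l (homog z) = 0)).resolve_left ha.ne'⟩

theorem face_eq_of_mem (hP : P = convexHull ℝ (S : Set E3)) {A B : Set E3} {m : ℕ}
    (hA : A ∈ faces P k) (hB : B ∈ faces P m) {y : E3} (hy : y ∈ intrinsicInterior ℝ A)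
    (hyB : y ∈ intrinsicInterior ℝ B) : A = B :=
  (face_subset_of_mem hP hA hB hy (intrinsicInterior_subset hyB)).antisymm
    (face_subset_of_mem hP hB hA hyB (intrinsicInterior_subset hy))

theorem eval_lin_inv_act (hg : IsOrientedIsometry g) (l : Dual ℝ (Fin 4 → ℝ)) {y : E3}
    (hy : ‖y‖ ≤ 1) : ∃ c : ℝ, 0 < c ∧ (l ∘ₗ lin g⁻¹) (homog (act g y)) = c * l (homog y) :=
  ⟨_, inv_pos.2 (lin_homog_pos hg hy), by
    rw [LinearMap.comp_apply, homog_act hg hy, map_smul, lin_inv_lin, map_smul, smul_eq_mul]⟩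

/-- Face pairings carry subfaces to faces. -/
theorem act_face (hS : ∀ s ∈ S, ‖s‖ = 1) (hP : P = convexHull ℝ (S : Set E3))
    (hG : ∀ g ∈ G, IsOrientedIsometry g) (hg : IsFacePairing G P F g) {A : Set E3}
    (hA : A ∈ faces P k) (hAF : A ⊆ F) : act g '' A ∈ faces P k := by
  classical
  have hgi := hG g hg.mem
  have hb : ∀ y ∈ P, ‖y‖ ≤ 1 := fun y hy => norm_le_one_of_mem hS hP hy
  obtain ⟨l, hl, hlA⟩ := exists_face_functional hA
  have htarget := hg.target
  rw [hP, mem_faces_iff] at htarget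
  obtain ⟨U, -, hU, -, hUF⟩ := htarget
  -- The transported functional is known to be nonnegative only on `g F`. It exposes the image of
  -- `A` within the face `g F`, and a face of a face is a face of `P`.
  set m := l ∘ₗ lin g⁻¹ with hm
  have hmU : ∀ s ∈ U, 0 ≤ m (vert S s) := by
    intro s hs
    have h1 : (s : E3) ∈ act g '' F := hUF ▸ mem_hull hs
    obtain ⟨y, hy, hys⟩ := h1
    have hyP := face_subset hg.source hy
    obtain ⟨c, hc, h2⟩ := eval_lin_inv_act hgi l (hb y hyP)
    rw [vert, ← hys, h2]
    exact mul_nonneg hc.le (hl y hyP)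
  set T : Finset S := U.filter fun s => m (vert S s) = 0 with hT
  have hTU : T ⊆ U := Finset.filter_subset _ _
  have hmT : ∀ s ∈ U, 0 ≤ m (vert S s) ∧ (m (vert S s) = 0 ↔ s ∈ T) := fun s hs =>
    ⟨hmU s hs, by simp [hT, hs]⟩
  have hhull : act g '' A = hull T := by
    rw [← hull_inter_zero hTU hmT, ← hUF]
    ext y
    constructor
    · rintro ⟨z, hz, rfl⟩
      refine ⟨⟨z, hAF hz, rfl⟩, ?_⟩
      obtain ⟨c, hc, h2⟩ := eval_lin_inv_act hgi l (hb z (face_subset hA hz))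
      rw [hlA] at hz
      rw [h2, hz.2, mul_zero]
    · rintro ⟨⟨z, hz, rfl⟩, h0⟩
      have hzP := face_subset hg.source hz
      obtain ⟨c, hc, h2⟩ := eval_lin_inv_act hgi l (hb z hzP)
      rw [h2] at h0
      refine ⟨z, ?_, rfl⟩
      rw [hlA]
      exact ⟨hzP, (mul_eq_zero.1 h0).resolve_left hc.ne'⟩
  have hTne : T.Nonempty := hull_nonempty.1 (hhull ▸ hA.1.image _)
  rw [hP, mem_faces_iff]
  refine ⟨T, hTne, hU.of_subface hTU m hmT, ?_, hhull⟩
  rw [finrank_hull hTne, ← hhull, finrank_vectorSpan_act hgi fun y hy => hb y (face_subset hA hy),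
    hA.2.2]

theorem act_inv_image (hg : IsOrientedIsometry g) {A : Set E3} (hb : ∀ y ∈ A, ‖y‖ ≤ 1) :
    act g⁻¹ '' (act g '' A) = A := by
  rw [Set.image_image]
  exact (Set.image_congr fun y hy => act_inv_act hg (hb y hy)).trans (Set.image_id' A)

theorem pairing_inv (hS : ∀ s ∈ S, ‖s‖ = 1) (hP : P = convexHull ℝ (S : Set E3))
    (hG : ∀ g ∈ G, IsOrientedIsometry g) (hg : IsFacePairing G P F g) :
    IsFacePairing G P (act g '' F) g⁻¹ := by
  have hb : ∀ y ∈ P, ‖y‖ ≤ 1 := fun y hy => norm_le_one_of_mem hS hP hy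
  have hgi := hG g hg.mem
  have hgi' := hG _ (inv_mem hg.mem)
  refine ⟨inv_mem hg.mem, hg.target, ?_, ?_⟩
  · rw [act_inv_image hgi fun y hy => hb y (face_subset hg.source hy)]
    exact hg.source
  · rw [← hg.inter]
    ext y
    constructor
    · rintro ⟨⟨z, hz, rfl⟩, h⟩
      have h1 := act_inv_act hgi' (hb z hz)
      rw [inv_inv] at h1
      exact ⟨z, ⟨⟨_, h, h1⟩, hz⟩, rfl⟩
    · rintro ⟨z, ⟨⟨u, hu, rfl⟩, hz⟩, rfl⟩
      refine ⟨⟨_, hz, rfl⟩, ?_⟩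
      rwa [act_inv_act hgi (hb u hu)]

/-- The relation generating the gluing of `P`. -/
def glued (G : Subgroup GL4) (P : Set E3) (x y : P) : Prop :=
  ∃ F g, IsFacePairing G P F g ∧ (x : E3) ∈ F ∧ (y : E3) = act g x

theorem glued_face (hS : ∀ s ∈ S, ‖s‖ = 1) (hP : P = convexHull ℝ (S : Set E3))
    (hG : ∀ g ∈ G, IsOrientedIsometry g) (hg : IsFacePairing G P F g) {x : E3} (hx : x ∈ F)
    (A : faces P k) (hA : x ∈ intrinsicInterior ℝ (A : Set E3)) :
    ∃ B : faces P k, act g x ∈ intrinsicInterior ℝ (B : Set E3) ∧ identified G P k A B := by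
  have hAF := face_subset_of_mem hP A.2 hg.source hA hx
  refine ⟨⟨_, act_face hS hP hG hg A.2 hAF⟩, ?_, F, g, hg, hAF, rfl⟩
  rw [← act_image_intrinsicInterior (hG g hg.mem) (hG _ (inv_mem hg.mem)) (face_convex hP A.2)
    fun y hy => norm_le_one_of_mem hS hP (face_subset A.2 hy)]
  exact ⟨x, hA, rfl⟩

/-- The class of the open face containing a point is invariant under gluing. Stating both directions
together lets the induction pass through symmetry. -/
theorem faceClass_eq_of_glued (hS : ∀ s ∈ S, ‖s‖ = 1) (hP : P = convexHull ℝ (S : Set E3))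
    (hG : ∀ g ∈ G, IsOrientedIsometry g) {x y : P} (h : Relation.EqvGen (glued G P) x y) :
    (∀ A : faces P k, (x : E3) ∈ intrinsicInterior ℝ (A : Set E3) →
      ∃ B : faces P k, (y : E3) ∈ intrinsicInterior ℝ (B : Set E3) ∧
        faceClass G P k A = faceClass G P k B) ∧
    (∀ A : faces P k, (y : E3) ∈ intrinsicInterior ℝ (A : Set E3) →
      ∃ B : faces P k, (x : E3) ∈ intrinsicInterior ℝ (B : Set E3) ∧
        faceClass G P k A = faceClass G P k B) := by
  induction h with
  | rel x y h =>
    obtain ⟨F, g, hg, hx, hy⟩ := h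
    constructor
    · intro A hA
      obtain ⟨B, hB, hAB⟩ := glued_face hS hP hG hg hx A hA
      exact ⟨B, hy ▸ hB, Quot.sound hAB⟩
    · intro A hA
      have hy' : (y : E3) ∈ act g '' F := ⟨x, hx, hy.symm⟩
      obtain ⟨B, hB, hAB⟩ := glued_face hS hP hG (pairing_inv hS hP hG hg) hy' A hA
      rw [hy, act_inv_act (hG g hg.mem) (norm_le_one_of_mem hS hP x.2)] at hB
      exact ⟨B, hB, Quot.sound hAB⟩
  | refl x => exact ⟨fun A hA => ⟨A, hA, rfl⟩, fun A hA => ⟨A, hA, rfl⟩⟩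
  | symm x y _ ih => exact ih.symm
  | trans x y z _ _ ih1 ih2 =>
    constructor
    · intro A hA
      obtain ⟨B, hB, h1⟩ := ih1.1 A hA
      obtain ⟨C, hC, h2⟩ := ih2.1 B hB
      exact ⟨C, hC, h1.trans h2⟩
    · intro A hA
      obtain ⟨B, hB, h1⟩ := ih2.2 A hA
      obtain ⟨C, hC, h2⟩ := ih1.2 B hB
      exact ⟨C, hC, h1.trans h2⟩

/-- The open cell of a face in the quotient space. -/
def cell (G : Subgroup GL4) (P : Set E3) (A : Set E3) : Set (QuotientSpace G P) :=
  Quot.mk _ '' {x : P | (x : E3) ∈ intrinsicInterior ℝ A}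

theorem cell_eq_of_identified (hS : ∀ s ∈ S, ‖s‖ = 1) (hP : P = convexHull ℝ (S : Set E3))
    (hG : ∀ g ∈ G, IsOrientedIsometry g) {A B : faces P k} (h : identified G P k A B) :
    cell G P (A : Set E3) = cell G P (B : Set E3) := by
  obtain ⟨F, g, hg, hAF, hB⟩ := h
  have himg := act_image_intrinsicInterior (hG g hg.mem) (hG _ (inv_mem hg.mem))
    (face_convex hP A.2) fun y hy => norm_le_one_of_mem hS hP (face_subset A.2 hy)
  rw [← hB] at himg
  ext c
  constructor
  · rintro ⟨x, hx, rfl⟩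
    have h1 : act g x ∈ intrinsicInterior ℝ (B : Set E3) := himg ▸ ⟨_, hx, rfl⟩
    refine ⟨⟨act g x, face_subset B.2 (intrinsicInterior_subset h1)⟩, h1, ?_⟩
    exact (Quot.sound ⟨F, g, hg, hAF (intrinsicInterior_subset hx), rfl⟩).symm
  · rintro ⟨y, hy, rfl⟩
    have h1 : (y : E3) ∈ intrinsicInterior ℝ (B : Set E3) := hy
    rw [← himg] at h1
    obtain ⟨x, hx, hxy⟩ := h1
    have hxA := intrinsicInterior_subset hx
    exact ⟨⟨x, face_subset A.2 hxA⟩, hx, Quot.sound ⟨F, g, hg, hAF hxA, hxy.symm⟩⟩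

/-- A common point of two cells comes from glued points in the relative interiors of the faces, and
a point lies in the relative interior of only one face. -/
theorem cell_eq_iff (hS : ∀ s ∈ S, ‖s‖ = 1) (hP : P = convexHull ℝ (S : Set E3))
    (hG : ∀ g ∈ G, IsOrientedIsometry g) {A B : faces P k} :
    cell G P (A : Set E3) = cell G P (B : Set E3) ↔ faceClass G P k A = faceClass G P k B := by
  constructor
  · intro h
    obtain ⟨x, hx⟩ := Set.Nonempty.intrinsicInterior (face_convex hP A.2) A.2.1
    have hxP := face_subset A.2 (intrinsicInterior_subset hx)
    have h1 : (Quot.mk _ ⟨x, hxP⟩ : QuotientSpace G P) ∈ cell G P (B : Set E3) :=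
      h ▸ ⟨⟨x, hxP⟩, hx, rfl⟩
    obtain ⟨y, hy, hyx⟩ := h1
    obtain ⟨B', hB', h2⟩ := (faceClass_eq_of_glued (k := k) hS hP hG (Quot.eqvGen_exact hyx)).2 A hx
    rw [h2, Subtype.ext (face_eq_of_mem hP B'.2 B.2 hB' hy)]
  · intro h
    have := Quot.eqvGen_exact h
    clear h
    induction this with
    | rel A B h => exact cell_eq_of_identified hS hP hG h
    | refl A => rfl
    | symm A B _ ih => exact ih.symm
    | trans A B C _ _ ih1 ih2 => exact ih1.trans ih2

theorem ncard_quotientCells (hS : ∀ s ∈ S, ‖s‖ = 1) (hP : P = convexHull ℝ (S : Set E3))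
    (hG : ∀ g ∈ G, IsOrientedIsometry g) :
    (quotientCells G P k).ncard = Nat.card (FaceClass G P k) := by
  let f : FaceClass G P k → Set (QuotientSpace G P) :=
    Quot.lift (fun A : faces P k => cell G P (A : Set E3)) fun A B h =>
      cell_eq_of_identified hS hP hG h
  have hf : Function.Injective f := by
    rintro ⟨A⟩ ⟨B⟩ h
    exact (cell_eq_iff hS hP hG).1 h
  have hrange : quotientCells G P k = Set.range f := by
    ext c
    constructor
    · rintro ⟨A, hA, rfl⟩
      exact ⟨faceClass G P k ⟨A, hA⟩, rfl⟩
    · rintro ⟨⟨A⟩, rfl⟩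
      exact ⟨A, A.2, rfl⟩
  rw [hrange, ← Nat.card_coe_set_eq, Nat.card_range_of_injective hf]

end Gluing

/-! ### Uniqueness of face pairings and absence of self-paired faces -/

section Pairings

variable {S : Finset E3} {P : Set E3} {G : Subgroup GL4} {F : Set E3} {g : GL4}

/-- An interior point lies strictly between a vertex off the facet, where the normal is positive,
and a point of `P`, where it is nonnegative. -/
theorem normal_pos_of_mem_interior (hx : IsVertexFamily (vert S))
    (hP : P = convexHull ℝ (S : Set E3)) {T : Finset S} (hT : T ∈ facets (vert S)) {q : E3}
    (hq : q ∈ interior P) : 0 < normal (vert S) T (homog q) := by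
  have hTf := (mem_facets.1 hT).1
  have hnn : ∀ y ∈ P, 0 ≤ normal (vert S) T (homog y) := fun y hy =>
    eval_nonneg_of_mem_hull (T := Finset.univ) (fun s _ => hTf.normal_nonneg s)
      (by rwa [hull_univ, ← hP])
  obtain ⟨i, hi⟩ := hx.exists_notMem hT
  have hiP : (i : E3) ∈ P := by
    rw [hP, ← hull_univ]
    exact mem_hull (Finset.mem_univ i)
  obtain ⟨u, hu, a, b, ha, hb, hab, rfl⟩ := ((mem_intrinsicInterior_iff_openSegment
    (hP ▸ convex_convexHull ℝ _)).1 (interior_subset_intrinsicInterior hq)).2 i hiP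
  have h1 := mul_pos ha (hTf.normal_pos hi)
  have h2 := mul_nonneg hb.le (hnn u hu)
  rw [homog_combo hab, map_add, map_smul, map_smul, smul_eq_mul, smul_eq_mul]
  exact add_pos_of_pos_of_nonneg h1 h2

/-- The neighbour `g P` of `P` along `F = g F'` lies on the other side of `F`. -/
theorem normal_neg_of_mem_interior_act (hS : ∀ s ∈ S, ‖s‖ = 1)
    (hint : (interior P).Nonempty) (hx : IsVertexFamily (vert S))
    (hP : P = convexHull ℝ (S : Set E3)) (hG : ∀ g ∈ G, IsOrientedIsometry g)
    (hg : IsFacePairing G P F g) {T : Finset S} (hT : T ∈ facets (vert S))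
    (hFT : act g '' F = hull T) {q : E3} (hq : q ∈ interior (act g '' P)) :
    normal (vert S) T (homog q) < 0 := by
  have hb : ∀ y ∈ P, ‖y‖ ≤ 1 := fun y hy => norm_le_one_of_mem hS hP hy
  have hgi := hG g hg.mem
  have hgi' := hG _ (inv_mem hg.mem)
  have hTf := (mem_facets.1 hT).1
  have hsource := hg.source
  rw [hP, mem_faces_two hx] at hsource
  obtain ⟨U, hU, rfl⟩ := hsource
  have hUf := (mem_facets.1 hU).1
  -- The functional of the source face, carried over by `g`, is positive on the interior of `g P`
  -- and vanishes on the target face, so only the sign of its factor `c` is in question.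
  obtain ⟨c, hc⟩ := hx.eq_smul_normal hT (l := normal (vert S) U ∘ₗ lin g⁻¹) fun s hs => by
    have h1 : (s : E3) ∈ act g '' hull U := hFT ▸ mem_hull hs
    obtain ⟨y, hy, hys⟩ := h1
    obtain ⟨c, -, h⟩ := eval_lin_inv_act hgi (normal (vert S) U)
      (hb y (face_subset hg.source hy))
    rw [vert, ← hys, h, eval_eq_zero_of_mem_hull (fun s hs => hUf.normal_eq_zero.2 hs) hy, mul_zero]
  have hpos : ∀ r ∈ interior (act g '' P), 0 < c * normal (vert S) T (homog r) := by
    intro r hr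
    rw [interior_act_image hgi hgi' hb] at hr
    obtain ⟨y, hy, rfl⟩ := hr
    obtain ⟨d, hd, h⟩ := eval_lin_inv_act hgi (normal (vert S) U) (hb y (interior_subset hy))
    have h1 := mul_pos hd (normal_pos_of_mem_interior hx hP hU hy)
    rw [← h, hc] at h1
    exact h1
  -- For `c ≥ 0` the bodies `P` and `g P` would lie on the same side of the common face and overlap
  -- in interior points, although they meet only along that face.
  have hcneg : c < 0 := by
    by_contra! hc0
    obtain ⟨p, hp⟩ := hint
    obtain ⟨r, hr1, hr2⟩ := interiors_overlap (F := hull T) (Q := P) (R := act g '' P)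
      (convex_hull T) (hP ▸ convex_convexHull ℝ _)
      (convex_act_image hgi hgi' (hP ▸ convex_convexHull ℝ _) hb)
      (hFT ▸ hg.target.1) (hFT ▸ face_subset hg.target)
      (hFT ▸ Set.image_mono (face_subset hg.source)) (hFT ▸ hg.target.2.2)
      (fun y hy => eval_eq_zero_of_mem_hull (fun s hs => hTf.normal_eq_zero.2 hs) hy) hp hq
      (normal_pos_of_mem_interior hx hP hT hp) (pos_of_mul_pos_right (hpos q hq) hc0)
    have hr : r ∈ hull T := by
      rw [← hFT, ← hg.inter]
      exact ⟨interior_subset hr2, interior_subset hr1⟩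
    have h1 := normal_pos_of_mem_interior hx hP hT hr1
    rw [eval_eq_zero_of_mem_hull (fun s hs => hTf.normal_eq_zero.2 hs) hr] at h1
    exact lt_irrefl _ h1
  have := hpos q hq
  by_contra! h
  have := mul_nonneg (neg_nonneg.2 hcneg.le) h
  linarith

/-- A face has only one face pairing. -/
theorem pairing_unique (hS : ∀ s ∈ S, ‖s‖ = 1) (hint : (interior P).Nonempty)
    (hx : IsVertexFamily (vert S)) (hP : P = convexHull ℝ (S : Set E3))
    (hG : ∀ g ∈ G, IsOrientedIsometry g)
    (hdisj : ∀ g ∈ G, g ≠ 1 → Disjoint (act g '' interior P) (interior P)) {g' : GL4}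
    (hg : IsFacePairing G P F g) (hg' : IsFacePairing G P F g') : g = g' := by
  have hb : ∀ y ∈ P, ‖y‖ ≤ 1 := fun y hy => norm_le_one_of_mem hS hP hy
  have hbF : ∀ y ∈ F, ‖y‖ ≤ 1 := fun y hy => hb y (face_subset hg.source hy)
  have hsource := hg.source
  rw [hP, mem_faces_two hx] at hsource
  obtain ⟨T, hT, hFT⟩ := hsource
  have hTf := (mem_facets.1 hT).1
  have i1 := hG _ hg.mem
  have i2 := hG _ (inv_mem hg.mem)
  have i3 := hG _ hg'.mem
  have i4 := hG _ (inv_mem hg'.mem)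
  have p1 := pairing_inv hS hP hG hg
  have p2 := pairing_inv hS hP hG hg'
  have e1 : act g⁻¹ '' (act g '' F) = hull T := by rw [act_inv_image i1 hbF, hFT]
  have e2 : act g'⁻¹ '' (act g' '' F) = hull T := by rw [act_inv_image i3 hbF, hFT]
  have hPc : Convex ℝ P := hP ▸ convex_convexHull ℝ _
  have n1 := fun q hq => normal_neg_of_mem_interior_act hS hint hx hP hG p1 hT e1 (q := q) hq
  have n2 := fun q hq => normal_neg_of_mem_interior_act hS hint hx hP hG p2 hT e2 (q := q) hq
  rw [interior_act_image i2 (by rwa [inv_inv]) hb] at n1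
  rw [interior_act_image i4 (by rwa [inv_inv]) hb] at n2
  obtain ⟨p, hp⟩ := hint
  -- Both neighbours `g⁻¹ P` and `g'⁻¹ P` lie across `F`, so their interiors meet. Unless `g = g'`,
  -- the element `g' g⁻¹` then contradicts the disjointness of translates.
  obtain ⟨r, hr1, hr2⟩ := interiors_overlap (F := hull T) (Q := act g⁻¹ '' P) (R := act g'⁻¹ '' P)
    (l := -normal (vert S) T)
    (convex_hull T) (convex_act_image i2 (by rwa [inv_inv]) hPc hb)
    (convex_act_image i4 (by rwa [inv_inv]) hPc hb)
    (hFT ▸ hg.source.1) (e1 ▸ Set.image_mono (face_subset hg.target))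
    (e2 ▸ Set.image_mono (face_subset hg'.target)) (hFT ▸ hg.source.2.2)
    (fun y hy => by
      rw [LinearMap.neg_apply, eval_eq_zero_of_mem_hull (fun s hs => hTf.normal_eq_zero.2 hs) hy,
        neg_zero])
    (q := act g⁻¹ p) (r := act g'⁻¹ p)
    (by rw [interior_act_image i2 (by rwa [inv_inv]) hb]; exact ⟨p, hp, rfl⟩)
    (by rw [interior_act_image i4 (by rwa [inv_inv]) hb]; exact ⟨p, hp, rfl⟩)
    (by simpa using n1 _ ⟨p, hp, rfl⟩) (by simpa using n2 _ ⟨p, hp, rfl⟩)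
  rw [interior_act_image i2 (by rwa [inv_inv]) hb] at hr1
  rw [interior_act_image i4 (by rwa [inv_inv]) hb] at hr2
  obtain ⟨y, hy, rfl⟩ := hr1
  obtain ⟨z, hz, hzy⟩ := hr2
  by_contra hne
  have hmem : g' * g⁻¹ ∈ G := mul_mem hg'.mem (inv_mem hg.mem)
  refine Set.disjoint_left.1 (hdisj _ hmem fun h => hne ?_) ⟨y, hy, rfl⟩ ?_
  · exact (mul_inv_eq_one.1 h).symm
  · rw [act_mul _ i2 (hb y (interior_subset hy)), ← hzy]
    have := act_inv_act i4 (hb z (interior_subset hz))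
    rw [inv_inv] at this
    rwa [this]

theorem spatialPart_add (X Y : Fin 4 → ℝ) : spatialPart (X + Y) = spatialPart X + spatialPart Y := by
  ext i; simp [spatialPart]

theorem lin_future {g : GL4} (hg : IsOrientedIsometry g) {X : Fin 4 → ℝ}
    (hX : ‖spatialPart X‖ < X 0) : ‖spatialPart (lin g X)‖ < lin g X 0 := by
  obtain ⟨h0, h1⟩ := lin_time_pos hg ((norm_nonneg _).trans_lt hX) hX.le
  refine lt_of_le_of_ne h1 fun h => ?_
  have h2 : mink (lin g X) (lin g X) = mink X X := hg.form X X
  rw [mink_self, mink_self, h, sub_self] at h2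
  have := pow_lt_pow_left₀ hX (norm_nonneg _) two_ne_zero
  linarith

theorem future_sum {X : ℕ → Fin 4 → ℝ} (hX : ∀ j, ‖spatialPart (X j)‖ < X j 0) (n : ℕ) :
    ‖spatialPart (∑ j ∈ Finset.range (n + 1), X j)‖ < (∑ j ∈ Finset.range (n + 1), X j) 0 := by
  induction n with
  | zero => simpa using hX 0
  | succ n ih =>
    rw [Finset.sum_range_succ, spatialPart_add, Pi.add_apply]
    exact (norm_add_le _ _).trans_lt (add_lt_add ih (hX _))

/-- An isometry that carries a two-dimensional face to itself fixes a point of hyperbolic space. -/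
theorem exists_fixed_point (hS : ∀ s ∈ S, ‖s‖ = 1) (hx : IsVertexFamily (vert S))
    (hpow : ∀ n : ℕ, IsOrientedIsometry (g ^ n)) {T : Finset S} (hT : T ∈ facets (vert S))
    (hgT : act g '' hull T = hull T) : ∃ y ∈ hyperbolicSpace, act g y = y := by
  have hTf := (mem_facets.1 hT).1
  have hg : IsOrientedIsometry g := by simpa using hpow 1
  -- The isometry preserves the sphere, and the only points of `P` there are its vertices; so it
  -- permutes the vertices of the face.
  have hmaps : ∀ s : T, ∃ t : T, act g s = t := by
    rintro ⟨s, hs⟩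
    have h1 : act g s ∈ hull T := hgT ▸ ⟨_, mem_hull hs, rfl⟩
    have h2 : act g s ∈ S := mem_of_norm_eq_one hS
      (hull_univ S ▸ hull_mono (Finset.subset_univ T) h1) (norm_act_eq_one hg (hS s s.2))
    exact ⟨⟨⟨_, h2⟩, hTf.mem_of_mem_hull h1⟩, rfl⟩
  choose f hf using hmaps
  have hinj : Function.Injective f := fun s t h => by
    have h1 : act g s = act g t := by rw [hf, hf, h]
    have h2 := congrArg homog h1
    rw [homog_act hg (hS _ s.1.2).le, homog_act hg (hS _ t.1.2).le, ← map_smul, ← map_smul] at h2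
    have h3 := lin_injective g h2
    have h4 := congrFun h3 0
    simp only [Pi.smul_apply, homog_zero, smul_eq_mul, mul_one] at h4
    rw [h4] at h3
    have h5 := smul_right_injective _ (inv_pos.2 (lin_homog_pos hg (hS _ t.1.2).le)).ne' h3
    exact Subtype.ext (Subtype.ext (homog_injective h5))
  set σ : Equiv.Perm T := Equiv.ofBijective f (Finite.injective_iff_bijective.1 hinj) with hσ
  have hiter : ∀ (n : ℕ) (s : T), act (g ^ n) s = ((σ ^ n) s : T) := by
    intro n
    induction n with
    | zero => intro s; simp
    | succ n ih =>
      intro s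
      rw [pow_succ', pow_succ', act_mul _ (hpow n) (hS _ s.1.2).le, ih, hf]
      rfl
  -- A power of `g` fixes every vertex of the face. Writing the exponent as `m + 1` makes the later
  -- orbit sum visibly nonempty.
  obtain ⟨m, hm⟩ : ∃ m : ℕ, m + 1 = orderOf σ :=
    ⟨orderOf σ - 1, Nat.sub_add_cancel (orderOf_pos σ)⟩
  have hfix : ∀ s : T, act (g ^ (m + 1)) s = s := fun s => by
    rw [hiter, hm, pow_orderOf_eq_one]
    rfl
  have hM := hpow (m + 1)
  set c : T → ℝ := fun s => lin (g ^ (m + 1)) (homog s) 0 with hc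
  have hcpos : ∀ s, 0 < c s := fun s => lin_homog_pos hM (hS _ s.1.2).le
  have heig : ∀ s : T, lin (g ^ (m + 1)) (homog s) = c s • homog s := fun s => by
    conv_lhs => rw [lin_homog hM (hS _ s.1.2).le, hfix]
  -- The power preserves the nonzero products of the null eigenvectors, so any two eigenvalues have
  -- product one. With three vertices and positive eigenvalues, all of them are one.
  have hprod : ∀ s t : T, s ≠ t → c s * c t = 1 := by
    intro s t hst
    have h1 : mink (lin (g ^ (m + 1)) (homog s)) (lin (g ^ (m + 1)) (homog t)) =
        mink (homog s) (homog t) := hM.form _ _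
    rw [heig, heig, mink_smul_smul] at h1
    have h2 := (mink_homog_neg (hS _ s.1.2) (hS _ t.1.2) fun h =>
      hst (Subtype.ext (Subtype.ext h))).ne
    exact mul_right_cancel₀ h2 (h1.trans (one_mul _).symm)
  obtain ⟨a, ha, b, hb, d, hd, hab, had, hbd⟩ := Finset.two_lt_card.1 (hx.three_le_card hT)
  have pab := hprod ⟨a, ha⟩ ⟨b, hb⟩ (by simpa using hab)
  have pad := hprod ⟨a, ha⟩ ⟨d, hd⟩ (by simpa using had)
  have pbd := hprod ⟨b, hb⟩ ⟨d, hd⟩ (by simpa using hbd)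
  have hca : c ⟨a, ha⟩ = 1 := by
    have h1 : c ⟨b, hb⟩ = c ⟨d, hd⟩ := mul_left_cancel₀ (hcpos _).ne' (pab.trans pad.symm)
    rw [h1, ← sq] at pbd
    rw [(pow_eq_one_iff_of_nonneg (hcpos _).le two_ne_zero).1 pbd, mul_one] at pad
    exact pad
  have hcb : c ⟨b, hb⟩ = 1 := by rwa [hca, one_mul] at pab
  set X : Fin 4 → ℝ := homog a + homog b with hX
  have hXfix : lin (g ^ (m + 1)) X = X := by
    have h1 := heig ⟨a, ha⟩
    have h2 := heig ⟨b, hb⟩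
    rw [hca, one_smul] at h1
    rw [hcb, one_smul] at h2
    rw [hX, map_add, h1, h2]
  have hXfut : ‖spatialPart X‖ < X 0 := by
    rw [hX, spatialPart_add, spatialPart_homog, spatialPart_homog]
    have h1 := inner_lt_one (hS _ a.2) (hS _ b.2) fun h => hab (Subtype.ext h)
    have h2 := norm_add_sq_real (a : E3) b
    rw [hS _ a.2, hS _ b.2] at h2
    have h3 : (homog a + homog b) 0 = 2 := by simp; norm_num
    rw [h3]
    exact lt_of_pow_lt_pow_left₀ 2 (by norm_num) (by linarith)
  -- The sum of two distinct future null vectors is timelike and fixed by `g ^ (m + 1)`. Its orbit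
  -- sum under `g` is fixed by `g` and remains future timelike, so it is a point of hyperbolic
  -- space.
  set U := ∑ j ∈ Finset.range (m + 1), lin (g ^ j) X with hU
  have hUfut : ‖spatialPart U‖ < U 0 := future_sum (fun j => lin_future (hpow j) hXfut) m
  have hU0 : 0 < U 0 := (norm_nonneg _).trans_lt hUfut
  have hUfix : lin g U = U := by
    rw [hU, map_sum]
    have h1 : ∀ j, lin g (lin (g ^ j) X) = lin (g ^ (j + 1)) X := fun j => by
      rw [← lin_mul, ← pow_succ']
    simp only [h1]
    rw [Finset.sum_range_succ, hXfix, Finset.sum_range_succ' (fun j => lin (g ^ j) X)]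
    simp
  refine ⟨dehomog U, ?_, ?_⟩
  · have h1 : dehomog U = (U 0)⁻¹ • spatialPart U := by
      ext i; simp [dehomog, spatialPart, div_eq_inv_mul]
    rw [hyperbolicSpace, mem_ball_zero_iff, h1, norm_smul, norm_inv, Real.norm_eq_abs,
      abs_of_pos hU0, inv_mul_lt_iff₀ hU0, mul_one]
    exact hUfut
  · rw [act_eq, homog_dehomog hU0.ne', map_smul, dehomog_smul (inv_ne_zero hU0.ne'), hUfix]

/-- A self-paired face yields a fixed point in hyperbolic space. The identity is excluded because it
meets `P` along all of `P`, not along a face. -/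
theorem act_face_ne (hS : ∀ s ∈ S, ‖s‖ = 1) (hx : IsVertexFamily (vert S))
    (hP : P = convexHull ℝ (S : Set E3)) (hG : ∀ g ∈ G, IsOrientedIsometry g)
    (hg : IsFacePairing G P F g) (hell : ¬ IsElliptic g) : act g '' F ≠ F := by
  intro hF
  have hsource := hg.source
  rw [hP, mem_faces_two hx] at hsource
  obtain ⟨T, hT, rfl⟩ := hsource
  refine hell ⟨?_, exists_fixed_point hS hx (fun n => hG _ (pow_mem hg.mem n)) hT hF⟩
  rintro rfl
  have h1 := hg.inter
  simp only [act_one, Set.image_id', Set.inter_self] at h1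
  obtain ⟨i, hi⟩ := hx.exists_notMem hT
  refine hi ((mem_facets.1 hT).1.mem_of_mem_hull ?_)
  rw [← h1, hP, ← hull_univ]
  exact mem_hull (Finset.mem_univ i)

/-- A fixed-point-free involution has half as many orbits as points. -/
theorem two_mul_card_quot {α : Type*} [Finite α] (σ : α → α) (hσ : ∀ a, σ (σ a) = a)
    (hne : ∀ a, σ a ≠ a) : 2 * Nat.card (Quot fun a b => b = σ a) = Nat.card α := by
  classical
  have := Fintype.ofFinite α
  have : Fintype (Quot fun a b => b = σ a) := Fintype.ofFinite _
  have hmk : ∀ a b, (Quot.mk (fun a b => b = σ a) a = Quot.mk (fun a b => b = σ a) b) ↔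
      a = b ∨ a = σ b := by
    intro a b
    constructor
    · intro h
      have h' := Quot.eqvGen_exact h
      clear h
      induction h' with
      | rel a b h => rw [h, hσ]; exact Or.inr rfl
      | refl a => exact Or.inl rfl
      | symm a b _ ih =>
        rcases ih with h | h
        · exact Or.inl h.symm
        · exact Or.inr (by rw [h, hσ])
      | trans a b c _ _ ih1 ih2 =>
        rcases ih1 with h | h <;> rcases ih2 with h' | h' <;> simp [h, h', hσ]
    · rintro (rfl | rfl)
      · rfl
      · exact (Quot.sound (r := fun a b => b = σ a) rfl).symm
  rw [Nat.card_eq_fintype_card, Nat.card_eq_fintype_card, ← Finset.card_univ (α := α),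
    Finset.card_eq_sum_card_fiberwise (f := Quot.mk fun a b => b = σ a) (t := Finset.univ)
      fun _ _ => Finset.mem_univ _, Finset.sum_const_nat (m := 2), Finset.card_univ, mul_comm]
  rintro ⟨a⟩ -
  rw [Finset.card_eq_two]
  refine ⟨a, σ a, (hne a).symm, Finset.ext fun b => ?_⟩
  simp [hmk]

end Pairings

/-! ### Numbers of faces, angles and classes -/

section Counting

variable {S : Finset E3} {P : Set E3} {G : Subgroup GL4}

theorem bijective_hull_facets (hx : IsVertexFamily (vert S)) (hP : P = convexHull ℝ (S : Set E3)) :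
    Function.Bijective (fun T : facets (vert S) =>
      (⟨hull T.1, hP ▸ (mem_faces_two hx).2 ⟨T, T.2, rfl⟩⟩ : faces P 2)) := by
  constructor
  · intro T U h
    exact Subtype.ext ((mem_facets.1 T.2).1.hull_inj (mem_facets.1 U.2).1 (congrArg Subtype.val h))
  · rintro ⟨F, hF⟩
    obtain ⟨T, hT, rfl⟩ := (mem_faces_two hx).1 (hP ▸ hF)
    exact ⟨⟨T, hT⟩, rfl⟩

theorem bijective_hull_edges (hx : IsVertexFamily (vert S)) (hP : P = convexHull ℝ (S : Set E3)) :
    Function.Bijective (fun T : edges (vert S) =>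
      (⟨hull T.1, hP ▸ (mem_faces_one hx).2 ⟨T, T.2, rfl⟩⟩ : faces P 1)) := by
  constructor
  · intro T U h
    exact Subtype.ext ((mem_edges.1 T.2).1.hull_inj (mem_edges.1 U.2).1 (congrArg Subtype.val h))
  · rintro ⟨F, hF⟩
    obtain ⟨T, hT, rfl⟩ := (mem_faces_one hx).1 (hP ▸ hF)
    exact ⟨⟨T, hT⟩, rfl⟩

theorem bijective_hull_vertices (hx : IsVertexFamily (vert S))
    (hP : P = convexHull ℝ (S : Set E3)) :
    Function.Bijective (fun s : S =>
      (⟨hull {s}, hP ▸ (mem_faces_zero hx).2 ⟨s, rfl⟩⟩ : faces P 0)) := by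
  constructor
  · intro s t h
    exact Finset.singleton_injective ((hx.vertex s).hull_inj (hx.vertex t) (congrArg Subtype.val h))
  · rintro ⟨F, hF⟩
    obtain ⟨s, rfl⟩ := (mem_faces_zero hx).1 (hP ▸ hF)
    exact ⟨s, rfl⟩

theorem ncard_faces_two (hx : IsVertexFamily (vert S)) (hP : P = convexHull ℝ (S : Set E3)) :
    (faces P 2).ncard = (facets (vert S)).card := by
  rw [← Nat.card_coe_set_eq, ← Nat.card_eq_of_bijective _ (bijective_hull_facets hx hP)]
  simp

theorem ncard_faces_one (hx : IsVertexFamily (vert S)) (hP : P = convexHull ℝ (S : Set E3)) :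
    (faces P 1).ncard = (edges (vert S)).card := by
  rw [← Nat.card_coe_set_eq, ← Nat.card_eq_of_bijective _ (bijective_hull_edges hx hP)]
  simp

theorem ncard_faces_zero (hx : IsVertexFamily (vert S)) (hP : P = convexHull ℝ (S : Set E3)) :
    (faces P 0).ncard = Fintype.card S := by
  rw [← Nat.card_coe_set_eq, ← Nat.card_eq_of_bijective _ (bijective_hull_vertices hx hP)]
  simp

/-- The dihedral angles of an ideal polyhedron sum to `π` times the excess of edges over
vertices. -/
theorem sum_dihedralAngle (hS : ∀ s ∈ S, ‖s‖ = 1) (hx : IsVertexFamily (vert S)) :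
    ∑ e ∈ edges (vert S), dihedralAngle (convexHull ℝ (S : Set E3)) (hull e) =
      Real.pi * ((edges (vert S)).card - Fintype.card S) := by
  classical
  set f : Finset S → ℝ := fun e => Real.pi - dihedralAngle (convexHull ℝ (S : Set E3)) (hull e)
    with hf
  have h1 : ∑ v : S, ∑ e ∈ (edges (vert S)).filter (fun e => v ∈ e), f e =
      Fintype.card S * (2 * Real.pi) := by
    rw [Finset.sum_congr rfl fun v _ => by convert sum_exterior_angles hS hx v]
    simp
  -- Each edge is counted at both of its ends.
  have h2 : ∑ v : S, ∑ e ∈ (edges (vert S)).filter (fun e => v ∈ e), f e =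
      ∑ e ∈ edges (vert S), 2 * f e := by
    simp_rw [Finset.sum_filter]
    rw [Finset.sum_comm]
    refine Finset.sum_congr rfl fun e he => ?_
    rw [← Finset.sum_filter, Finset.sum_const, Finset.filter_univ_mem, (mem_edges.1 he).2]
    simp
  rw [h2, ← Finset.mul_sum] at h1
  simp only [hf, Finset.sum_sub_distrib, Finset.sum_const, nsmul_eq_mul] at h1
  linarith

/-- Each class of two-dimensional faces consists of two faces. -/
theorem two_mul_card_faceClass (hS : ∀ s ∈ S, ‖s‖ = 1) (hint : (interior P).Nonempty)
    (hx : IsVertexFamily (vert S)) (hP : P = convexHull ℝ (S : Set E3))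
    (hG : ∀ g ∈ G, IsOrientedIsometry g) (hGP : IsFundamentalPolyhedron G P)
    (hell : ∀ (F : Set E3) (g : GL4), IsFacePairing G P F g → ¬ IsElliptic g) :
    2 * Nat.card (FaceClass G P 2) = (facets (vert S)).card := by
  have : Finite (faces P 2) := Finite.of_surjective _ (bijective_hull_facets hx hP).2
  have hpair := hGP.pairing
  choose! p hp using hpair
  set σ : faces P 2 → faces P 2 := fun F => ⟨act (p F) '' F, (hp F F.2).target⟩ with hσ
  -- A polygonal face lies in no other polygonal face, and its pairing is unique; so direct
  -- identification is the graph of `σ`.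
  have hid : identified G P 2 = fun A B => B = σ A := by
    ext A B
    constructor
    · rintro ⟨F, g, hg, hAF, hB⟩
      have hAF' : (A : Set E3) = F := by
        have hm : ∀ F, F ∈ faces P 2 → ∃ T ∈ facets (vert S), F = hull T := fun F hF => by
          rw [hP, mem_faces_two hx] at hF
          exact hF
        obtain ⟨T, hT, hTA⟩ := hm _ A.2
        obtain ⟨U, hU, hUF⟩ := hm _ hg.source
        rw [hTA, hUF] at hAF ⊢
        rw [IsVertexFamily.facets_eq_of_subset hT hU ((mem_facets.1 hU).1.hull_subset_iff.1 hAF)]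
      subst hAF'
      have := pairing_unique hS hint hx hP hG hGP.disjoint hg (hp A A.2)
      exact Subtype.ext (by rw [hB, this])
    · rintro rfl
      exact ⟨A, p A, hp A A.2, subset_rfl, rfl⟩
  rw [FaceClass, hid, two_mul_card_quot σ, Nat.card_coe_set_eq, ncard_faces_two hx hP]
  · intro F
    have h1 := pairing_inv hS hP hG (hp F F.2)
    -- By uniqueness the pairing of the target face is the inverse one, which makes `σ` an
    -- involution.
    have h2 := pairing_unique hS hint hx hP hG hGP.disjoint h1 (hp (σ F) (σ F).2)
    apply Subtype.ext
    show act (p (σ F)) '' (act (p F) '' F) = F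
    rw [← h2, act_inv_image (hG _ (hp F F.2).mem)
      fun y hy => norm_le_one_of_mem hS hP (face_subset F.2 hy)]
  · intro F h
    exact act_face_ne hS hx hP hG (hp F F.2) (hell _ _ (hp F F.2)) (congrArg Subtype.val h)

theorem ncard_quotientCells_three (hx : IsVertexFamily (vert S))
    (hP : P = convexHull ℝ (S : Set E3)) : (quotientCells G P 3).ncard = 1 := by
  rw [Set.ncard_eq_one]
  refine ⟨cell G P P, Set.ext fun c => ?_⟩
  have h3 : ∀ A, A ∈ faces P 3 ↔ A = P := fun A => by rw [hP, mem_faces_three hx]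
  constructor
  · rintro ⟨A, hA, rfl⟩
    rw [(h3 A).1 hA]
    rfl
  · rintro rfl
    exact ⟨P, (h3 P).2 rfl, rfl⟩

end Counting

end IdealPolyhedra

/-! ### The two counts combined -/

open IdealPolyhedra

theorem proposition4p1
    (G : Subgroup (Matrix.GeneralLinearGroup (Fin 4) ℝ)) (hG : IsKleinian G)
    (P : Set E3) (hP : IsIdealPolyhedron P) (hGP : IsFundamentalPolyhedron G P)
    (hell : ∀ (F : Set E3) (g : Matrix.GeneralLinearGroup (Fin 4) ℝ),
      IsFacePairing G P F g → ¬ IsElliptic g)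
    (hangle : ∀ c : FaceClass G P 1,
      ∑ᶠ e : {e : faces P 1 // faceClass G P 1 e = c}, dihedralAngle P (e : faces P 1)
        = 2 * Real.pi) :
    (Nat.card (FaceClass G P 1) : ℚ)
        = (((faces P 1).ncard : ℚ) - ((faces P 0).ncard : ℚ)) / 2 ∧
      (Nat.card (FaceClass G P 0) : ℤ) = quotientEulerChar G P := by
  classical
  obtain ⟨S', hfin, hsub, hPS, hint⟩ := hP
  obtain ⟨S, rfl⟩ := hfin.exists_finset_coe
  have hS : ∀ s ∈ S, ‖s‖ = 1 := fun s hs => by simpa [idealBoundary] using hsub hs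
  have hx : IsVertexFamily (vert S) := isVertexFamily hS (hPS ▸ hint)
  have hbij := bijective_hull_edges hx hPS
  have : Finite (faces P 1) := Finite.of_surjective _ hbij.2
  have : Fintype (faces P 1) := Fintype.ofFinite _
  have : Finite (FaceClass G P 1) := Finite.of_surjective (faceClass G P 1) Quot.mk_surjective
  have : Fintype (FaceClass G P 1) := Fintype.ofFinite _
  have h1 : ∑ e : faces P 1, dihedralAngle P (e : Set E3) =
      Nat.card (FaceClass G P 1) * (2 * Real.pi) := by
    rw [← Fintype.sum_fiberwise (faceClass G P 1), Finset.sum_congr rfl fun c _ =>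
      (finsum_eq_sum_of_fintype _).symm.trans (hangle c)]
    simp
  have h2 : ∑ e : faces P 1, dihedralAngle P (e : Set E3) =
      Real.pi * ((edges (vert S)).card - Fintype.card S) := by
    rw [← sum_dihedralAngle hS hx, ← Finset.sum_coe_sort (edges (vert S)), ← hPS]
    exact (hbij.sum_comp fun e : faces P 1 => dihedralAngle P (e : Set E3)).symm
  -- The angle sum computed over edge classes equals the one computed over vertices; cancelling `π`
  -- leaves an identity of natural numbers.
  have hE : (edges (vert S)).card = 2 * Nat.card (FaceClass G P 1) + Fintype.card S := by
    have h3 : ((edges (vert S)).card : ℝ) = 2 * Nat.card (FaceClass G P 1) + Fintype.card S := by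
      apply mul_left_cancel₀ Real.pi_ne_zero
      linarith
    exact_mod_cast h3
  refine ⟨?_, ?_⟩
  · rw [ncard_faces_one hx hPS, ncard_faces_zero hx hPS, hE]
    push_cast
    ring
  · have hF := two_mul_card_faceClass hS hint hx hPS hG.isometry hGP hell
    have heuler := hx.euler
    have h3 : Nat.card (FaceClass G P 3) = 1 := by
      rw [← ncard_quotientCells hS hPS hG.isometry, ncard_quotientCells_three hx hPS]
    simp only [quotientEulerChar, Finset.sum_range_succ, Finset.sum_range_zero,
      ncard_quotientCells hS hPS hG.isometry, h3]
    -- The number of vertices cancels from Euler's formula and leaves one more face class than edge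
    -- classes, so in the alternating sum all terms but `V` cancel.
    rw [hE, ← hF] at heuler
    push_cast
    have : (2 * (Nat.card (FaceClass G P 1) : ℤ) + Fintype.card S) + 2 =
      Fintype.card S + 2 * Nat.card (FaceClass G P 2) := by exact_mod_cast heuler
    linarith
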